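/- **Setting.** Let $\iota$ be a finite or countable index set, $\ell_2=\ell_2(\iota)$ with coordinate vectors $\delta_k$, let $d\ge 0$ and $\tau\ge 1$ be integers, and put $\nu(\lambda)=|1-e^{i\lambda\tau}|^{2d}/\lambda^{2d}$ and $w(\lambda)=(1-e^{-i\lambda\tau})^d/(i\lambda)^d$ for $\lambda\in(-\pi,\pi]$. A *spectral density* is a (strongly) measurable function $f(\lambda)=\{f_{kn}(\lambda)\}$ on $(-\pi,\pi]$ whose values are almost everywhere positive bounded operators on $\ell_2$, with $\int\nu\|f\|\,d\lambda<\infty$. Let $a=(a_0,a_1,\dots)$, $a_j\in\ell_2$, be the coefficient vectors of the functional $A\xi$, let $\sum_k d_\tau(k)x^k=(\sum_j x^{\tau j})^d$ and $b_j=(D^\tau a)_j=\sum_{m\le j}d_\tau(j-m)a_m$, and assume $\sum_j (j+1)\|b_j\|<\infty$; put $B(e^{-i\lambda})=\sum_{j\ge0}b_je^{-i\lambda j}$. The functional is $A\xi=\sum_{j\ge0}b_j^\top\vec\xi_{-j}$, where $\vec\xi_j,\vec\eta_j$ are uncorrelated centred stationary increment sequences with spectral densities $f,g$, that is $E\xi_{kl}\overline{\xi_{nj}}=\frac1{2\pi}\int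 e^{i\lambda(l-j)}\nu f_{kn}\,d\lambda$ and similarly for $\eta$; it is estimated from $\vec\xi_j+\vec\eta_j$, $j\le0$. Let $L_2^0(f+g)$ be the closed linear span in $L_2(f+g)$ of the functions $e^{i\lambda j}w(\lambda)\delta_k$, $j\le0$, $k\in\iota$, among measurable $\ell_2$-valued functions, and for such functions $h$ let $$\Delta(h;f,g)=\frac1{2\pi}\int_{-\pi}^{\pi}\Big[(wB-h)^\top f\,\overline{(wB-h)}+h^\top g\,\overline h\Big]d\lambda,\qquad \Delta(f,g)=\inf_{h\in L_2^0(f+g)}\Delta(h;f,g).$$ Given a set $D$ of pairs of densities, $(f^0,g^0)\in D$ is *least favourable* in $D$ if $\Delta(f^0,g^0)=\max_{(f,g)\in D}\Delta(f,g)$; a function $h\in H_D=\bigcap_{(f,g)\in D}L_2^0(f+g)$ is *minimax-robust* if it minimises $\sup_{(f,g)\in D}\Delta(h;f,g)$ over $H_D$. The pair $(f,g)$ satisfies the *minimality condition* if $f+g$ is boundedly invertible almost everywhere and $\int\nu^{-1}\|(f+g)^{-1}\|d\lambda<\infty$. For such a pair let $P_\tau,R,Q_\tau$ be the operators given by the block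 matrices with $(l,j)$ blocks ($l,j\ge0$) $$\frac1{2\pi}\int e^{-i\lambda(l-j)}\nu^{-1}\big((f+g)^{-1}\big)^{\top}d\lambda,\quad \frac1{2\pi}\int e^{-i\lambda(l+1+j)}\big(f(f+g)^{-1}\big)^\top d\lambda,\quad \frac1{2\pi}\int e^{i\lambda(l-j)}\nu\big(f(f+g)^{-1}g\big)^\top d\lambda .$$ Here $P_\tau^{-1}Rb$ is the limit, in the norm $\langle P_\tau x,x\rangle^{1/2}$, of finitely supported $x_n$ with $P_\tau x_n\to Rb$ entrywise, and $\langle Rb,P_\tau^{-1}Rb\rangle=\lim\langle Rb,x_n\rangle$ (the usual meaning if $P_\tau$ is bounded and boundedly invertible on $\ell_2$); $C(e^{i\lambda})=\sum_{j\ge0}(P_\tau^{-1}Rb)_je^{i\lambda(j+1)}$ is the limit of the corresponding trigonometric polynomials $X_n$ for the same norm, $\frac1{2\pi}\int\nu^{-1}X^\top(f+g)^{-1}\overline X\,d\lambda$. **Classes.** Let $p,q\ge0$, $p_k,q_k$ be numbers, $P,Q$ matrices, $B_1,B_2$ positive bounded operators, $\langle B,f\rangle=\mathrm{Tr}(B^{1/2}fB^{1/2})$,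 $0\le\varepsilon\le1$ and $g_1$ a spectral density. $D_0^1,D_0^2,D_0^3,D_0^4$ are the sets of spectral densities $f$ with, respectively, $\frac1{2\pi}\int f=P$ (entrywise); $\frac1{2\pi}\int\mathrm{Tr} f=p$; $\frac1{2\pi}\int f_{kk}=p_k$ for all $k$; $\frac1{2\pi}\int\langle B_1,f\rangle=p$. $D_\varepsilon^1,D_\varepsilon^2,D_\varepsilon^3,D_\varepsilon^4$ are the sets of spectral densities $g$ for which there is a spectral density $W$ with, almost everywhere, respectively, $\mathrm{Tr}\,g=(1-\varepsilon)\mathrm{Tr}\,g_1+\varepsilon\mathrm{Tr}\,W$ and $\frac1{2\pi}\int\mathrm{Tr}\,g=q$; $g_{kk}=(1-\varepsilon)(g_1)_{kk}+\varepsilon W_{kk}$ and $\frac1{2\pi}\int g_{kk}=q_k$ for all $k$; $\langle B_2,g\rangle=(1-\varepsilon)\langle B_2,g_1\rangle+\varepsilon\langle B_2,W\rangle$ and $\frac1{2\pi}\int\langle B_2,g\rangle=q$; $g=(1-\varepsilon)g_1+\varepsilon W$ and $\frac1{2\pi}\int g=Q$ (entrywise). **Equations.** With $(C^{f})^\top=\nu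 B^\top g^0+C^\top$, $(C^{g})^\top=\nu B^\top f^0-C^\top$ and $S=f^0+g^0$ ($C$ formed from $f^0,g^0$), the $k$-th pair of equations is $\nu^{-1}C^f(C^f)^*=SM_fS$, $\nu^{-1}C^g(C^g)^*=SM_gS$ almost everywhere, for some Lagrange multipliers, where - $k=1$: $M_f=\vec\alpha\vec\alpha^*$, $M_g=\alpha^2+\gamma$, $\gamma(\lambda)\le0$, $\gamma=0$ where $\mathrm{Tr}\,g^0>(1-\varepsilon)\mathrm{Tr}\,g_1$; - $k=2$: $M_f=\alpha^2$, $M_g=\mathrm{diag}(\alpha_k^2+\gamma_k)$, $\gamma_k(\lambda)\le0$, $\gamma_k=0$ where $g^0_{kk}>(1-\varepsilon)(g_1)_{kk}$; - $k=3$: $M_f=\mathrm{diag}(\alpha_k^2)$, $M_g=(\alpha^2+\gamma)B_2^\top$, $\gamma(\lambda)\le0$, $\gamma=0$ where $\langle B_2,g^0\rangle>(1-\varepsilon)\langle B_2,g_1\rangle$; - $k=4$: $M_f=\alpha^2B_1^\top$, $M_g=\vec\alpha\vec\alpha^*+\Gamma$, $\Gamma(\lambda)\le0$, $\Gamma=0$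 where $g^0>(1-\varepsilon)g_1$. **Theorem 5.** Let $k\in\{1,2,3,4\}$ and $D=D_0^k\times D_\varepsilon^k$. 1. Let $(f^0,g^0)\in D$ satisfy the $k$-th pair of equations and the minimality condition, and solve the constrained optimization problem: $\langle Rb,P_\tau^{-1}Rb\rangle+\langle Q_\tau b,b\rangle$ attains at $(f^0,g^0)$ its maximum over the pairs in $D$ that satisfy the minimality condition. Then $(f^0,g^0)$ are least favourable in $D$ for the optimal linear filtering of $A\xi$; the function $C$ of $(f^0,g^0)$ exists; the function $h^0$ given by $$(h^0)^\top=wB^\top f^0(f^0+g^0)^{-1}-\frac{(-i\lambda)^d}{(1-e^{i\lambda\tau})^d}C^\top(f^0+g^0)^{-1}$$ is the spectral characteristic of the optimal estimate for $(f^0,g^0)$, and it is, up to equality almost everywhere, the unique minimax-robust spectral characteristic for $D$. 2. The same holds for every $(f^0,g^0)\in D$ that satisfies the minimality condition and solves the optimization problem, whether or not it was found from the equations. 3. For $(f,g)\in D$, $\Delta(f,g)$ is the mean square error of the orthogonal projection: for all square integrable sequences $\vec\xi,\vec\eta$ as above on a probability space, it is the squared $L_2$-distance from $A\xi$ to the closed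 linear span of the $\xi_{kj}+\eta_{kj}$, $j\le0$. -/

import Mathlib

open MeasureTheory Filter Topology Complex
open scoped NNReal ENNReal lp

noncomputable section

namespace MinimaxFilter

/-! ## The coordinate space, matrices of operators, bilinear row notation -/

/-- The space `ℓ₂` of (column) vectors `(x_k)_{k ∈ ι}`. -/
abbrev H (ι : Type*) := ℓ²(ι, ℂ)

section Operators

variable {ι : Type*}

open Classical in
/-- The coordinate vector `δ_k`. -/
def delta (k : ι) : H ι := lp.single 2 k (1 : ℂ)

/-- The `(k, n)` entry of the matrix of a bounded operator. -/
def entry (A : H ι →L[ℂ] H ι) (k n : ι) : ℂ := (A (delta n) : H ι) k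

/-- Entrywise complex conjugation on `ℓ₂`, as a continuous conjugate-linear map. -/
def conjCLM (ι : Type*) : H ι →L⋆[ℂ] H ι :=
  ((starₗᵢ ℂ : H ι ≃ₗᵢ⋆[ℂ] H ι).toContinuousLinearEquiv : H ι →L⋆[ℂ] H ι)

/-- The transpose `Aᵀ` of a bounded operator (the entrywise conjugate of the adjoint). -/
def transp (A : H ι →L[ℂ] H ι) : H ι →L[ℂ] H ι :=
  ((conjCLM ι).comp (ContinuousLinearMap.adjoint A)).comp (conjCLM ι)

theorem transp_apply (A : H ι →L[ℂ] H ι) (x : H ι) :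
    transp A x = star (ContinuousLinearMap.adjoint A (star x)) := rfl

/-- The row vector `xᵀ A`, written as a column: `(xᵀ A)ᵀ = Aᵀ x`. -/
def rowMul (x : H ι) (A : H ι →L[ℂ] H ι) : H ι := transp A x

/-- The real part of the form `xᵀ A x̄` (which is real for Hermitian `A`). -/
def quad (A : H ι →L[ℂ] H ι) (x : H ι) : ℝ := (inner ℂ (star x) (A (star x))).re

/-- The rank one operator `x x*`. -/
def outer (x : H ι) : H ι →L[ℂ] H ι := InnerProductSpace.rankOne ℂ x x

/-- The trace of a positive operator, as an element of `[0, ∞]`. -/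
def opTrace (A : H ι →L[ℂ] H ι) : ℝ≥0∞ := ∑' k, ENNReal.ofReal (entry A k k).re

/-- The positive square root of a positive operator on a Hilbert space. -/
def opSqrt {E : Type*} [NormedAddCommGroup E] [InnerProductSpace ℂ E] [CompleteSpace E]
    (B : E →L[ℂ] E) : E →L[ℂ] E := CFC.sqrt B

/-- `⟨B, A⟩ = Tr (B A)` for positive operators, as an element of `[0, ∞]`; it is written as
`Tr (B^{1/2} A B^{1/2})`, so that it is defined for all positive `A`. -/
def pairing (B A : H ι →L[ℂ] H ι) : ℝ≥0∞ := opTrace (opSqrt B * A * opSqrt B)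

end Operators

/-! ## Weights -/

/-- The measure `dλ / 2π` on `(-π, π]`. -/
def circ : Measure ℝ :=
  ENNReal.ofReal (1 / (2 * Real.pi)) • volume.restrict (Set.Ioc (-Real.pi) Real.pi)

/-- `(1 - e^{-iλτ})^d / (iλ)^d`. -/
def incr (d τ : ℕ) (l : ℝ) : ℂ := (1 - exp (-(I * l * τ))) ^ d / (I * l) ^ d

/-- `|1 - e^{iλτ}|^{2d} / λ^{2d}`. -/
def wt (d τ : ℕ) (l : ℝ) : ℝ := ‖1 - exp (I * l * τ)‖ ^ (2 * d) / l ^ (2 * d)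

/-- `d_τ(k)`: `∑ d_τ(k) x^k = (∑ x^{τ j})^d`. -/
def dCoeff (d τ k : ℕ) : ℂ :=
  PowerSeries.coeff k ((PowerSeries.mk fun j => if τ ∣ j then (1 : ℂ) else 0) ^ d)

/-- `(D^τ a)_j = ∑_{m ≤ j} d_τ(j - m) a_m`. -/
def Dτ {ι : Type*} (d τ : ℕ) (a : ℕ → H ι) (j : ℕ) : H ι :=
  ∑ m ∈ Finset.range (j + 1), dCoeff d τ (j - m) • a m

section Filtering

variable {ι : Type*}

/-! ## Spectral densities -/

/-- Spectral densities of `d`-th increment sequences with step `τ`: measurable functions with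
values in the positive operators, integrable with the weight `|1 - e^{iλτ}|^{2d} / λ^{2d}`. -/
structure IsSpectralDensity (d τ : ℕ) (f : ℝ → H ι →L[ℂ] H ι) : Prop where
  measurable : ∀ x, AEStronglyMeasurable (fun l => f l x) circ
  positive : ∀ᵐ l ∂circ, (f l).IsPositive
  integrable : Integrable (fun l => wt d τ l * ‖f l‖) circ

/-- `(f(λ) + g(λ))⁻¹`. -/
def sumInv (f g : ℝ → H ι →L[ℂ] H ι) (l : ℝ) : H ι →L[ℂ] H ι := Ring.inverse (f l + g l)

/-- The minimality condition: `f + g` is invertible almost everywhere and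
`∫ λ^{2d} / |1 - e^{iλτ}|^{2d} (f(λ) + g(λ))⁻¹ dλ < ∞`. -/
structure Minimality (d τ : ℕ) (f g : ℝ → H ι →L[ℂ] H ι) : Prop where
  invertible : ∀ᵐ l ∂circ, IsUnit (f l + g l)
  integrable : Integrable (fun l => (wt d τ l)⁻¹ * ‖sumInv f g l‖) circ

/-! ## Estimates and mean square errors -/

/-- The squared norm of `h` in `L₂(S)`, `∫ hᵀ S h̄ dλ / 2π`. -/
def normSq (S : ℝ → H ι →L[ℂ] H ι) (h : ℝ → H ι) : ℝ≥0∞ :=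
  ∫⁻ l, ENNReal.ofReal (quad (S l) (h l)) ∂circ

/-- The functions `e^{-iλj} (1 - e^{-iλτ})^d (iλ)^{-d} δ_k`, `j ≥ 0`. -/
def observed (d τ : ℕ) (p : ℕ × ι) (l : ℝ) : H ι :=
  (exp (-(I * l * p.1)) * incr d τ l) • delta p.2

/-- `L₂⁰(S)`: the closed linear span of the functions `observed d τ (j, k)` in `L₂(S)`. -/
def L20 (d τ : ℕ) (S : ℝ → H ι →L[ℂ] H ι) : Set (ℝ → H ι) :=
  {h | AEStronglyMeasurable h circ ∧ ∃ p : ℕ → ℝ → H ι,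
    (∀ n, p n ∈ Submodule.span ℂ (Set.range (observed (ι := ι) d τ))) ∧
    Tendsto (fun n => normSq S (h - p n)) atTop (𝓝 0)}

/-- `B(e^{-iλ}) = ∑_j b_j e^{-iλj}`. -/
def symB (b : ℕ → H ι) (l : ℝ) : H ι := ∑' j : ℕ, exp (-(I * l * j)) • b j

/-- `Δ(h; f, g)`: the mean square error of the linear estimate with spectral characteristic `h` of
the functional with coefficients `b`, when signal and noise have spectral densities `f`, `g`. -/
def mse (d τ : ℕ) (b : ℕ → H ι) (h : ℝ → H ι) (f g : ℝ → H ι →L[ℂ] H ι) : ℝ≥0∞ :=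
  ∫⁻ l, (ENNReal.ofReal (quad (f l) (incr d τ l • symB b l - h l))
    + ENNReal.ofReal (quad (g l) (h l))) ∂circ

/-- `Δ(h(f, g); f, g)`: the mean square error of the optimal linear estimate. -/
def optMse (d τ : ℕ) (b : ℕ → H ι) (f g : ℝ → H ι →L[ℂ] H ι) : ℝ≥0∞ :=
  ⨅ h ∈ L20 d τ (f + g), mse d τ b h f g

/-- `h` is the spectral characteristic of the optimal linear estimate. -/
def IsOptimal (d τ : ℕ) (b : ℕ → H ι) (f g : ℝ → H ι →L[ℂ] H ι) (h : ℝ → H ι) : Prop :=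
  h ∈ L20 d τ (f + g) ∧ ∀ h' ∈ L20 d τ (f + g), mse d τ b h f g ≤ mse d τ b h' f g

/-! The same mean square error for random sequences. -/

/-- `ξ`, `η` are uncorrelated centred vector stationary (increment) sequences with spectral
densities `f`, `g`: `E ξ_{kl} \bar ξ_{nj} = (1/2π) ∫ e^{iλ(l-j)} |1-e^{iλτ}|^{2d} λ^{-2d} f_{kn}`. -/
structure IsRealization {Ω : Type*} [MeasurableSpace Ω] (d τ : ℕ) (f g : ℝ → H ι →L[ℂ] H ι)
    (μ : Measure Ω) (ξ η : ℤ → ι → Lp ℂ 2 μ) : Prop where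
  mean_ξ : ∀ j k, ∫ ω, ξ j k ω ∂μ = 0
  mean_η : ∀ j k, ∫ ω, η j k ω ∂μ = 0
  cov_ξ : ∀ l j k n, inner ℂ (ξ j n) (ξ l k) =
    ∫ t, exp (I * t * (l - j)) * wt d τ t * entry (f t) k n ∂circ
  cov_η : ∀ l j k n, inner ℂ (η j n) (η l k) =
    ∫ t, exp (I * t * (l - j)) * wt d τ t * entry (g t) k n ∂circ
  uncorrelated : ∀ l j k n, inner ℂ (ξ j n) (η l k) = 0

/-- The functional `∑_{j ≥ 0} b_jᵀ ξ_{-j}`. -/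
def functional {Ω : Type*} [MeasurableSpace Ω] {μ : Measure Ω} (b : ℕ → H ι)
    (ξ : ℤ → ι → Lp ℂ 2 μ) : Lp ℂ 2 μ := ∑' j : ℕ, ∑' k, (b j) k • ξ (-(j : ℤ)) k

/-- The closed linear span of the observations `ξ_{-j} + η_{-j}`, `j ≥ 0`. -/
def past {Ω : Type*} [MeasurableSpace Ω] {μ : Measure Ω}
    (ξ η : ℤ → ι → Lp ℂ 2 μ) : Submodule ℂ (Lp ℂ 2 μ) :=
  (Submodule.span ℂ
    (Set.range fun p : ℕ × ι => ξ (-(p.1 : ℤ)) p.2 + η (-(p.1 : ℤ)) p.2)).topologicalClosure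

/-! ## The operators `P_τ`, `R`, `Q_τ` -/

/-- The matrix of `P_τ`: the block `(l, j)` is the matrix
`(1/2π) ∫ e^{-iλ(l-j)} λ^{2d} / |1 - e^{iλτ}|^{2d} ((f + g)⁻¹)ᵀ dλ`. -/
def matP (d τ : ℕ) (f g : ℝ → H ι →L[ℂ] H ι) : Matrix (ℕ × ι) (ℕ × ι) ℂ := fun p q =>
  ∫ t, exp (-(I * t * ((p.1 : ℂ) - q.1))) * (wt d τ t)⁻¹ * entry (sumInv f g t) q.2 p.2 ∂circ

/-- The matrix of `R`: the block `(l, j)` is `(1/2π) ∫ e^{-iλ(l+1+j)} (f (f + g)⁻¹)ᵀ dλ`. -/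
def matR (f g : ℝ → H ι →L[ℂ] H ι) : Matrix (ℕ × ι) (ℕ × ι) ℂ := fun p q =>
  ∫ t, exp (-(I * t * ((p.1 : ℂ) + 1 + q.1))) * entry (f t * sumInv f g t) q.2 p.2 ∂circ

/-- The matrix of `Q_τ`: the block `(l, j)` is
`(1/2π) ∫ e^{iλ(l-j)} |1 - e^{iλτ}|^{2d} / λ^{2d} (f (f + g)⁻¹ g)ᵀ dλ`. -/
def matQ (d τ : ℕ) (f g : ℝ → H ι →L[ℂ] H ι) : Matrix (ℕ × ι) (ℕ × ι) ℂ := fun p q =>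
  ∫ t, exp (I * t * ((p.1 : ℂ) - q.1)) * wt d τ t
    * entry (f t * sumInv f g t * g t) q.2 p.2 ∂circ

/-- The sequence `b = D^τ a` as one vector indexed by `ℕ × ι`. -/
def stack (b : ℕ → H ι) (p : ℕ × ι) : ℂ := (b p.1) p.2

/-- A matrix applied to a vector. -/
def app {κ : Type*} (M : Matrix κ κ ℂ) (x : κ → ℂ) (p : κ) : ℂ := ∑' q, M p q * x q

/-- The quadratic form `⟨P x, x⟩` on finitely supported vectors. -/
def energy {κ : Type*} (P : Matrix κ κ ℂ) (x : κ →₀ ℂ) : ℝ :=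
  (∑ p ∈ x.support, app P x p * star (x p)).re

/-- The finitely supported vectors `x_n` converge to `P⁻¹ r`: they converge in the norm
`⟨P x, x⟩^{1/2}` of the positive (in general unbounded) operator `P`, and `P x_n → r` entrywise.
If `P` is bounded with a bounded inverse on `ℓ₂`, then this means that `x_n → P⁻¹ r` in `ℓ₂`. -/
def ConvergesToInv {κ : Type*} (P : Matrix κ κ ℂ) (r : κ → ℂ) (x : ℕ → κ →₀ ℂ) : Prop :=
  (∀ δ > 0, ∃ N, ∀ m ≥ N, ∀ n ≥ N, energy P (x m - x n) < δ) ∧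
  ∀ p, Tendsto (fun n => app P (x n) p) atTop (𝓝 (r p))

/-- `⟨r, P⁻¹ r⟩ = v`. -/
def HasInvForm {κ : Type*} (P : Matrix κ κ ℂ) (r : κ → ℂ) (v : ℝ) : Prop :=
  ∃ x : ℕ → κ →₀ ℂ, ConvergesToInv P r x ∧
    Tendsto (fun n => (∑ p ∈ (x n).support, r p * star (x n p)).re) atTop (𝓝 v)

/-- `⟨R b, P_τ⁻¹ R b⟩ + ⟨Q_τ b, b⟩ = v`. -/
def HasValue (d τ : ℕ) (b : ℕ → H ι) (f g : ℝ → H ι →L[ℂ] H ι) (v : ℝ) : Prop :=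
  ∃ u, HasInvForm (matP d τ f g) (app (matR f g) (stack b)) u ∧
    v = u + (∑' p, app (matQ d τ f g) (stack b) p * star (stack b p)).re

/-- `∑_j x_j e^{iλ(j+1)}` for a finitely supported `x`. -/
def symFin (x : ℕ × ι →₀ ℂ) (l : ℝ) : H ι :=
  ∑ p ∈ x.support, (x p * exp (I * l * ((p.1 : ℂ) + 1))) • delta p.2

/-- `C` is the function `C_τ(e^{iλ}) = ∑_j (P_τ⁻¹ R b)_j e^{iλ(j+1)}`: the limit of the functions
`∑_j (x_n)_j e^{iλ(j+1)}` along finitely supported `x_n → P_τ⁻¹ R b`, where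
`⟨P_τ x, x⟩ = (1/2π) ∫ λ^{2d} / |1 - e^{iλτ}|^{2d} Xᵀ (f + g)⁻¹ X̄ dλ`
for `X = ∑_j x_j e^{iλ(j+1)}`. -/
def IsSymbolC (d τ : ℕ) (b : ℕ → H ι) (f g : ℝ → H ι →L[ℂ] H ι) (C : ℝ → H ι) : Prop :=
  AEStronglyMeasurable C circ ∧ ∃ x : ℕ → ℕ × ι →₀ ℂ,
    ConvergesToInv (matP d τ f g) (app (matR f g) (stack b)) x ∧
    Tendsto (fun n => ∫⁻ l, ENNReal.ofReal
      ((wt d τ l)⁻¹ * quad (sumInv f g l) (C l - symFin (x n) l)) ∂circ) atTop (𝓝 0)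

/-- The spectral characteristic
`hᵀ = Bᵀ (1 - e^{-iλτ})^d (iλ)^{-d} f (f + g)⁻¹ - (-iλ)^d (1 - e^{iλτ})^{-d} Cᵀ (f + g)⁻¹`. -/
def spectralA (d τ : ℕ) (b : ℕ → H ι) (f g : ℝ → H ι →L[ℂ] H ι) (C : ℝ → H ι) (l : ℝ) : H ι :=
  incr d τ l • rowMul (symB b l) (f l * sumInv f g l)
    - ((-(I * l)) ^ d / (1 - exp (I * l * τ)) ^ d) • rowMul (C l) (sumInv f g l)

/-! ## Least favourable densities and minimax characteristics -/

/-- A pair of classes of spectral densities. -/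
abbrev DensityPairs (ι : Type*) := Set ((ℝ → H ι →L[ℂ] H ι) × (ℝ → H ι →L[ℂ] H ι))

/-- `(f⁰, g⁰)` are least favourable in `D` for the optimal linear filtering. -/
def IsLeastFavourable (d τ : ℕ) (b : ℕ → H ι) (D : DensityPairs ι)
    (f0 g0 : ℝ → H ι →L[ℂ] H ι) : Prop :=
  (f0, g0) ∈ D ∧ ∀ fg ∈ D, optMse d τ b fg.1 fg.2 ≤ optMse d τ b f0 g0

/-- `H_D = ⋂ L₂⁰(f + g)`. -/
def HD (d τ : ℕ) (D : DensityPairs ι) : Set (ℝ → H ι) := ⋂ fg ∈ D, L20 d τ (fg.1 + fg.2)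

/-- `h ∈ H_D` is minimax (robust): it minimises `sup_D Δ(h; f, g)` over `H_D`. -/
def IsMinimax (d τ : ℕ) (b : ℕ → H ι) (D : DensityPairs ι) (h : ℝ → H ι) : Prop :=
  h ∈ HD d τ D ∧ ∀ h' ∈ HD d τ D,
    ⨆ fg ∈ D, mse d τ b h fg.1 fg.2 ≤ ⨆ fg ∈ D, mse d τ b h' fg.1 fg.2

/-- `(f⁰, g⁰)` solve the constrained optimization problem
`⟨R b, P_τ⁻¹ R b⟩ + ⟨Q_τ b, b⟩ → max`; the operators are defined by the pairs `(f, g) ∈ D` that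
satisfy the minimality condition. -/
def SolvesProblem (d τ : ℕ) (b : ℕ → H ι) (D : DensityPairs ι)
    (f0 g0 : ℝ → H ι →L[ℂ] H ι) : Prop :=
  ∃ v0, HasValue d τ b f0 g0 v0 ∧ ∀ fg ∈ D, Minimality d τ fg.1 fg.2 →
    ∀ v, HasValue d τ b fg.1 fg.2 v → v ≤ v0

/-! ## The classes `D_0^k × D_ε^k` -/

/-- The given quantities in the definitions of the classes. -/
structure ClassData (ι : Type*) where
  /-- `P` -/
  P : Matrix ι ι ℂ
  /-- `p` -/
  p : ℝ≥0
  /-- `p_k` -/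
  pk : ι → ℝ
  /-- `B₁` -/
  B₁ : H ι →L[ℂ] H ι
  /-- `g₁(λ)` -/
  g₁ : ℝ → H ι →L[ℂ] H ι
  /-- `ε` -/
  ε : ℝ
  /-- `q` -/
  q : ℝ≥0
  /-- `q_k` -/
  qk : ι → ℝ
  /-- `B₂` -/
  B₂ : H ι →L[ℂ] H ι
  /-- `Q` -/
  Q : Matrix ι ι ℂ

/-- Standing assumptions on the given quantities. -/
structure ClassData.Valid (d τ : ℕ) (c : ClassData ι) : Prop where
  B₁_pos : c.B₁.IsPositive
  B₂_pos : c.B₂.IsPositive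
  ε_nonneg : 0 ≤ c.ε
  ε_le_one : c.ε ≤ 1
  g₁_density : IsSpectralDensity d τ c.g₁

/-- `(1/2π) ∫ u(λ) dλ = z`, with `u` integrable. -/
def HasIntegralEq (u : ℝ → ℂ) (z : ℂ) : Prop := Integrable u circ ∧ ∫ l, u l ∂circ = z

/-- The numbering `k = 1, 2, 3, 4` of the pairs of classes. -/
inductive ClassNo
  | one | two | three | four

/-- `D_0^k`. -/
def classD0 (d τ : ℕ) (c : ClassData ι) : ClassNo → Set (ℝ → H ι →L[ℂ] H ι)
  | .one => {f | IsSpectralDensity d τ f ∧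
      ∀ i j, HasIntegralEq (fun l => entry (f l) i j) (c.P i j)}
  | .two => {f | IsSpectralDensity d τ f ∧ ∫⁻ l, opTrace (f l) ∂circ = c.p}
  | .three => {f | IsSpectralDensity d τ f ∧
      ∀ i, HasIntegralEq (fun l => entry (f l) i i) (c.pk i)}
  | .four => {f | IsSpectralDensity d τ f ∧ ∫⁻ l, pairing c.B₁ (f l) ∂circ = c.p}

/-- `D_ε^k`; `W` is an unknown spectral density. -/
def classDε (d τ : ℕ) (c : ClassData ι) : ClassNo → Set (ℝ → H ι →L[ℂ] H ι)
  | .one => {g | IsSpectralDensity d τ g ∧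
      (∃ W : ℝ → H ι →L[ℂ] H ι, IsSpectralDensity d τ W ∧ ∀ᵐ l ∂circ, opTrace (g l) =
        ENNReal.ofReal (1 - c.ε) * opTrace (c.g₁ l) + ENNReal.ofReal c.ε * opTrace (W l)) ∧
      ∫⁻ l, opTrace (g l) ∂circ = c.q}
  | .two => {g | IsSpectralDensity d τ g ∧
      (∃ W : ℝ → H ι →L[ℂ] H ι, IsSpectralDensity d τ W ∧ ∀ᵐ l ∂circ, ∀ i, entry (g l) i i =
        (1 - c.ε) * entry (c.g₁ l) i i + c.ε * entry (W l) i i) ∧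
      ∀ i, HasIntegralEq (fun l => entry (g l) i i) (c.qk i)}
  | .three => {g | IsSpectralDensity d τ g ∧
      (∃ W : ℝ → H ι →L[ℂ] H ι, IsSpectralDensity d τ W ∧ ∀ᵐ l ∂circ, pairing c.B₂ (g l) =
        ENNReal.ofReal (1 - c.ε) * pairing c.B₂ (c.g₁ l)
          + ENNReal.ofReal c.ε * pairing c.B₂ (W l)) ∧
      ∫⁻ l, pairing c.B₂ (g l) ∂circ = c.q}
  | .four => {g | IsSpectralDensity d τ g ∧
      (∃ W : ℝ → H ι →L[ℂ] H ι, IsSpectralDensity d τ W ∧ ∀ᵐ l ∂circ,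
        g l = ((1 - c.ε : ℝ) : ℂ) • c.g₁ l + (c.ε : ℂ) • W l) ∧
      ∀ i j, HasIntegralEq (fun l => entry (g l) i j) (c.Q i j)}

/-- `D_0^k × D_ε^k`. -/
def classPair (d τ : ℕ) (c : ClassData ι) (k : ClassNo) : DensityPairs ι :=
  classD0 d τ c k ×ˢ classDε d τ c k

/-! ## The equations with Lagrange multipliers -/

/-- `C^f(e^{iλ})`: `(C^f)ᵀ = Bᵀ |1 - e^{iλτ}|^{2d} / λ^{2d} g⁰ + Cᵀ`. -/
def symCf (d τ : ℕ) (b : ℕ → H ι) (g0 : ℝ → H ι →L[ℂ] H ι) (C : ℝ → H ι) (l : ℝ) : H ι :=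
  (wt d τ l : ℂ) • rowMul (symB b l) (g0 l) + C l

/-- `C^g(e^{iλ})`: `(C^g)ᵀ = Bᵀ |1 - e^{iλτ}|^{2d} / λ^{2d} f⁰ - Cᵀ`. -/
def symCg (d τ : ℕ) (b : ℕ → H ι) (f0 : ℝ → H ι →L[ℂ] H ι) (C : ℝ → H ι) (l : ℝ) : H ι :=
  (wt d τ l : ℂ) • rowMul (symB b l) (f0 l) - C l

/-- `λ^{2d} / |1 - e^{iλτ}|^{2d} x x* = (f⁰ + g⁰) M (f⁰ + g⁰)` at almost all `λ`, with `x = x(λ)`. -/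
def LagrangeEq (d τ : ℕ) (f0 g0 : ℝ → H ι →L[ℂ] H ι) (x : ℝ → H ι)
    (M : ℝ → H ι →L[ℂ] H ι) : Prop :=
  ∀ᵐ l ∂circ, ((wt d τ l)⁻¹ : ℂ) • outer (x l) = (f0 l + g0 l) * M l * (f0 l + g0 l)

/-- `A` is the diagonal operator with the entries `u_k`. -/
def IsDiag (A : H ι →L[ℂ] H ι) (u : ι → ℝ) : Prop := ∀ k, A (delta k) = (u k : ℂ) • delta k

/-- The first equation of the `k`-th pair, for `C^f`. -/
def EqF (d τ : ℕ) (c : ClassData ι) (b : ℕ → H ι) (f0 g0 : ℝ → H ι →L[ℂ] H ι)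
    (C : ℝ → H ι) : ClassNo → Prop
  | .one => ∃ α : H ι, LagrangeEq d τ f0 g0 (symCf d τ b g0 C) fun _ => outer α
  | .two => ∃ α : ℝ, LagrangeEq d τ f0 g0 (symCf d τ b g0 C) fun _ => ((α ^ 2 : ℝ) : ℂ) • 1
  | .three => ∃ (α : ι → ℝ) (A : H ι →L[ℂ] H ι), IsDiag A (fun k => α k ^ 2) ∧
      LagrangeEq d τ f0 g0 (symCf d τ b g0 C) fun _ => A
  | .four => ∃ α : ℝ, LagrangeEq d τ f0 g0 (symCf d τ b g0 C)
      fun _ => ((α ^ 2 : ℝ) : ℂ) • transp c.B₁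

/-- The second equation of the `k`-th pair, for `C^g`. -/
def EqG (d τ : ℕ) (c : ClassData ι) (b : ℕ → H ι) (f0 g0 : ℝ → H ι →L[ℂ] H ι)
    (C : ℝ → H ι) : ClassNo → Prop
  | .one => ∃ (α : ℝ) (γ : ℝ → ℝ),
      (∀ᵐ l ∂circ, γ l ≤ 0 ∧
        (ENNReal.ofReal (1 - c.ε) * opTrace (c.g₁ l) < opTrace (g0 l) → γ l = 0)) ∧
      LagrangeEq d τ f0 g0 (symCg d τ b f0 C) fun l => ((α ^ 2 + γ l : ℝ) : ℂ) • 1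
  | .two => ∃ (α : ι → ℝ) (γ : ι → ℝ → ℝ) (A : ℝ → H ι →L[ℂ] H ι),
      (∀ᵐ l ∂circ, ∀ k, γ k l ≤ 0 ∧
        ((1 - c.ε) * (entry (c.g₁ l) k k).re < (entry (g0 l) k k).re → γ k l = 0)) ∧
      (∀ᵐ l ∂circ, IsDiag (A l) fun k => α k ^ 2 + γ k l) ∧
      LagrangeEq d τ f0 g0 (symCg d τ b f0 C) A
  | .three => ∃ (α : ℝ) (γ : ℝ → ℝ),
      (∀ᵐ l ∂circ, γ l ≤ 0 ∧
        (ENNReal.ofReal (1 - c.ε) * pairing c.B₂ (c.g₁ l) < pairing c.B₂ (g0 l) → γ l = 0)) ∧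
      LagrangeEq d τ f0 g0 (symCg d τ b f0 C) fun l => ((α ^ 2 + γ l : ℝ) : ℂ) • transp c.B₂
  | .four => ∃ (α : H ι) (Γ : ℝ → H ι →L[ℂ] H ι),
      (∀ᵐ l ∂circ, (-Γ l).IsPositive ∧
        ((g0 l - ((1 - c.ε : ℝ) : ℂ) • c.g₁ l).IsPositive ∧
          (∀ x ≠ 0, 0 < quad (g0 l - ((1 - c.ε : ℝ) : ℂ) • c.g₁ l) x) → Γ l = 0)) ∧
      LagrangeEq d τ f0 g0 (symCg d τ b f0 C) fun l => outer α + Γ l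

/-- The `k`-th pair of equations for `(f⁰, g⁰)`. -/
def LagrangeEquations (d τ : ℕ) (c : ClassData ι) (b : ℕ → H ι) (k : ClassNo)
    (f0 g0 : ℝ → H ι →L[ℂ] H ι) : Prop :=
  ∃ C, IsSymbolC d τ b f0 g0 C ∧ EqF d τ c b f0 g0 C k ∧ EqG d τ c b f0 g0 C k

/-- `(f⁰, g⁰)` are least favourable in `D`, and the minimax-robust spectral characteristic is the
spectral characteristic of the optimal estimate for `(f⁰, g⁰)` given by the formula `spectralA`.
Spectral characteristics are determined up to equality almost everywhere. -/
structure RobustSolution (d τ : ℕ) (b : ℕ → H ι) (D : DensityPairs ι)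
    (f0 g0 : ℝ → H ι →L[ℂ] H ι) : Prop where
  leastFavourable : IsLeastFavourable d τ b D f0 g0
  exists_symbol : ∃ C, IsSymbolC d τ b f0 g0 C
  optimal : ∀ C, IsSymbolC d τ b f0 g0 C → IsOptimal d τ b f0 g0 (spectralA d τ b f0 g0 C)
  minimax : ∀ C, IsSymbolC d τ b f0 g0 C →
    ∀ h, IsMinimax d τ b D h ↔ h =ᵐ[circ] spectralA d τ b f0 g0 C

end Filtering

end MinimaxFilter

end

open MinimaxFilter

open MeasureTheory Filter Topology Complex
open scoped NNReal ENNReal lp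
noncomputable section
namespace MinimaxFilter

/-! ## Positive operators -/

section Operators

set_option linter.unusedSectionVars false

variable {E : Type*} [NormedAddCommGroup E] [InnerProductSpace ℂ E]

/-! Transposition turns the row formulas into Hermitian forms. Put `F = fᵀ`, `G = gᵀ`, `S = F + G`,
and write `w` for `incr`. Completing the square at each frequency (`qf_sub_add_qf`) splits the error
of `h` into the squared distance in `L₂(S)` from `h` to the target `w S⁻¹ F B`, and a term built
from the parallel sum `F - F S⁻¹ F` that does not depend on `h`. Optimal filtering is thus the
projection of one function to `L₂⁰(S)`.

Under the minimality condition the functions `w̄⁻¹ S⁻¹ e^{iλ(j+1)} δ_k`, `j ≥ 0`, belong to `L₂(S)`,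
and `L₂⁰(S)` is exactly their orthogonal complement (`MinPair.mem_obsClosure_iff`). The hard
inclusion is a density theorem (`exists_vpoly_near`): an integrable function with no Fourier
coefficients at `e^{iλ(l+1)}`, of finite norm for an integrable operator weight, is a limit in that
norm of polynomials in `e^{-iλ}`. Multiplication by an outer function (`exists_outer`) bounds the
function and the weight at once and reduces this to the unweighted case.

The Gram matrix of these dual functions is `P_τ`, their inner products with the target are the
entries of `R b`, and the constant term is `⟨Q_τ b, b⟩`. So the quantity to be maximized is the
minimal error (`MinPair.hasValue_iff`, `MinPair.optMse_eq`), `C` encodes the projection of the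
target to the complement, and any other admissible `h` costs exactly the additional squared distance
to the optimal `h⁰` (`MinPair.mse_eq_add`).

The maximum is taken over minimal pairs only, whereas `h⁰` has to be admissible, with error at most
the maximum `v₀`, for every pair in `D`. This is `saddle_point`. The classes are convex, and mixing
`(f⁰, g⁰)` with an arbitrary pair `(f, g)` at weight `t < 1` keeps minimality. Let `u_t` be the
optimal characteristic of the mixture, whose error is at most `v₀`. Then the error of `u_t` at `(f,
g)` is at most `v₀`, and `u_t → h⁰` in `L₂(f⁰ + g⁰)` as `t → 0`. Comparing the optimality identities
of two mixtures shows that the `u_t` are also Cauchy in `L₂(f + g)`. Fatou's lemma passes both facts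
to `h⁰`. Uniqueness follows since on `H_D` the error at `(f⁰, g⁰)` is `v₀` plus the squared distance
to `h⁰`.

For random sequences, the past of `ξ` and the observed functions in `L₂(fᵀ)` have the same Gram
matrix, likewise for `η`, so there are isometries between their closed spans; uncorrelatedness adds
the two squared norms. -/

/-- The real part of the form `⟨x, A x⟩`. -/
def qf (A : E →L[ℂ] E) (x : E) : ℝ := (inner ℂ x (A x)).re

theorem qf_add_left (A B : E →L[ℂ] E) (x : E) : qf (A + B) x = qf A x + qf B x := by
  simp [qf]

theorem qf_real_smul_left (r : ℝ) (A : E →L[ℂ] E) (x : E) : qf ((r : ℂ) • A) x = r * qf A x := by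
  simp [qf]

theorem qf_smul_right (A : E →L[ℂ] E) (c : ℂ) (x : E) : qf A (c • x) = ‖c‖ ^ 2 * qf A x := by
  simp only [qf, map_smul, inner_smul_left, inner_smul_right]
  rw [← mul_assoc, mul_comm c, ← normSq_eq_conj_mul_self, normSq_eq_norm_sq]
  exact re_ofReal_mul _ _

theorem isPositive_real_smul {A : E →L[ℂ] E} (hA : A.IsPositive) {r : ℝ} (hr : 0 ≤ r) :
    ((r : ℂ) • A).IsPositive := hA.smul_of_nonneg (by exact_mod_cast hr)

theorem qf_neg_right (A : E →L[ℂ] E) (x : E) : qf A (-x) = qf A x := by simp [qf]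

theorem qf_nonneg {A : E →L[ℂ] E} (hA : A.IsPositive) (x : E) : 0 ≤ qf A x :=
  hA.re_inner_nonneg_right x

theorem qf_le_norm (A : E →L[ℂ] E) (x : E) : qf A x ≤ ‖A‖ * ‖x‖ ^ 2 := by
  calc qf A x ≤ ‖inner ℂ x (A x)‖ := re_le_norm _
    _ ≤ ‖x‖ * ‖A x‖ := norm_inner_le_norm _ _
    _ ≤ ‖x‖ * (‖A‖ * ‖x‖) := by gcongr; exact A.le_opNorm x
    _ = _ := by ring

theorem qf_parallelogram (A : E →L[ℂ] E) (x y : E) :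
    qf A (x + y) + qf A (x - y) = 2 * qf A x + 2 * qf A y := by
  simp only [qf, map_add, map_sub, inner_add_left, inner_add_right, inner_sub_left,
    inner_sub_right, add_re, sub_re]
  ring

theorem qf_add_right_le {A : E →L[ℂ] E} (hA : A.IsPositive) (x y : E) :
    qf A (x + y) ≤ 2 * qf A x + 2 * qf A y := by
  have := qf_parallelogram A x y
  linarith [qf_nonneg hA (x - y)]

variable [CompleteSpace E]

theorem isPositive_opSqrt (A : E →L[ℂ] E) : (opSqrt A).IsPositive :=
  (ContinuousLinearMap.nonneg_iff_isPositive _).1 (CFC.sqrt_nonneg A)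

theorem opSqrt_opSqrt_apply {A : E →L[ℂ] E} (hA : A.IsPositive) (x : E) :
    opSqrt A (opSqrt A x) = A x := by
  have h := CFC.sqrt_mul_sqrt_self A ((ContinuousLinearMap.nonneg_iff_isPositive _).2 hA)
  exact congrArg (fun B : E →L[ℂ] E => B x) h

theorem inner_opSqrt {A : E →L[ℂ] E} (hA : A.IsPositive) (x y : E) :
    inner ℂ (opSqrt A x) (opSqrt A y) = inner ℂ x (A y) := by
  rw [(isPositive_opSqrt A).inner_left_eq_inner_right, opSqrt_opSqrt_apply hA]

theorem norm_opSqrt_sq {A : E →L[ℂ] E} (hA : A.IsPositive) (x : E) :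
    ‖opSqrt A x‖ ^ 2 = qf A x := by
  rw [qf, ← inner_opSqrt hA, inner_self_eq_norm_sq_to_K]
  norm_cast

theorem norm_opSqrt_le {A : E →L[ℂ] E} (hA : A.IsPositive) : ‖opSqrt A‖ ^ 2 ≤ ‖A‖ := by
  have : ‖opSqrt A‖ ≤ √‖A‖ := by
    refine ContinuousLinearMap.opNorm_le_bound _ (Real.sqrt_nonneg _) fun x => ?_
    refine abs_le_of_sq_le_sq' ?_ (by positivity) |>.2
    rw [norm_opSqrt_sq hA, mul_pow, Real.sq_sqrt (norm_nonneg _)]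
    exact qf_le_norm A x
  calc ‖opSqrt A‖ ^ 2 ≤ √‖A‖ ^ 2 := by gcongr
    _ = ‖A‖ := Real.sq_sqrt (norm_nonneg _)

/-- Factor `A` through its square root: one factor contributes the operator norm, the other the
form. -/
theorem norm_apply_sq_le {A : E →L[ℂ] E} (hA : A.IsPositive) (x : E) :
    ‖A x‖ ^ 2 ≤ ‖A‖ * qf A x := by
  rw [← opSqrt_opSqrt_apply hA, ← norm_opSqrt_sq hA]
  calc ‖opSqrt A (opSqrt A x)‖ ^ 2 ≤ (‖opSqrt A‖ * ‖opSqrt A x‖) ^ 2 := by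
        gcongr; exact ContinuousLinearMap.le_opNorm _ _
    _ = ‖opSqrt A‖ ^ 2 * ‖opSqrt A x‖ ^ 2 := by ring
    _ ≤ _ := by gcongr; exact norm_opSqrt_le hA

theorem norm_inner_sq_le {A : E →L[ℂ] E} (hA : A.IsPositive) (x y : E) :
    ‖inner ℂ x (A y)‖ ^ 2 ≤ qf A x * qf A y := by
  rw [← inner_opSqrt hA, ← norm_opSqrt_sq hA, ← norm_opSqrt_sq hA, ← mul_pow]
  gcongr
  exact norm_inner_le_norm _ _

theorem inverse_apply_self {S : E →L[ℂ] E} (hS : IsUnit S) (x : E) : Ring.inverse S (S x) = x :=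
  congrArg (fun B : E →L[ℂ] E => B x) (Ring.inverse_mul_cancel S hS)

theorem self_apply_inverse {S : E →L[ℂ] E} (hS : IsUnit S) (x : E) : S (Ring.inverse S x) = x :=
  congrArg (fun B : E →L[ℂ] E => B x) (Ring.mul_inverse_cancel S hS)

theorem isPositive_inverse {S : E →L[ℂ] E} (hp : S.IsPositive) (hS : IsUnit S) :
    (Ring.inverse S).IsPositive := by
  refine (ContinuousLinearMap.isPositive_def').2 ⟨hp.isSelfAdjoint.ringInverse, fun x => ?_⟩
  have := hp.re_inner_nonneg_right (Ring.inverse S x)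
  rw [self_apply_inverse hS] at this
  exact this

theorem qf_inverse {S : E →L[ℂ] E} (hp : S.IsPositive) (hS : IsUnit S) (x : E) :
    qf S (Ring.inverse S x) = qf (Ring.inverse S) x := by
  rw [qf, qf, ← hp.inner_left_eq_inner_right, self_apply_inverse hS]

/-- The preceding bound for `S⁻¹` at the vector `S x`. Through it the minimality condition turns
control of the form of `S` into control of vectors. -/
theorem norm_sq_le_inverse {S : E →L[ℂ] E} (hp : S.IsPositive) (hS : IsUnit S) (x : E) :
    ‖x‖ ^ 2 ≤ ‖Ring.inverse S‖ * qf S x := by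
  have h := norm_apply_sq_le (isPositive_inverse hp hS) (S x)
  rwa [inverse_apply_self hS, ← qf_inverse hp hS, inverse_apply_self hS] at h

/-- With `y = (A + B)⁻¹ A x`, Cauchy–Schwarz for the form of `A` bounds `⟨y, (A + B) y⟩² = ⟨y, A
x⟩²` by `⟨y, (A + B) y⟩ ⟨x, A x⟩`; then one factor is cancelled. This is the positivity of the
parallel sum. -/
theorem qf_inverse_apply_le {A B : E →L[ℂ] E} (hA : A.IsPositive) (hB : B.IsPositive)
    (hS : IsUnit (A + B)) (x : E) : qf (Ring.inverse (A + B)) (A x) ≤ qf A x := by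
  set y := Ring.inverse (A + B) (A x) with hy
  have h1 : qf (A + B) y = qf (Ring.inverse (A + B)) (A x) := qf_inverse (hA.add hB) hS _
  have h2 : qf (A + B) y = (inner ℂ y (A x)).re := by rw [qf, hy, self_apply_inverse hS]
  have h3 := norm_inner_sq_le hA y x
  have h4 : qf A y ≤ qf (A + B) y := by rw [qf_add_left]; linarith [qf_nonneg hB y]
  have h5 := qf_nonneg (hA.add hB) y
  rw [← h1]
  have h6 : qf (A + B) y ^ 2 ≤ qf (A + B) y * qf A x := by
    calc qf (A + B) y ^ 2 ≤ ‖inner ℂ y (A x)‖ ^ 2 := by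
          gcongr; rw [h2]; exact re_le_norm _
      _ ≤ _ := h3
      _ ≤ _ := by gcongr; exact qf_nonneg hA x
  rcases h5.eq_or_lt with h | h
  · rw [← h]; exact qf_nonneg hA x
  · exact le_of_mul_le_mul_left (by linarith [sq (qf (A + B) y)]) h

theorem norm_inverse_le_of_bound {S : E →L[ℂ] E} {c : ℝ} (hc : 0 ≤ c) (hS : IsUnit S)
    (h : ∀ x, ‖x‖ ^ 2 ≤ c * qf S x) : ‖Ring.inverse S‖ ≤ c := by
  refine ContinuousLinearMap.opNorm_le_bound _ hc fun x => ?_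
  set y := Ring.inverse S x
  have hy : S y = x := self_apply_inverse hS x
  have h1 := h y
  have h2 : qf S y ≤ ‖y‖ * ‖x‖ := by
    rw [qf, hy]
    exact (re_le_norm _).trans (norm_inner_le_norm _ _)
  rcases (norm_nonneg y).eq_or_lt with h0 | h0
  · rw [← h0]; positivity
  · refine le_of_mul_le_mul_left ?_ h0
    nlinarith [mul_le_mul_of_nonneg_left h2 hc]

/-- Being bounded below gives injectivity and closed range; self-adjointness makes the orthogonal
complement of the range the kernel, which is zero. -/
theorem isUnit_of_bound {S : E →L[ℂ] E} (hp : S.IsPositive) {c : ℝ} 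
    (h : ∀ x, ‖x‖ ^ 2 ≤ c * qf S x) : IsUnit S := by
  have key : ∀ x, ‖x‖ ≤ |c| * ‖S x‖ := fun x => by
    rcases (norm_nonneg x).eq_or_lt with h0 | h0
    · rw [← h0]; positivity
    · refine le_of_mul_le_mul_left ?_ h0
      calc ‖x‖ * ‖x‖ = ‖x‖ ^ 2 := by ring
        _ ≤ c * qf S x := h x
        _ ≤ |c| * qf S x := by gcongr; exacts [qf_nonneg hp x, le_abs_self c]
        _ ≤ |c| * (‖x‖ * ‖S x‖) := by
          gcongr; exact (re_le_norm _).trans (norm_inner_le_norm _ _)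
        _ = _ := by ring
  have hanti : AntilipschitzWith (Real.toNNReal |c|) S :=
    S.antilipschitz_of_bound (by simpa [Real.coe_toNNReal _ (abs_nonneg c)] using key)
  have hker : S.ker = ⊥ := LinearMap.ker_eq_bot.2 hanti.injective
  have hrange : S.range = ⊤ := by
    have hcl : IsClosed (S.range : Set E) := by
      exact hanti.isClosed_range S.uniformContinuous
    have h1 : (S.range)ᗮ = ⊥ := by
      rw [ContinuousLinearMap.orthogonal_range, hp.isSelfAdjoint.adjoint_eq]
      exact hker
    have := Submodule.topologicalClosure_eq_top_iff.2 h1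
    rwa [hcl.submodule_topologicalClosure_eq] at this
  rw [ContinuousLinearMap.isUnit_iff_bijective]
  exact ⟨hanti.injective, LinearMap.range_eq_top.1 hrange⟩

end Operators

/-! ### Transposition: from row formulas to Hermitian forms -/

section Transpose
variable {ι : Type*}

theorem inner_star_star (x y : H ι) : inner ℂ (star x) (star y) = inner ℂ y x := by
  rw [lp.inner_eq_tsum, lp.inner_eq_tsum]
  refine tsum_congr fun i => ?_
  simp [mul_comm]

theorem inner_transp (A : H ι →L[ℂ] H ι) (x y : H ι) :
    inner ℂ x (transp A y) = inner ℂ (star y) (A (star x)) := by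
  rw [transp_apply, ← star_star x, inner_star_star, ContinuousLinearMap.adjoint_inner_left,
    star_star]

/-- Lets the errors, written with rows as `xᵀ A x̄`, be treated as ordinary Hermitian forms of the
transposed densities. -/
theorem quad_eq_qf (A : H ι →L[ℂ] H ι) (x : H ι) : quad A x = qf (transp A) x := by
  rw [quad, qf, inner_transp]

theorem transp_eq_of_inner {A B : H ι →L[ℂ] H ι}
    (h : ∀ x y, inner ℂ x (B y) = inner ℂ (star y) (A (star x))) : transp A = B := by
  ext1 y
  refine ext_inner_left ℂ fun x => ?_
  rw [inner_transp, h]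

theorem transp_transp (A : H ι →L[ℂ] H ι) : transp (transp A) = A :=
  transp_eq_of_inner fun x y => by rw [inner_transp, star_star, star_star]

theorem transp_add (A B : H ι →L[ℂ] H ι) : transp (A + B) = transp A + transp B :=
  transp_eq_of_inner fun x y => by simp [inner_transp]

theorem transp_smul (c : ℂ) (A : H ι →L[ℂ] H ι) : transp (c • A) = c • transp A :=
  transp_eq_of_inner fun x y => by simp [inner_transp]

theorem star_transp_apply (A : H ι →L[ℂ] H ι) (y : H ι) :
    star (transp A y) = ContinuousLinearMap.adjoint A (star y) := by
  rw [transp_apply, star_star]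

theorem transp_mul (A B : H ι →L[ℂ] H ι) : transp (A * B) = transp B * transp A := by
  refine transp_eq_of_inner fun x y => ?_
  simp only [mul_apply_eq_comp]
  rw [inner_transp, star_transp_apply, ContinuousLinearMap.adjoint_inner_left]

theorem transp_one : transp (1 : H ι →L[ℂ] H ι) = 1 :=
  transp_eq_of_inner fun x y => by simp [inner_star_star]

theorem norm_transp_le (A : H ι →L[ℂ] H ι) : ‖transp A‖ ≤ ‖A‖ := by
  refine ContinuousLinearMap.opNorm_le_bound _ (norm_nonneg _) fun x => ?_
  rw [transp_apply, norm_star]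
  refine (ContinuousLinearMap.le_opNorm _ _).trans ?_
  rw [norm_star, LinearIsometryEquiv.norm_map]

theorem norm_transp (A : H ι →L[ℂ] H ι) : ‖transp A‖ = ‖A‖ :=
  le_antisymm (norm_transp_le A) (by simpa [transp_transp] using norm_transp_le (transp A))

theorem isPositive_transp {A : H ι →L[ℂ] H ι} (hA : A.IsPositive) : (transp A).IsPositive := by
  refine (ContinuousLinearMap.isPositive_def).2 ⟨fun x y => ?_, fun x => ?_⟩
  · change inner ℂ (transp A x) y = inner ℂ x (transp A y)
    rw [inner_transp, ← inner_conj_symm, inner_transp, inner_conj_symm,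
      hA.inner_left_eq_inner_right]
  · have := hA.re_inner_nonneg_right (star x)
    rw [ContinuousLinearMap.reApplyInnerSelf_apply, ← inner_conj_symm, inner_transp, RCLike.conj_re]
    exact this

theorem isUnit_transp {A : H ι →L[ℂ] H ι} (hA : IsUnit A) : IsUnit (transp A) := by
  refine isUnit_iff_exists.2 ⟨transp (Ring.inverse A), ?_, ?_⟩
  · rw [← transp_mul, Ring.inverse_mul_cancel A hA, transp_one]
  · rw [← transp_mul, Ring.mul_inverse_cancel A hA, transp_one]

theorem transp_inverse (A : H ι →L[ℂ] H ι) : transp (Ring.inverse A) = Ring.inverse (transp A) := by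
  by_cases hA : IsUnit A
  · calc transp (Ring.inverse A)
        = transp (Ring.inverse A) * (transp A * Ring.inverse (transp A)) := by
          rw [Ring.mul_inverse_cancel _ (isUnit_transp hA), mul_one]
      _ = Ring.inverse (transp A) := by
          rw [← mul_assoc, ← transp_mul, Ring.mul_inverse_cancel A hA, transp_one, one_mul]
  · have h2 : ¬ IsUnit (transp A) := fun h => hA (by simpa [transp_transp] using isUnit_transp h)
    rw [Ring.inverse_non_unit _ hA, Ring.inverse_non_unit _ h2]
    exact transp_eq_of_inner fun x y => by simp

theorem inner_delta (k : ι) (x : H ι) : inner ℂ (delta k) x = x k := by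
  classical
  have := lp.inner_single_left (𝕜 := ℂ) k (1 : ℂ) x
  rw [delta]
  convert this using 1
  simp

theorem star_delta (k : ι) : star (delta k) = delta k := by
  refine ext_inner_right ℂ fun x => ?_
  rw [← star_star x, inner_star_star, ← inner_conj_symm, inner_delta, inner_delta]
  simp

theorem norm_delta (k : ι) : ‖delta k‖ = 1 := by
  rw [delta]; simp

theorem entry_eq_inner (A : H ι →L[ℂ] H ι) (k n : ι) :
    entry A k n = inner ℂ (delta k) (A (delta n)) := (inner_delta _ _).symm

theorem entry_eq_transp (A : H ι →L[ℂ] H ι) (k n : ι) :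
    entry A k n = inner ℂ (delta n) (transp A (delta k)) := by
  rw [inner_transp, star_delta, star_delta, entry_eq_inner]

end Transpose

/-! ## Strongly measurable families of operators -/

section StrongMeasurability

variable {E : Type*} [NormedAddCommGroup E] [InnerProductSpace ℂ E]
variable {μ : Measure ℝ}

/-- Strong measurability of a family of operators. -/
def StrMeas (μ : Measure ℝ) (A : ℝ → E →L[ℂ] E) : Prop :=
  ∀ x, AEStronglyMeasurable (fun l => A l x) μ

/-- For a simple function this is a finite sum over its values; the general case is a pointwise
limit, by continuity of each `A l`. -/
theorem StrMeas.apply {A : ℝ → E →L[ℂ] E} (hA : StrMeas μ A) {v : ℝ → E}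
    (hv : AEStronglyMeasurable v μ) : AEStronglyMeasurable (fun l => A l (v l)) μ := by
  have hs : ∀ s : SimpleFunc ℝ E, AEStronglyMeasurable (fun l => A l (s l)) μ := by
    intro s
    have h : (fun l => A l (s l)) =
        fun l => ∑ y ∈ s.range, (s ⁻¹' {y}).indicator (fun l => A l y) l := by
      funext l
      rw [Finset.sum_eq_single (s l)]
      · simp
      · intro y _ hy
        exact Set.indicator_of_notMem (fun h => hy (by simpa using h.symm)) _
      · intro h
        exact absurd (s.mem_range_self l) h
    rw [h]
    exact Finset.aestronglyMeasurable_fun_sum _ fun y _ =>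
      (hA y).indicator (s.measurableSet_fiber y)
  refine aestronglyMeasurable_of_tendsto_ae atTop
    (fun n => hs (hv.stronglyMeasurable_mk.approx n)) ?_
  filter_upwards [hv.ae_eq_mk] with l hl
  rw [hl]
  exact ((A l).continuous.tendsto _).comp (hv.stronglyMeasurable_mk.tendsto_approx l)

theorem StrMeas.mul {A B : ℝ → E →L[ℂ] E} (hA : StrMeas μ A) (hB : StrMeas μ B) :
    StrMeas μ fun l => A l * B l := fun x => hA.apply (hB x)

theorem StrMeas.add {A B : ℝ → E →L[ℂ] E} (hA : StrMeas μ A) (hB : StrMeas μ B) :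
    StrMeas μ fun l => A l + B l := fun x => (hA x).add (hB x)

theorem StrMeas.sub {A B : ℝ → E →L[ℂ] E} (hA : StrMeas μ A) (hB : StrMeas μ B) :
    StrMeas μ fun l => A l - B l := fun x => (hA x).sub (hB x)

theorem StrMeas.smul {A : ℝ → E →L[ℂ] E} (hA : StrMeas μ A) {c : ℝ → ℂ}
    (hc : AEStronglyMeasurable c μ) : StrMeas μ fun l => c l • A l := fun x => hc.smul (hA x)

theorem StrMeas.const (A : E →L[ℂ] E) : StrMeas μ fun _ => A := fun _ =>
  aestronglyMeasurable_const

theorem StrMeas.pow {A : ℝ → E →L[ℂ] E} (hA : StrMeas μ A) (n : ℕ) :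
    StrMeas μ fun l => A l ^ n := by
  induction n with
  | zero => simpa using StrMeas.const 1
  | succ n ih => simpa only [pow_succ] using ih.mul hA

theorem StrMeas.sum {κ : Type*} {A : κ → ℝ → E →L[ℂ] E} {s : Finset κ}
    (hA : ∀ k ∈ s, StrMeas μ (A k)) : StrMeas μ fun l => ∑ k ∈ s, A k l := fun x => by
  simpa using Finset.aestronglyMeasurable_fun_sum s fun k hk => hA k hk x

theorem StrMeas.congr {A B : ℝ → E →L[ℂ] E} (hA : StrMeas μ A) (h : A =ᵐ[μ] B) :
    StrMeas μ B := fun x => (hA x).congr (h.mono fun l hl => by simp only [hl])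

theorem StrMeas.of_tendsto {A : ℕ → ℝ → E →L[ℂ] E} {B : ℝ → E →L[ℂ] E}
    (hA : ∀ n, StrMeas μ (A n)) (h : ∀ᵐ l ∂μ, Tendsto (fun n => A n l) atTop (𝓝 (B l))) :
    StrMeas μ B := fun x => aestronglyMeasurable_of_tendsto_ae atTop (fun n => hA n x) <|
  h.mono fun l hl =>
    ((ContinuousLinearMap.apply ℂ E x).continuous.tendsto (B l)).comp hl

/-- By separability the operator norm is a countable supremum of measurable quotients. The zero
vector contributes `0 / 0 = 0` in `ℝ≥0∞`. -/
theorem StrMeas.norm [TopologicalSpace.SeparableSpace E] {A : ℝ → E →L[ℂ] E}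
    (hA : StrMeas μ A) : AEMeasurable (fun l => ‖A l‖) μ := by
  have key : ∀ B : E →L[ℂ] E, ‖B‖ₑ =
      ⨆ n, ‖B (TopologicalSpace.denseSeq E n)‖ₑ / ‖TopologicalSpace.denseSeq E n‖ₑ := by
    intro B
    refine le_antisymm ?_ (iSup_le fun n => ?_)
    · set c := ⨆ n, ‖B (TopologicalSpace.denseSeq E n)‖ₑ / ‖TopologicalSpace.denseSeq E n‖ₑ
        with hc
      by_cases htop : c = ⊤
      · rw [htop]; exact le_top
      have h1 : ∀ n, ‖B (TopologicalSpace.denseSeq E n)‖ ≤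
          c.toReal * ‖TopologicalSpace.denseSeq E n‖ := fun n => by
        set x := TopologicalSpace.denseSeq E n with hx
        by_cases h0 : x = 0
        · simp [h0]
        have : ‖B x‖ₑ / ‖x‖ₑ ≤ c := le_iSup (fun n => ‖B (TopologicalSpace.denseSeq E n)‖ₑ /
          ‖TopologicalSpace.denseSeq E n‖ₑ) n
        have h2 := (ENNReal.div_le_iff_le_mul (Or.inl (by simpa using h0))
          (Or.inl enorm_ne_top)).1 this
        have h3 := ENNReal.toReal_mono (ENNReal.mul_ne_top htop enorm_ne_top) h2
        simpa using h3
      have h2 : ∀ x, ‖B x‖ ≤ c.toReal * ‖x‖ := fun x => by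
        refine (TopologicalSpace.denseRange_denseSeq E).induction_on
          (p := fun x => ‖B x‖ ≤ c.toReal * ‖x‖) x ?_ h1
        exact isClosed_le (by fun_prop) (by fun_prop)
      have h3 := ContinuousLinearMap.opNorm_le_bound B ENNReal.toReal_nonneg h2
      rw [← ofReal_norm]
      exact ENNReal.ofReal_le_of_le_toReal h3
    · exact ENNReal.div_le_of_le_mul (by
        simpa [enorm_eq_nnnorm, ← ENNReal.coe_mul] using B.le_opNNNorm _)
  have : AEMeasurable (fun l => ‖A l‖ₑ) μ := by
    simp_rw [key]
    exact AEMeasurable.iSup fun n => (hA _).enorm.div_const _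
  simpa using this.ennreal_toReal

variable [CompleteSpace E]

/-- After normalization by `‖A l‖` the spectrum lies in `[0, 1]`, where one sequence of polynomials
approximates the square root uniformly, for all `l` at once. Polynomials of a strongly measurable
family are strongly measurable. Where `A l = 0` the normalizing factor takes its default value `0`,
which does no harm. -/
theorem StrMeas.opSqrt [TopologicalSpace.SeparableSpace E] {A : ℝ → E →L[ℂ] E}
    (hA : StrMeas μ A) (hp : ∀ᵐ l ∂μ, (A l).IsPositive) : StrMeas μ fun l => opSqrt (A l) := by
  have hex : ∀ n : ℕ, ∃ p : Polynomial ℝ, ∀ x ∈ Set.Icc (0 : ℝ) 1,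
      |p.eval x - √x| < 1 / ((n : ℝ) + 1) := fun n =>
    exists_polynomial_near_of_continuousOn 0 1 _ Real.continuous_sqrt.continuousOn _
      (by positivity)
  choose p hpoly using hex
  set a : ℝ → E →L[ℂ] E := fun l => ((‖A l‖⁻¹ : ℝ) : ℂ) • A l with ha
  have ham : StrMeas μ a := hA.smul
    (by exact (Complex.measurable_ofReal.comp_aemeasurable hA.norm.inv).aestronglyMeasurable)
  have hpm : ∀ q : Polynomial ℝ, StrMeas μ fun l => Polynomial.aeval (a l) q := fun q => by
    have h := StrMeas.sum (A := fun (k : ℕ) l => ((q.coeff k : ℝ) : ℂ) • a l ^ k)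
      (s := Finset.range (q.natDegree + 1)) fun k _ => (ham.pow k).smul aestronglyMeasurable_const
    convert h using 2 with l
    rw [Polynomial.aeval_eq_sum_range]
    exact Finset.sum_congr rfl fun k _ => (Complex.coe_smul _ _).symm
  have hlim : StrMeas μ fun l => MinimaxFilter.opSqrt (a l) := by
    refine StrMeas.of_tendsto (fun n => hpm (p n)) ?_
    filter_upwards [hp] with l hl
    have hpos : (a l).IsPositive := isPositive_real_smul hl (by simp)
    have hnn : 0 ≤ a l := (ContinuousLinearMap.nonneg_iff_isPositive _).2 hpos
    have hle : ‖a l‖ ≤ 1 := by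
      rw [ha, norm_smul]
      simpa using inv_mul_le_one
    rw [tendsto_iff_norm_sub_tendsto_zero]
    refine squeeze_zero (fun _ => norm_nonneg _) (fun n => ?_)
      tendsto_one_div_add_atTop_nhds_zero_nat
    rw [MinimaxFilter.opSqrt, CFC.sqrt_eq_real_sqrt (a l), ← cfc_polynomial (p n) (a l)
      hpos.isSelfAdjoint, cfcₙ_eq_cfc, ← cfc_sub _ _ _ (p n).continuous.continuousOn
        Real.continuous_sqrt.continuousOn]
    refine norm_cfc_le (by positivity) fun x hx => ?_
    have hx0 : 0 ≤ x := spectrum_nonneg_of_nonneg hnn hx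
    have hx1 : x ≤ 1 := by
      have h1 := spectrum.norm_le_norm_mul_of_mem hx
      have h2 : ‖(1 : E →L[ℂ] E)‖ ≤ 1 := ContinuousLinearMap.norm_id_le
      exact (le_abs_self x).trans (h1.trans (mul_le_one₀ hle (norm_nonneg _) h2))
    exact (hpoly n x ⟨hx0, hx1⟩).le
  have h2 : StrMeas μ fun l => ((√‖A l‖ : ℝ) : ℂ) • MinimaxFilter.opSqrt (a l) :=
    hlim.smul (by exact (Complex.measurable_ofReal.comp_aemeasurable
      hA.norm.sqrt).aestronglyMeasurable)
  refine h2.congr ?_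
  filter_upwards [hp] with l hl
  have hpos : (a l).IsPositive := isPositive_real_smul hl (by simp)
  have hnn : 0 ≤ a l := (ContinuousLinearMap.nonneg_iff_isPositive _).2 hpos
  refine (CFC.sqrt_unique ?_ ?_).symm
  · rw [smul_mul_smul_comm, ← ofReal_mul, Real.mul_self_sqrt (norm_nonneg _),
      MinimaxFilter.opSqrt, CFC.sqrt_mul_sqrt_self (a l), ha]
    by_cases h0 : A l = 0
    · simp [h0]
    · simp only
      rw [smul_smul, ← ofReal_mul, mul_inv_cancel₀ (by simpa using h0)]
      simp
  · exact (ContinuousLinearMap.nonneg_iff_isPositive _).2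
      ((isPositive_opSqrt _).smul_of_nonneg (by simp))

theorem norm_le_of_qf_le {A : E →L[ℂ] E} (hA : A.IsPositive) {c : ℝ} (hc : 0 ≤ c)
    (h : ∀ x, qf A x ≤ c * ‖x‖ ^ 2) : ‖A‖ ≤ c := by
  rcases (norm_nonneg A).eq_or_lt with h0 | h0
  · rw [← h0]; exact hc
  have h1 : ‖A‖ ≤ √(‖A‖ * c) := by
    refine ContinuousLinearMap.opNorm_le_bound _ (Real.sqrt_nonneg _) fun x => ?_
    refine abs_le_of_sq_le_sq' ?_ (by positivity) |>.2
    rw [mul_pow, Real.sq_sqrt (by positivity), mul_assoc]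
    exact (norm_apply_sq_le hA x).trans (by gcongr; exact h x)
  have h2 := Real.sq_sqrt (x := ‖A‖ * c) (by positivity)
  have h3 : ‖A‖ ^ 2 ≤ ‖A‖ * c := by rw [← h2]; gcongr
  exact le_of_mul_le_mul_left (by linarith [sq ‖A‖]) h0

/-- Neumann series for `S / ‖S‖ = 1 - b`: positivity and invertibility of `S` force `‖b‖ < 1`, so
the inverse is a norm limit of polynomials in `S`, up to scalars. -/
theorem StrMeas.inverse [TopologicalSpace.SeparableSpace E] {S : ℝ → E →L[ℂ] E}
    (hS : StrMeas μ S) (hp : ∀ᵐ l ∂μ, (S l).IsPositive) (hu : ∀ᵐ l ∂μ, IsUnit (S l)) :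
    StrMeas μ fun l => Ring.inverse (S l) := by
  rcases subsingleton_or_nontrivial E with hE | hE
  · intro x
    rw [Subsingleton.elim (fun l => Ring.inverse (S l) x) (fun _ => 0)]
    exact aestronglyMeasurable_const
  set b : ℝ → E →L[ℂ] E := fun l => 1 - ((‖S l‖⁻¹ : ℝ) : ℂ) • S l with hb
  have hnm : AEStronglyMeasurable (fun l => ((‖S l‖⁻¹ : ℝ) : ℂ)) μ :=
    (Complex.measurable_ofReal.comp_aemeasurable hS.norm.inv).aestronglyMeasurable
  have hbm : StrMeas μ b := (StrMeas.const 1).sub (hS.smul hnm)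
  refine StrMeas.of_tendsto (A := fun n l => ((‖S l‖⁻¹ : ℝ) : ℂ) • ∑ k ∈ Finset.range n, b l ^ k)
    (fun n => (StrMeas.sum fun k _ => hbm.pow k).smul hnm) ?_
  filter_upwards [hp, hu] with l hl hul
  have hS0 : S l ≠ 0 := hul.ne_zero
  have hn0 : 0 < ‖S l‖ := by simpa using hS0
  have hi0 : 0 < ‖Ring.inverse (S l)‖ := by
    rw [norm_pos_iff]
    exact (hul.ringInverse).ne_zero
  have hqb : ∀ x, qf (b l) x = ‖x‖ ^ 2 - ‖S l‖⁻¹ * qf (S l) x := fun x => by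
    have h1 : qf (b l) x = qf 1 x - qf (((‖S l‖⁻¹ : ℝ) : ℂ) • S l) x := by
      simp [qf, hb]
    rw [h1, qf_real_smul_left]
    congr 1
    simp only [qf, one_apply_eq_self]
    rw [inner_self_eq_norm_sq_to_K]
    norm_cast
  have hbp : (b l).IsPositive := by
    refine (ContinuousLinearMap.isPositive_def').2 ⟨?_, fun x => ?_⟩
    · exact (IsSelfAdjoint.one _).sub ((isPositive_real_smul hl (by simp)).isSelfAdjoint)
    · have h1 := hqb x
      have h2 := qf_le_norm (S l) x
      have h3 : ‖S l‖⁻¹ * qf (S l) x ≤ ‖x‖ ^ 2 := by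
        rw [inv_mul_le_iff₀ hn0]; exact h2
      rw [ContinuousLinearMap.reApplyInnerSelf_apply, ← inner_conj_symm, RCLike.conj_re]
      change 0 ≤ qf (b l) x
      linarith
  have hc : ‖b l‖ < 1 := by
    -- The form of `S` is at least `‖S⁻¹‖⁻¹ ‖x‖²`; dividing by `‖S‖` yields the contraction
    -- constant.
    set c : ℝ := 1 - (‖S l‖ * ‖Ring.inverse (S l)‖)⁻¹ with hcdef
    have hqc : ∀ x, qf (b l) x ≤ c * ‖x‖ ^ 2 := fun x => by
      rw [hqb, hcdef]
      have := norm_sq_le_inverse hl hul x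
      have h4 : ‖Ring.inverse (S l)‖⁻¹ * ‖x‖ ^ 2 ≤ qf (S l) x := by
        rwa [inv_mul_le_iff₀ hi0]
      have h5 := mul_le_mul_of_nonneg_left h4 (inv_nonneg.2 hn0.le)
      rw [mul_inv]
      linarith
    have hc0 : 0 ≤ c := by
      obtain ⟨x, hx⟩ := exists_ne (0 : E)
      have h6 := (qf_nonneg hbp x).trans (hqc x)
      have h7 : 0 < ‖x‖ ^ 2 := by positivity
      exact nonneg_of_mul_nonneg_left h6 h7
    refine (norm_le_of_qf_le hbp hc0 hqc).trans_lt ?_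
    rw [hcdef]
    have : 0 < (‖S l‖ * ‖Ring.inverse (S l)‖)⁻¹ := by positivity
    linarith
  have hsum := (summable_geometric_of_norm_lt_one hc).hasSum.tendsto_sum_nat
  have hmul := mul_neg_geom_series (b l) hc
  have hval : Ring.inverse (S l) = ((‖S l‖⁻¹ : ℝ) : ℂ) • ∑' k, b l ^ k := by
    have h8 : 1 - b l = ((‖S l‖⁻¹ : ℝ) : ℂ) • S l := by simp [hb]
    rw [h8, smul_mul_assoc] at hmul
    calc Ring.inverse (S l) = Ring.inverse (S l) * 1 := (mul_one _).symm
      _ = Ring.inverse (S l) * (((‖S l‖⁻¹ : ℝ) : ℂ) • (S l * ∑' k, b l ^ k)) := by rw [hmul]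
      _ = _ := by
        rw [mul_smul_comm, ← mul_assoc, Ring.inverse_mul_cancel _ hul, one_mul]
  rw [hval]
  exact hsum.const_smul _

end StrongMeasurability

/-! ### Coordinate expansion, separability and measurability of transposes -/

section Coordinates

variable {ι : Type*}

theorem hasSum_delta (x : H ι) : HasSum (fun k => x k • delta k) x := by
  classical
  have := lp.hasSum_single (p := 2) (by norm_num) x
  convert this using 2 with k
  rw [delta, ← lp.single_smul]
  simp

instance [Countable ι] : TopologicalSpace.SeparableSpace (H ι) := by
  have h : Dense ((Submodule.span ℂ (Set.range (delta (ι := ι)))) : Set (H ι)) := by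
    intro x
    refine mem_closure_of_tendsto (hasSum_delta x) (Eventually.of_forall fun s => ?_)
    exact Submodule.sum_mem _ fun k _ =>
      Submodule.smul_mem _ _ (Submodule.subset_span ⟨k, rfl⟩)
  have hs : TopologicalSpace.IsSeparable
      ((Submodule.span ℂ (Set.range (delta (ι := ι)))) : Set (H ι)) :=
    (Set.countable_range _).isSeparable.span
  have := hs.closure
  rw [h.closure_eq] at this
  exact TopologicalSpace.isSeparable_univ_iff.1 this

theorem StrMeas.transp {μ : Measure ℝ} {A : ℝ → H ι →L[ℂ] H ι} (hA : StrMeas μ A)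
    (hp : ∀ᵐ l ∂μ, (A l).IsPositive) : StrMeas μ fun l => transp (A l) := fun x => by
  have h : AEStronglyMeasurable (fun l => star (A l (star x))) μ :=
    continuous_star.comp_aestronglyMeasurable (hA (star x))
  refine h.congr ?_
  filter_upwards [hp] with l hl
  rw [transp_apply, hl.isSelfAdjoint.adjoint_eq]

theorem IsSpectralDensity.strMeas {d τ : ℕ} {f : ℝ → H ι →L[ℂ] H ι}
    (hf : IsSpectralDensity d τ f) : StrMeas circ f := hf.measurable

end Coordinates

/-! ## Trigonometric polynomials -/

section Trigonometric

instance fact_two_pi_pos : Fact (0 < 2 * Real.pi) := ⟨Real.two_pi_pos⟩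

/-- The character `e^{i t n}`. -/
def chr (n : ℤ) (t : ℝ) : ℂ := exp (I * t * n)

theorem chr_eq_fourier (n : ℤ) (t : ℝ) :
    chr n t = fourier n (t : AddCircle (2 * Real.pi)) := by
  rw [fourier_coe_apply, chr]
  congr 1
  push_cast
  field_simp

theorem chr_mul (m n : ℤ) (t : ℝ) : chr m t * chr n t = chr (m + n) t := by
  rw [chr, chr, chr, ← exp_add]; push_cast; ring_nf

theorem conj_chr (n : ℤ) (t : ℝ) : (starRingEnd ℂ) (chr n t) = chr (-n) t := by
  rw [chr, chr, ← exp_conj]; simp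

theorem norm_chr (n : ℤ) (t : ℝ) : ‖chr n t‖ = 1 := by
  rw [chr, show I * t * n = ((t * n : ℝ) : ℂ) * I by push_cast; ring]
  exact norm_exp_ofReal_mul_I _

theorem continuous_chr (n : ℤ) : Continuous (chr n) := by unfold chr; fun_prop

theorem measurePreserving_circ :
    MeasurePreserving ((↑) : ℝ → AddCircle (2 * Real.pi)) circ AddCircle.haarAddCircle := by
  have h := AddCircle.measurePreserving_mk (2 * Real.pi) (-Real.pi)
  rw [show -Real.pi + 2 * Real.pi = Real.pi by ring] at h
  refine ⟨h.measurable, ?_⟩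
  rw [circ, Measure.map_smul, h.map_eq, AddCircle.volume_eq_smul_haarAddCircle, smul_smul,
    ← ENNReal.ofReal_mul (by positivity)]
  rw [one_div, inv_mul_cancel₀ (by positivity)]
  simp

instance : IsProbabilityMeasure circ := by
  refine ⟨?_⟩
  have := measurePreserving_circ.measure_preimage (s := Set.univ) MeasurableSet.univ.nullMeasurableSet
  simpa using this

theorem integral_circ_comp {F : AddCircle (2 * Real.pi) → ℂ}
    (hF : AEStronglyMeasurable F AddCircle.haarAddCircle) :
    ∫ t, F (t : AddCircle (2 * Real.pi)) ∂circ = ∫ x, F x ∂AddCircle.haarAddCircle := by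
  rw [← measurePreserving_circ.map_eq] at hF ⊢
  exact (integral_map measurePreserving_circ.measurable.aemeasurable hF).symm

theorem integral_chr (n : ℤ) : ∫ t, chr n t ∂circ = if n = 0 then 1 else 0 := by
  simp_rw [chr_eq_fourier]
  rw [integral_circ_comp (fourier n).continuous.aestronglyMeasurable]
  split_ifs with h
  · subst h; simp
  · exact integral_eq_zero_of_add_right_eq_neg (μ := AddCircle.haarAddCircle)
      (fourier_add_half_inv_index h Real.two_pi_pos)

/-- Trigonometric polynomials. -/
def trigPoly : Submodule ℂ (ℝ → ℂ) := Submodule.span ℂ (Set.range chr)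

theorem trigPoly_continuous {p : ℝ → ℂ} (hp : p ∈ trigPoly) : Continuous p := by
  induction hp using Submodule.span_induction with
  | mem x h => obtain ⟨n, rfl⟩ := h; exact continuous_chr n
  | zero => exact continuous_const
  | add x y _ _ hx hy => exact hx.add hy
  | smul a x _ hx => exact hx.const_smul a

theorem exists_continuousMap_of_trigPoly {p : ℝ → ℂ} (hp : p ∈ trigPoly) :
    ∃ P : C(AddCircle (2 * Real.pi), ℂ), ∀ t : ℝ, p t = P t := by
  induction hp using Submodule.span_induction with
  | mem x h => obtain ⟨n, rfl⟩ := h; exact ⟨fourier n, chr_eq_fourier n⟩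
  | zero => exact ⟨0, fun _ => rfl⟩
  | add x y _ _ hx hy =>
    obtain ⟨P, hP⟩ := hx
    obtain ⟨Q, hQ⟩ := hy
    exact ⟨P + Q, fun t => by simp [hP, hQ]⟩
  | smul a x _ hx =>
    obtain ⟨P, hP⟩ := hx
    exact ⟨a • P, fun t => by simp [hP]⟩

theorem trigPoly_bounded {p : ℝ → ℂ} (hp : p ∈ trigPoly) : ∃ K, ∀ t, ‖p t‖ ≤ K := by
  obtain ⟨P, hP⟩ := exists_continuousMap_of_trigPoly hp
  exact ⟨‖P‖, fun t => by rw [hP]; exact P.norm_coe_le_norm _⟩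

theorem trigPoly_integrable {p : ℝ → ℂ} (hp : p ∈ trigPoly) : Integrable p circ := by
  obtain ⟨K, hK⟩ := trigPoly_bounded hp
  exact Integrable.of_bound (trigPoly_continuous hp).aestronglyMeasurable K
    (Eventually.of_forall hK)

theorem trigPoly_of_mem_span {P : C(AddCircle (2 * Real.pi), ℂ)}
    (hP : P ∈ Submodule.span ℂ (Set.range (@fourier (2 * Real.pi)))) :
    (fun t : ℝ => P (t : AddCircle (2 * Real.pi))) ∈ trigPoly := by
  induction hP using Submodule.span_induction with
  | mem x h =>
    obtain ⟨n, rfl⟩ := h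
    exact Submodule.subset_span ⟨n, funext fun t => chr_eq_fourier n t⟩
  | zero => exact trigPoly.zero_mem
  | add x y _ _ hx hy => exact trigPoly.add_mem hx hy
  | smul a x _ hx => exact trigPoly.smul_mem a hx

theorem exists_trigPoly_near_continuousMap (F : C(AddCircle (2 * Real.pi), ℂ)) {δ : ℝ}
    (hδ : 0 < δ) : ∃ p ∈ trigPoly, ∀ t : ℝ, ‖F (t : AddCircle (2 * Real.pi)) - p t‖ < δ := by
  have h : F ∈ (Submodule.span ℂ
      (Set.range (@fourier (2 * Real.pi)))).topologicalClosure := by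
    rw [span_fourier_closure_eq_top]; trivial
  obtain ⟨P, hP, hd⟩ := Metric.mem_closure_iff.1 h δ hδ
  refine ⟨_, trigPoly_of_mem_span hP, fun t => ?_⟩
  rw [dist_eq_norm] at hd
  exact ((F - P).norm_coe_le_norm t).trans_lt hd

theorem exists_trigPoly_majorant {p : ℝ → ℂ} (hp : p ∈ trigPoly) {δ : ℝ} (hδ : 0 < δ) :
    ∃ q ∈ trigPoly, ∀ t, ‖p t‖ ≤ (q t).re ∧ (q t).re ≤ ‖p t‖ + δ := by
  obtain ⟨P, hP⟩ := exists_continuousMap_of_trigPoly hp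
  -- An approximation of `‖p‖ + δ/2` within `δ/2` lies between `‖p‖` and `‖p‖ + δ`.
  let F : C(AddCircle (2 * Real.pi), ℂ) :=
    ⟨fun x => ((‖P x‖ + δ / 2 : ℝ) : ℂ), by fun_prop⟩
  obtain ⟨q, hq, hqF⟩ := exists_trigPoly_near_continuousMap F (half_pos hδ)
  refine ⟨q, hq, fun t => ?_⟩
  have h1 := (abs_re_le_norm _).trans (hqF t).le
  rw [sub_re, abs_le] at h1
  have h2 : (F (t : AddCircle (2 * Real.pi))).re = ‖p t‖ + δ / 2 := by
    rw [hP]; exact ofReal_re _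
  rw [h2] at h1
  constructor <;> linarith

/-- Moves a function from the interval to the circle group, where density of continuous functions
and completeness of the Fourier system apply. -/
theorem exists_memLp_lift {u : ℝ → ℂ} {p : ℝ≥0∞} (hu : MemLp u p circ) :
    ∃ U : AddCircle (2 * Real.pi) → ℂ, MemLp U p AddCircle.haarAddCircle ∧
      ∀ᵐ t : ℝ ∂circ, U (t : AddCircle (2 * Real.pi)) = u t := by
  have hu' : MemLp u p (volume.restrict (Set.Ioc (-Real.pi) (-Real.pi + 2 * Real.pi))) := by
    rw [show -Real.pi + 2 * Real.pi = Real.pi by ring]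
    have := hu.smul_measure (c := ENNReal.ofReal (2 * Real.pi)) ENNReal.ofReal_ne_top
    rw [circ, smul_smul, ← ENNReal.ofReal_mul (by positivity)] at this
    rw [mul_one_div_cancel (by positivity)] at this
    simpa using this
  refine ⟨AddCircle.liftIoc (2 * Real.pi) (-Real.pi) u, hu'.memLp_liftIoc.haarAddCircle, ?_⟩
  refine Measure.ae_smul_measure ?_ _
  refine (ae_restrict_mem measurableSet_Ioc).mono fun t ht => ?_
  refine AddCircle.liftIoc_coe_apply ?_
  rwa [show -Real.pi + 2 * Real.pi = Real.pi by ring]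

theorem exists_trigPoly_near_integrable {u : ℝ → ℂ} (hu : Integrable u circ) {δ : ℝ}
    (hδ : 0 < δ) : ∃ p ∈ trigPoly, ∫ t, ‖u t - p t‖ ∂circ ≤ δ := by
  obtain ⟨U, hU, hUu⟩ := exists_memLp_lift (memLp_one_iff_integrable.2 hu)
  obtain ⟨F, hF, hFi⟩ :=
    (hU.integrable le_rfl).exists_boundedContinuous_integral_sub_le (half_pos hδ)
  obtain ⟨p, hp, hpF⟩ := exists_trigPoly_near_continuousMap F.toContinuousMap (half_pos hδ)
  refine ⟨p, hp, ?_⟩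
  have hd : Integrable (fun x => U x - F x) AddCircle.haarAddCircle :=
    (hU.integrable le_rfl).sub hFi
  have hi : Integrable (fun t : ℝ => ‖U (t : AddCircle (2 * Real.pi)) - F t‖) circ :=
    (measurePreserving_circ.integrable_comp hd.aestronglyMeasurable).2 hd |>.norm
  have hval : ∫ t : ℝ, ‖U (t : AddCircle (2 * Real.pi)) - F t‖ ∂circ
      = ∫ x, ‖U x - F x‖ ∂AddCircle.haarAddCircle := by
    have hn := hd.norm.aestronglyMeasurable
    rw [← measurePreserving_circ.map_eq] at hn ⊢
    exact (integral_map measurePreserving_circ.measurable.aemeasurable hn).symm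
  calc ∫ t, ‖u t - p t‖ ∂circ
      ≤ ∫ t : ℝ, (‖U (t : AddCircle (2 * Real.pi)) - F t‖ + δ / 2) ∂circ := by
        refine integral_mono_ae (hu.sub (trigPoly_integrable hp)).norm
          (hi.add (integrable_const _)) ?_
        filter_upwards [hUu] with t ht
        rw [← ht]
        calc _ ≤ _ := norm_sub_le_norm_sub_add_norm_sub _ (F (t : AddCircle (2 * Real.pi))) _
          _ ≤ _ := by gcongr; exact (hpF t).le
    _ ≤ δ := by
        rw [integral_add hi (integrable_const _), hval]
        simp only [integral_const, probReal_univ, one_smul]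
        linarith

theorem ae_eq_zero_of_forall_integral_chr {u : ℝ → ℂ} (hu : MemLp u 2 circ)
    (h : ∀ n : ℤ, ∫ t, chr n t * u t ∂circ = 0) : u =ᵐ[circ] 0 := by
  obtain ⟨U, hU, hUu⟩ := exists_memLp_lift hu
  have hcoef : ∀ n : ℤ, fourierCoeff (hU.toLp U) n = 0 := fun n => by
    rw [fourierCoeff]
    calc _ = ∫ x, fourier (-n) x * U x ∂AddCircle.haarAddCircle :=
          integral_congr_ae (hU.coeFn_toLp.mono fun x hx => by simp only [hx, smul_eq_mul])
      _ = ∫ t : ℝ, fourier (-n) (t : AddCircle (2 * Real.pi)) * U t ∂circ :=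
          (integral_circ_comp ((fourier (-n)).continuous.aestronglyMeasurable.mul
            hU.aestronglyMeasurable)).symm
      _ = ∫ t, chr (-n) t * u t ∂circ := integral_congr_ae
          (hUu.mono fun t ht => by simp only [ht, chr_eq_fourier])
      _ = 0 := h _
  have h0 : hU.toLp U = 0 := by
    refine fourierBasis.repr.injective ?_
    ext n
    rw [fourierBasis_repr, hcoef]
    simp
  have h1 : U =ᵐ[AddCircle.haarAddCircle] 0 := (Lp.eq_zero_iff_ae_eq_zero.1 h0 |>.symm.trans
    hU.coeFn_toLp).symm
  have h2 := measurePreserving_circ.quasiMeasurePreserving.ae_eq_comp h1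
  filter_upwards [h2, hUu] with t ht1 ht2
  rw [← ht2]; exact ht1

/-- The function `e^{-it}`. -/
def zc (t : ℝ) : ℂ := chr (-1) t

theorem zc_pow (n : ℕ) (t : ℝ) : zc t ^ n = chr (-n) t := by
  rw [zc, chr, chr, ← exp_nat_mul]; push_cast; ring_nf

theorem continuous_zc : Continuous zc := continuous_chr _

theorem norm_zc (t : ℝ) : ‖zc t‖ = 1 := norm_chr _ _

/-- The mean value property: `zc` runs over the unit circle, and only the constant term has a
nonzero mean. -/
theorem integral_poly (P : Polynomial ℂ) : ∫ t, P.eval (zc t) ∂circ = P.eval 0 := by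
  simp_rw [Polynomial.eval_eq_sum_range, zc_pow]
  rw [integral_finsetSum]
  · simp_rw [integral_const_mul, integral_chr]
    rw [Finset.sum_eq_single 0 (fun b _ hb => by simp [hb]) (fun h => by simp at h),
      Finset.sum_eq_single 0 (fun b _ hb => by simp [hb]) (fun h => by simp at h)]
    simp
  · exact fun n _ => (trigPoly_integrable (Submodule.subset_span ⟨_, rfl⟩)).const_mul _

/-- Characters `e^{int}` with `n > 0` are replaced by their conjugates, with conjugate coefficients;
this keeps the real part and makes the polynomial analytic in `zc`. An imaginary constant then
normalizes the value at `0`. -/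
theorem exists_poly_re_eq {q : ℝ → ℂ} (hq : q ∈ trigPoly) :
    ∃ P : Polynomial ℂ, (∀ t, (P.eval (zc t)).re = (q t).re) ∧ (P.eval 0).im = 0 := by
  have h : ∃ P : Polynomial ℂ, ∀ t, (P.eval (zc t)).re = (q t).re := by
    suffices H : ∀ q ∈ trigPoly, ∀ c : ℂ, ∃ P : Polynomial ℂ, ∀ t,
        (P.eval (zc t)).re = (c * q t).re by
      obtain ⟨P, hP⟩ := H q hq 1
      exact ⟨P, fun t => by simpa using hP t⟩
    intro q hq
    induction hq using Submodule.span_induction with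
    | mem x h =>
      obtain ⟨n, rfl⟩ := h
      intro c
      rcases le_or_gt n 0 with hn | hn
      · obtain ⟨m, rfl⟩ := Int.exists_eq_neg_ofNat hn
        refine ⟨Polynomial.C c * Polynomial.X ^ m, fun t => ?_⟩
        simp [zc_pow]
      · obtain ⟨m, rfl⟩ := Int.eq_ofNat_of_zero_le hn.le
        refine ⟨Polynomial.C ((starRingEnd ℂ) c) * Polynomial.X ^ m, fun t => ?_⟩
        have : (starRingEnd ℂ) (c * chr m t) = (starRingEnd ℂ) c * zc t ^ m := by
          rw [map_mul, conj_chr, zc_pow]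
        rw [← conj_re (c * chr m t), this]
        simp
    | zero => exact fun c => ⟨0, fun t => by simp⟩
    | add x y _ _ hx hy =>
      intro c
      obtain ⟨P, hP⟩ := hx c
      obtain ⟨Q, hQ⟩ := hy c
      exact ⟨P + Q, fun t => by
        rw [Polynomial.eval_add, add_re, hP, hQ, Pi.add_apply, mul_add, add_re]⟩
    | smul a x _ hx =>
      intro c
      obtain ⟨P, hP⟩ := hx (c * a)
      exact ⟨P, fun t => by rw [hP, Pi.smul_apply, smul_eq_mul, mul_assoc]⟩
  obtain ⟨P, hP⟩ := h
  refine ⟨P - Polynomial.C (((P.eval 0).im : ℂ) * I), fun t => ?_, ?_⟩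
  · simp [hP]
  · simp

theorem exists_poly_near_exp (G : Polynomial ℂ) {δ : ℝ} (hδ : 0 < δ) :
    ∃ A : Polynomial ℂ, (∀ t, ‖A.eval (zc t) - exp (G.eval (zc t))‖ ≤ δ) ∧
      ‖A.eval 0 - exp (G.eval 0)‖ ≤ δ := by
  obtain ⟨R, hR⟩ : ∃ R, ∀ w ∈ Metric.closedBall (0 : ℂ) 1, ‖G.eval w‖ ≤ R :=
    (isCompact_closedBall 0 1).exists_bound_of_continuousOn G.continuous.continuousOn
  have hlim : Tendsto (fun n => Real.exp R - ∑ m ∈ Finset.range n, R ^ m / m.factorial) atTop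
      (𝓝 0) := by
    have := (Real.exp_eq_exp_ℝ ▸ NormedSpace.expSeries_div_hasSum_exp (𝔸 := ℝ) R).tendsto_sum_nat
    simpa using this.const_sub (Real.exp R)
  obtain ⟨n, hn⟩ := ((hlim.eventually (ge_mem_nhds hδ))).exists
  -- The Taylor remainder of `exp` has nonnegative coefficients, so on `[0, R]` it is largest at
  -- `R`; one degree `n` serves the whole closed disc.
  have hmono : ∀ x : ℝ, 0 ≤ x → x ≤ R → Real.exp x - ∑ m ∈ Finset.range n, x ^ m / m.factorial ≤
      Real.exp R - ∑ m ∈ Finset.range n, R ^ m / m.factorial := fun x hx0 hx => by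
    have hx' := (Real.exp_eq_exp_ℝ ▸ NormedSpace.expSeries_div_hasSum_exp (𝔸 := ℝ) x)
    have hR' := (Real.exp_eq_exp_ℝ ▸ NormedSpace.expSeries_div_hasSum_exp (𝔸 := ℝ) R)
    rw [← hx'.tsum_eq, ← hR'.tsum_eq, ← hx'.summable.sum_add_tsum_nat_add n,
      ← hR'.summable.sum_add_tsum_nat_add n, add_sub_cancel_left, add_sub_cancel_left]
    refine Summable.tsum_le_tsum (fun k => ?_) ((summable_nat_add_iff n).2 hx'.summable)
      ((summable_nat_add_iff n).2 hR'.summable)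
    gcongr
  refine ⟨∑ m ∈ Finset.range n, Polynomial.C ((m.factorial : ℂ)⁻¹) * G ^ m, ?_⟩
  have key : ∀ w : ℂ, ‖w‖ ≤ 1 → ‖(∑ m ∈ Finset.range n,
      Polynomial.C ((m.factorial : ℂ)⁻¹) * G ^ m).eval w - exp (G.eval w)‖ ≤ δ := fun w hw => by
    rw [norm_sub_rev, Polynomial.eval_finsetSum]
    simp only [Polynomial.eval_mul, Polynomial.eval_C, Polynomial.eval_pow]
    have h1 := norm_exp_sub_sum_le_exp_norm_sub_sum (G.eval w) n
    have h2 := hmono _ (norm_nonneg _) (hR w (by simpa using hw))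
    refine le_trans (le_of_eq ?_) (h1.trans (h2.trans hn))
    simp_rw [div_eq_inv_mul]
  exact ⟨fun t => key _ (norm_zc t).le, key 0 (by simp)⟩

theorem integral_exp_poly (G : Polynomial ℂ) :
    ∫ t, exp (G.eval (zc t)) ∂circ = exp (G.eval 0) := by
  have hc : Continuous fun t => exp (G.eval (zc t)) :=
    Complex.continuous_exp.comp (G.continuous.comp continuous_zc)
  refine eq_of_forall_dist_le fun ε hε => ?_
  obtain ⟨A, hA1, hA2⟩ := exists_poly_near_exp G (half_pos hε)
  have hAi : Integrable (fun t => A.eval (zc t)) circ := by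
    obtain ⟨R, hR⟩ : ∃ R, ∀ w ∈ Metric.closedBall (0 : ℂ) 1, ‖A.eval w‖ ≤ R :=
      (isCompact_closedBall 0 1).exists_bound_of_continuousOn A.continuous.continuousOn
    exact Integrable.of_bound (A.continuous.comp continuous_zc).aestronglyMeasurable R
      (Eventually.of_forall fun t => hR _ (by simp [norm_zc]))
  have hdi : Integrable (fun t => A.eval (zc t) - exp (G.eval (zc t))) circ :=
    Integrable.of_bound ((A.continuous.comp continuous_zc).sub hc).aestronglyMeasurable _
      (Eventually.of_forall hA1)
  have hei : Integrable (fun t => exp (G.eval (zc t))) circ := by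
    exact (hAi.sub hdi).congr (Eventually.of_forall fun t => by simp)
  have h1 : ‖∫ t, (A.eval (zc t) - exp (G.eval (zc t))) ∂circ‖ ≤ ε / 2 := by
    refine (norm_integral_le_of_norm_le_const (Eventually.of_forall hA1)).trans ?_
    simp
  rw [integral_sub hAi hei, integral_poly] at h1
  rw [dist_eq_norm]
  calc _ = ‖(A.eval 0 - exp (G.eval 0)) - (A.eval 0 - ∫ t, exp (G.eval (zc t)) ∂circ)‖ := by
        congr 1; ring
    _ ≤ ε / 2 + ε / 2 := (norm_sub_le _ _).trans (add_le_add hA2 h1)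
    _ = ε := by ring

/-- Since `‖e^{-G}‖ ≤ 1`, `‖1 - e^{-G}‖² ≤ 2 - 2 Re e^{-G}`. By the mean value property the right
side has mean `2 - 2 e^{-G(0)} ≤ 2 G(0)`; nonnegativity of the variance passes from the second
moment to the first. -/
theorem integral_norm_one_sub_exp_le {G : Polynomial ℂ} (hG : ∀ t, 0 ≤ (G.eval (zc t)).re)
    (h0 : (G.eval 0).im = 0) :
    ∫ t, ‖1 - exp (-G.eval (zc t))‖ ∂circ ≤ √(2 * (G.eval 0).re) := by
  have hc : Continuous fun t => exp (-G.eval (zc t)) :=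
    Complex.continuous_exp.comp (G.continuous.comp continuous_zc).neg
  have hle : ∀ t, ‖exp (-G.eval (zc t))‖ ≤ 1 := fun t => by
    rw [norm_exp, Real.exp_le_one_iff]; simpa using hG t
  have hei : Integrable (fun t => exp (-G.eval (zc t))) circ :=
    Integrable.of_bound hc.aestronglyMeasurable 1 (Eventually.of_forall hle)
  have hint : ∫ t, exp (-G.eval (zc t)) ∂circ = exp (-G.eval 0) := by
    simpa using integral_exp_poly (-G)
  have hG0 : G.eval 0 = ((G.eval 0).re : ℂ) := by
    apply Complex.ext <;> simp [h0]
  have hre : ∫ t, (exp (-G.eval (zc t))).re ∂circ = Real.exp (-(G.eval 0).re) := by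
    have := integral_re (𝕜 := ℂ) hei
    rw [hint, hG0, ← ofReal_neg, ← ofReal_exp] at this
    exact this.trans (ofReal_re _)
  have hre_i : Integrable (fun t => (exp (-G.eval (zc t))).re) circ := hei.re
  set F : ℝ → ℝ := fun t => ‖1 - exp (-G.eval (zc t))‖ with hF
  have hFc : Continuous F := (continuous_const.sub hc).norm
  have hF2 : ∀ t, F t ≤ 2 := fun t => by
    refine (norm_sub_le _ _).trans ?_
    rw [norm_one]; linarith [hle t]
  have hFi : MemLp F 2 circ := MemLp.of_bound hFc.aestronglyMeasurable 2
    (Eventually.of_forall fun t => by rw [Real.norm_of_nonneg (norm_nonneg _)]; exact hF2 t)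
  have hsq : ∫ t, F t ^ 2 ∂circ ≤ 2 * (G.eval 0).re := by
    calc ∫ t, F t ^ 2 ∂circ ≤ ∫ t, (2 - 2 * (exp (-G.eval (zc t))).re) ∂circ := by
          refine integral_mono hFi.integrable_sq
            ((integrable_const _).sub (hre_i.const_mul 2)) fun t => ?_
          have h1 := hle t
          have h2 : ‖exp (-G.eval (zc t))‖ ^ 2 ≤ 1 := pow_le_one₀ (norm_nonneg _) h1
          simp only [hF, ← normSq_eq_norm_sq, normSq_sub] at h2 ⊢
          simp at h2 ⊢
          linarith
      _ = 2 - 2 * Real.exp (-(G.eval 0).re) := by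
          rw [integral_sub (integrable_const _) (hre_i.const_mul 2), integral_const_mul, hre]
          simp
      _ ≤ 2 * (G.eval 0).re := by
          linarith [Real.add_one_le_exp (-(G.eval 0).re)]
  refine Real.le_sqrt_of_sq_le (le_trans ?_ hsq)
  have hvar := ProbabilityTheory.variance_nonneg F circ
  rw [ProbabilityTheory.variance_eq_sub hFi] at hvar
  simpa using hvar

end Trigonometric

/-! ## Outer functions -/

section Outer

theorem ae_summable_of_summable_integral {α : Type*} [MeasurableSpace α] {μ : Measure α}
    {f : ℕ → α → ℝ} (hf : ∀ n, Integrable (f n) μ) (h0 : ∀ n t, 0 ≤ f n t) {c : ℕ → ℝ}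
    (hc : Summable c) (hle : ∀ n, ∫ t, f n t ∂μ ≤ c n) :
    ∀ᵐ t ∂μ, Summable fun n => f n t := by
  have h1 : ∫⁻ t, ∑' n, ENNReal.ofReal (f n t) ∂μ ≠ ⊤ := by
    rw [lintegral_tsum fun n => (hf n).aemeasurable.ennreal_ofReal]
    have h2 : ∀ n, ∫⁻ t, ENNReal.ofReal (f n t) ∂μ ≤ ENNReal.ofReal (c n) := fun n => by
      rw [← ofReal_integral_eq_lintegral_ofReal (hf n) (Eventually.of_forall (h0 n))]
      exact ENNReal.ofReal_le_ofReal (hle n)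
    refine ne_top_of_le_ne_top ?_ (ENNReal.tsum_le_tsum h2)
    exact hc.tsum_ofReal_ne_top
  have h3 := ae_lt_top' (AEMeasurable.tsum fun n =>
    (hf n).aemeasurable.ennreal_ofReal) h1
  filter_upwards [h3] with t ht
  have := ENNReal.summable_toReal ht.ne
  simpa [ENNReal.toReal_ofReal (h0 _ _)] using this

/-- Decompose `u` into rapidly decreasing trigonometric polynomials, majorize each modulus by the
real part of an analytic polynomial, and add. The value at `0` of each polynomial is the mean of the
majorant, so `L₁` bounds control it. -/
theorem exists_analytic_majorant {u : ℝ → ℂ} (hu : Integrable u circ) :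
    ∃ Q : ℕ → Polynomial ℂ, (∀ n t, 0 ≤ ((Q n).eval (zc t)).re) ∧ (∀ n, ((Q n).eval 0).im = 0) ∧
      Summable (fun n => √(2 * ((Q n).eval 0).re)) ∧
      ∀ᵐ t ∂circ, ∀ᶠ N in atTop, ‖u t‖ ≤ ∑ n ∈ Finset.range N, ((Q n).eval (zc t)).re + 1 := by
  have hpos : ∀ n : ℕ, (0 : ℝ) < (1 / 4) ^ n := fun n => by positivity
  choose p hp hpu using fun n => exists_trigPoly_near_integrable hu (hpos n)
  -- The partial sums of `D` telescope to the approximants `p`.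
  let D : ℕ → ℝ → ℂ := fun n => Nat.casesOn n (p 0) fun n => p (n + 1) - p n
  have hD : ∀ n, D n ∈ trigPoly := fun n => by
    cases n with
    | zero => exact hp 0
    | succ n => exact trigPoly.sub_mem (hp _) (hp _)
  choose q hq hqD using fun n => exists_trigPoly_majorant (hD n) (hpos n)
  choose Q hQ hQ0 using fun n => exists_poly_re_eq (hq n)
  have hc : ∀ n, ((Q n).eval 0).re = ∫ t, (q n t).re ∂circ := fun n => by
    rw [← integral_poly]
    have hi : Integrable (fun t => (Q n).eval (zc t)) circ := by
      obtain ⟨R, hR⟩ : ∃ R, ∀ w ∈ Metric.closedBall (0 : ℂ) 1, ‖(Q n).eval w‖ ≤ R :=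
        (isCompact_closedBall 0 1).exists_bound_of_continuousOn (Q n).continuous.continuousOn
      exact Integrable.of_bound ((Q n).continuous.comp continuous_zc).aestronglyMeasurable R
        (Eventually.of_forall fun t => hR _ (by simp [norm_zc]))
    have h1 := integral_re (𝕜 := ℂ) hi
    refine h1.symm.trans (integral_congr_ae (Eventually.of_forall fun t => hQ n t))
  have hui : ∀ n, Integrable (fun t => ‖u t - p n t‖) circ := fun n =>
    (hu.sub (trigPoly_integrable (hp n))).norm
  refine ⟨Q, fun n t => ?_, hQ0, ?_, ?_⟩
  · rw [hQ]; exact (norm_nonneg _).trans (hqD n t).1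
  · refine (summable_nat_add_iff 1).1 ?_
    -- The difference of approximants costs `4^{-n} + 4^{-(n+1)}` and the majorant `4^{-(n+1)}`,
    -- together at most `3 · 4^{-n}`; hence square roots of size `√6 · 2^{-n}`.
    have hb : ∀ n, √(2 * ((Q (n + 1)).eval 0).re) ≤ √6 * (1 / 2) ^ n := fun n => by
      have h1 : ((Q (n + 1)).eval 0).re ≤ 3 * (1 / 4) ^ n := by
        rw [hc]
        calc ∫ t, (q (n + 1) t).re ∂circ
            ≤ ∫ t, ((‖u t - p n t‖ + ‖u t - p (n + 1) t‖) + (1 / 4) ^ (n + 1)) ∂circ := by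
              refine integral_mono (trigPoly_integrable (hq _)).re
                (((hui n).add (hui (n + 1))).add (integrable_const _)) fun t => ?_
              refine (hqD (n + 1) t).2.trans ?_
              gcongr
              have : D (n + 1) t = (u t - p n t) - (u t - p (n + 1) t) := by
                change p (n + 1) t - p n t = _; ring
              rw [this]
              exact norm_sub_le _ _
          _ ≤ (1 / 4) ^ n + (1 / 4) ^ (n + 1) + (1 / 4) ^ (n + 1) := by
              have hadd : Integrable (fun t => ‖u t - p n t‖ + ‖u t - p (n + 1) t‖) circ :=
                (hui n).add (hui (n + 1))
              rw [integral_add hadd (integrable_const _), integral_add (hui n) (hui (n + 1))]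
              have := hpu n
              have := hpu (n + 1)
              simp only [integral_const, probReal_univ, one_smul]
              linarith
          _ ≤ 3 * (1 / 4) ^ n := by rw [pow_succ]; linarith [hpos n]
      calc √(2 * ((Q (n + 1)).eval 0).re) ≤ √(6 * ((1 / 2) ^ n) ^ 2) := by
            apply Real.sqrt_le_sqrt
            rw [← pow_mul, mul_comm n 2, pow_mul]
            norm_num at h1 ⊢
            linarith
        _ = _ := by rw [Real.sqrt_mul (by norm_num), Real.sqrt_sq (by positivity)]
    exact Summable.of_nonneg_of_le (fun _ => Real.sqrt_nonneg _) hb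
      ((summable_geometric_of_lt_one (by norm_num) (by norm_num)).mul_left _)
  · have hs := ae_summable_of_summable_integral hui (fun _ _ => norm_nonneg _)
      (summable_geometric_of_lt_one (by norm_num : (0 : ℝ) ≤ 1 / 4) (by norm_num)) hpu
    filter_upwards [hs] with t ht
    have h1 : ∀ᶠ N in atTop, ‖u t - p N t‖ ≤ 1 :=
      ht.tendsto_atTop_zero.eventually (ge_mem_nhds one_pos)
    obtain ⟨M, hM⟩ := eventually_atTop.1 h1
    refine eventually_atTop.2 ⟨M + 1, fun N hN => ?_⟩
    obtain ⟨L, rfl⟩ : ∃ L, N = L + 1 := ⟨N - 1, by omega⟩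
    have hpD : p L t = ∑ n ∈ Finset.range (L + 1), D n t := by
      rw [Finset.sum_range_succ']
      change _ = ∑ n ∈ Finset.range L, (p (n + 1) t - p n t) + p 0 t
      rw [Finset.sum_range_sub (fun n => p n t)]; ring
    calc ‖u t‖ ≤ ‖p L t‖ + ‖u t - p L t‖ := by
          simpa using norm_add_le (p L t) (u t - p L t)
      _ ≤ ∑ n ∈ Finset.range (L + 1), ((Q n).eval (zc t)).re + 1 := by
          gcongr
          · rw [hpD]
            refine (norm_sum_le _ _).trans (Finset.sum_le_sum fun n _ => ?_)
            rw [hQ]; exact (hqD n t).1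
          · exact hM L (by omega)

/-- Take `O = exp(-e ∑ Q_n)` for the analytic majorant. Its modulus is at most `exp(-e(‖u‖ - 1))`,
so `‖O‖ ‖u‖` is bounded because `x e^{-ex}` is. A small `e` keeps `O` near `1` in mean, and the
partial products are uniform limits of polynomials in `zc`, which makes `O` analytic. -/
theorem exists_outer {u : ℝ → ℂ} (hu : Integrable u circ) {δ : ℝ} (hδ : 0 < δ) :
    ∃ O : ℝ → ℂ, AEStronglyMeasurable O circ ∧
      (∃ A : ℕ → Polynomial ℂ, (∀ n t, ‖(A n).eval (zc t)‖ ≤ 2) ∧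
        ∀ᵐ t ∂circ, Tendsto (fun n => (A n).eval (zc t)) atTop (𝓝 (O t))) ∧
      (∀ᵐ t ∂circ, ‖O t‖ ≤ 1) ∧ (∃ K, 0 ≤ K ∧ ∀ᵐ t ∂circ, ‖O t‖ * ‖u t‖ ≤ K) ∧
      ∫ t, ‖1 - O t‖ ∂circ ≤ δ := by
  obtain ⟨Q, hQ, hQ0, hQs, hQu⟩ := exists_analytic_majorant hu
  set S := ∑' n, √(2 * ((Q n).eval 0).re) with hS
  have hS0 : 0 ≤ S := tsum_nonneg fun _ => Real.sqrt_nonneg _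
  -- Chosen so that `√e · S ≤ δ`; the `+ 1` guards against `S = 0`.
  set e : ℝ := (δ / (S + 1)) ^ 2 with he
  have he0 : 0 < e := by positivity
  set R : ℕ → Polynomial ℂ := fun n => Polynomial.C (e : ℂ) * Q n with hR
  have hRev : ∀ n w, ((R n).eval w).re = e * ((Q n).eval w).re := fun n w => by simp [hR]
  have hR1 : ∀ n t, 0 ≤ ((R n).eval (zc t)).re := fun n t => by
    rw [hRev]; exact mul_nonneg he0.le (hQ n t)
  have hR0 : ∀ n, ((R n).eval 0).im = 0 := fun n => by simp [hR, hQ0]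
  set s : ℕ → ℝ → ℂ := fun N t => exp (-(∑ n ∈ Finset.range N, R n).eval (zc t)) with hs
  have hs_cont : ∀ N, Continuous (s N) := fun N =>
    Complex.continuous_exp.comp ((Polynomial.continuous _).comp continuous_zc).neg
  have hs_norm : ∀ N t, ‖s N t‖ = Real.exp (-(e * ∑ n ∈ Finset.range N, ((Q n).eval (zc t)).re)) :=
    fun N t => by
      rw [hs]
      simp only [norm_exp, neg_re, Polynomial.eval_finsetSum, re_sum, hRev, Finset.mul_sum]
  have hs_le : ∀ N t, ‖s N t‖ ≤ 1 := fun N t => by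
    rw [hs_norm, Real.exp_le_one_iff, neg_nonpos]
    exact mul_nonneg he0.le (Finset.sum_nonneg fun n _ => hQ n t)
  have hs_zero : ∀ t, s 0 t = 1 := fun t => by simp [hs]
  have hs_succ : ∀ N t, s (N + 1) t = s N t * exp (-(R N).eval (zc t)) := fun N t => by
    simp only [hs, Finset.sum_range_succ, Polynomial.eval_add, neg_add, exp_add]
  set f : ℕ → ℝ → ℝ := fun n t => ‖1 - exp (-(R n).eval (zc t))‖ with hf
  have hf_cont : ∀ n, Continuous (f n) := fun n => (continuous_const.sub
    (Complex.continuous_exp.comp ((Polynomial.continuous _).comp continuous_zc).neg)).norm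
  have hf_int : ∀ n, Integrable (f n) circ := fun n =>
    Integrable.of_bound (hf_cont n).aestronglyMeasurable 2 (Eventually.of_forall fun t => by
      rw [Real.norm_of_nonneg (norm_nonneg _)]
      refine (norm_sub_le _ _).trans ?_
      have : ‖exp (-(R n).eval (zc t))‖ ≤ 1 := by
        rw [norm_exp, Real.exp_le_one_iff]; simpa using hR1 n t
      rw [norm_one]; linarith)
  have hf_le : ∀ n, ∫ t, f n t ∂circ ≤ √e * √(2 * ((Q n).eval 0).re) := fun n => by
    refine (integral_norm_one_sub_exp_le (hR1 n) (hR0 n)).trans (le_of_eq ?_)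
    rw [hRev, ← Real.sqrt_mul he0.le]; ring_nf
  have hd : ∀ n t, ‖s (n + 1) t - s n t‖ ≤ f n t := fun n t => by
    rw [hs_succ, ← norm_neg, show -(s n t * exp (-(R n).eval (zc t)) - s n t)
      = s n t * (1 - exp (-(R n).eval (zc t))) by ring, norm_mul]
    exact mul_le_of_le_one_left (norm_nonneg _) (hs_le n t)
  have hsum := ae_summable_of_summable_integral hf_int (fun _ _ => norm_nonneg _)
    (hQs.mul_left (√e)) hf_le
  set O : ℝ → ℂ := fun t => 1 + ∑' n, (s (n + 1) t - s n t) with hO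
  have hlim : ∀ᵐ t ∂circ, Tendsto (fun n => s n t) atTop (𝓝 (O t)) := by
    filter_upwards [hsum] with t ht
    have h1 : Summable fun n => s (n + 1) t - s n t := Summable.of_norm_bounded ht (hd · t)
    have h2 := h1.hasSum.tendsto_sum_nat.const_add 1
    refine h2.congr fun N => ?_
    rw [Finset.sum_range_sub (fun n => s n t), hs_zero]; ring
  have hOm : AEStronglyMeasurable O circ :=
    aestronglyMeasurable_of_tendsto_ae atTop (fun n => (hs_cont n).aestronglyMeasurable) hlim
  refine ⟨O, hOm, ?_, ?_, ?_, ?_⟩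
  · have hpos : ∀ n : ℕ, (0 : ℝ) < 1 / (n + 1) := fun n => by positivity
    -- The error `1 / (n + 1) ≤ 1` added to partial products of modulus at most `1` gives the
    -- uniform bound `2`, and it vanishes in the limit.
    choose A hA _ using fun n : ℕ =>
      exists_poly_near_exp (-(∑ k ∈ Finset.range n, R k)) (hpos n)
    have hA' : ∀ (n : ℕ) t, ‖(A n).eval (zc t) - s n t‖ ≤ 1 / ((n : ℝ) + 1) := fun n t => by
      simpa [hs] using hA n t
    refine ⟨A, fun n t => ?_, ?_⟩
    · have h1 : (1 : ℝ) / (n + 1) ≤ 1 := by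
        rw [div_le_one (by positivity)]; linarith [(Nat.cast_nonneg n : (0 : ℝ) ≤ n)]
      calc ‖(A n).eval (zc t)‖ ≤ ‖(A n).eval (zc t) - s n t‖ + ‖s n t‖ := by
            simpa using norm_add_le ((A n).eval (zc t) - s n t) (s n t)
        _ ≤ 2 := by linarith [hA' n t, hs_le n t]
    · filter_upwards [hlim] with t ht
      have h0 : Tendsto (fun n => (A n).eval (zc t) - s n t) atTop (𝓝 0) :=
        squeeze_zero_norm (hA' · t) tendsto_one_div_add_atTop_nhds_zero_nat
      simpa using h0.add ht
  · filter_upwards [hlim] with t ht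
    exact le_of_tendsto ht.norm (Eventually.of_forall fun n => hs_le n t)
  · refine ⟨Real.exp e / e, by positivity, ?_⟩
    filter_upwards [hlim, hQu] with t ht hut
    refine le_of_tendsto (ht.norm.mul_const ‖u t‖) (hut.mono fun N hN => ?_)
    rw [hs_norm]
    calc _ ≤ Real.exp (-(e * (‖u t‖ - 1))) * ‖u t‖ := by
          gcongr; linarith
      _ = Real.exp e * (Real.exp (-(e * ‖u t‖)) * ‖u t‖) := by
          rw [← mul_assoc, ← Real.exp_add]; ring_nf
      _ ≤ Real.exp e * (1 / e) := by
          gcongr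
          rw [le_div_iff₀ he0, Real.exp_neg, inv_mul_eq_div, div_mul_eq_mul_div,
            div_le_one (Real.exp_pos _)]
          linarith [Real.add_one_le_exp (e * ‖u t‖)]
      _ = _ := by ring
  · have h1 : Tendsto (fun n => ∫ t, ‖1 - s n t‖ ∂circ) atTop (𝓝 (∫ t, ‖1 - O t‖ ∂circ)) := by
      refine tendsto_integral_of_dominated_convergence (fun _ => 2)
        (fun n => (continuous_const.sub (hs_cont n)).norm.aestronglyMeasurable)
        (integrable_const _) (fun n => Eventually.of_forall fun t => ?_) ?_
      · rw [norm_norm]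
        refine (norm_sub_le _ _).trans ?_
        rw [norm_one]; linarith [hs_le n t]
      · filter_upwards [hlim] with t ht
        exact (tendsto_const_nhds.sub ht).norm
    refine le_of_tendsto h1 (Eventually.of_forall fun N => ?_)
    calc ∫ t, ‖1 - s N t‖ ∂circ ≤ ∫ t, ∑ n ∈ Finset.range N, f n t ∂circ := by
          refine integral_mono_of_nonneg (Eventually.of_forall fun _ => norm_nonneg _)
            (integrable_finsetSum _ fun n _ => hf_int n) (Eventually.of_forall fun t => ?_)
          change ‖1 - s N t‖ ≤ _
          rw [norm_sub_rev, ← hs_zero t, ← Finset.sum_range_sub (fun n => s n t)]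
          exact (norm_sum_le _ _).trans (Finset.sum_le_sum fun n _ => hd n t)
      _ ≤ ∑ n ∈ Finset.range N, √e * √(2 * ((Q n).eval 0).re) := by
          rw [integral_finsetSum _ fun n _ => hf_int n]
          exact Finset.sum_le_sum fun n _ => hf_le n
      _ ≤ √e * S := by
          rw [← Finset.mul_sum]
          gcongr
          exact hQs.sum_le_tsum _ fun _ _ => Real.sqrt_nonneg _
      _ ≤ δ := by
          rw [he, Real.sqrt_sq (by positivity), div_mul_eq_mul_div, div_le_iff₀ (by positivity)]
          nlinarith

end Outer

/-! ## Vector polynomials -/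

section VectorPolynomials

variable {ι : Type*}

/-- The monomials `e^{-itj} δ_k`, `j ≥ 0`. -/
def vmono (p : ℕ × ι) (t : ℝ) : H ι := zc t ^ p.1 • delta p.2

/-- The span of the monomials `e^{-itj} δ_k`, `j ≥ 0`. -/
def vpoly (ι : Type*) : Submodule ℂ (ℝ → H ι) := Submodule.span ℂ (Set.range vmono)

theorem vpoly_continuous {p : ℝ → H ι} (hp : p ∈ vpoly ι) : Continuous p := by
  induction hp using Submodule.span_induction with
  | mem x h => obtain ⟨n, rfl⟩ := h; exact (continuous_zc.pow _).smul continuous_const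
  | zero => exact continuous_const
  | add x y _ _ hx hy => exact hx.add hy
  | smul a x _ hx => exact hx.const_smul a

theorem norm_vmono (p : ℕ × ι) (t : ℝ) : ‖vmono p t‖ = 1 := by
  rw [vmono, norm_smul, norm_pow, norm_zc, one_pow, one_mul, norm_delta]

theorem vpoly_bounded {p : ℝ → H ι} (hp : p ∈ vpoly ι) : ∃ K, ∀ t, ‖p t‖ ≤ K := by
  induction hp using Submodule.span_induction with
  | mem x h => obtain ⟨n, rfl⟩ := h; exact ⟨1, fun t => (norm_vmono n t).le⟩
  | zero => exact ⟨0, fun t => by simp⟩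
  | add x y _ _ hx hy =>
    obtain ⟨K, hK⟩ := hx
    obtain ⟨L, hL⟩ := hy
    exact ⟨K + L, fun t => (norm_add_le _ _).trans (add_le_add (hK t) (hL t))⟩
  | smul a x _ hx =>
    obtain ⟨K, hK⟩ := hx
    exact ⟨‖a‖ * K, fun t => by
      rw [Pi.smul_apply, norm_smul]; exact mul_le_mul_of_nonneg_left (hK t) (norm_nonneg _)⟩

theorem vpoly_memLp {p : ℝ → H ι} (hp : p ∈ vpoly ι) : MemLp p 2 circ := by
  obtain ⟨K, hK⟩ := vpoly_bounded hp
  exact MemLp.of_bound (vpoly_continuous hp).aestronglyMeasurable K (Eventually.of_forall hK)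

theorem poly_smul_vpoly (A : Polynomial ℂ) {p : ℝ → H ι} (hp : p ∈ vpoly ι) :
    (fun t => A.eval (zc t) • p t) ∈ vpoly ι := by
  induction hp using Submodule.span_induction with
  | mem x h =>
    obtain ⟨n, rfl⟩ := h
    have : (fun t => A.eval (zc t) • vmono n t) =
        ∑ k ∈ Finset.range (A.natDegree + 1), A.coeff k • vmono (k + n.1, n.2) := by
      funext t
      simp only [vmono, Polynomial.eval_eq_sum_range, Finset.sum_apply, Pi.smul_apply, smul_smul,
        pow_add, Finset.sum_mul, ← Finset.sum_smul, mul_assoc]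
    rw [this]
    exact Submodule.sum_mem _ fun k _ => Submodule.smul_mem _ _ (Submodule.subset_span ⟨_, rfl⟩)
  | zero =>
    convert (vpoly ι).zero_mem using 1
    funext t
    simp
  | add x y _ _ hx hy =>
    convert (vpoly ι).add_mem hx hy using 1
    funext t
    simp [smul_add]
  | smul a x _ hx =>
    have := (vpoly ι).smul_mem a hx
    convert this using 1
    funext t
    simp only [Pi.smul_apply]
    rw [smul_comm]

theorem inner_toLp_toLp {f g : ℝ → H ι} (hf : MemLp f 2 circ) (hg : MemLp g 2 circ) :
    inner ℂ (hf.toLp f) (hg.toLp g) = ∫ t, inner ℂ (f t) (g t) ∂circ := by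
  rw [L2.inner_def]
  refine integral_congr_ae ?_
  filter_upwards [hf.coeFn_toLp, hg.coeFn_toLp] with t h1 h2
  rw [h1, h2]

theorem memLp_chr_delta (n : ℤ) (k : ι) : MemLp (fun t => chr n t • delta k) 2 circ :=
  MemLp.of_bound ((continuous_chr n).smul continuous_const).aestronglyMeasurable 1
    (Eventually.of_forall fun t => by rw [norm_smul, norm_chr, norm_delta, one_mul])

theorem inner_chr_delta (n : ℤ) (k : ι) (t : ℝ) (x : H ι) :
    inner ℂ (chr n t • delta k) x = chr (-n) t * x k := by
  rw [inner_smul_left, conj_chr, inner_delta]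

/-- Project to the closed span of the monomials `e^{-imt} δ_k`, `m ≥ 0`. The remainder is orthogonal
to these by construction, and to `e^{int} δ_k`, `n > 0`, because both `ζ` and its projection are. So
all Fourier coefficients of its coordinates vanish, and there are countably many coordinates. -/
theorem exists_vpoly_near_of_memLp [Countable ι] {ζ : ℝ → H ι} (hζ : MemLp ζ 2 circ)
    (hcoef : ∀ (l : ℕ) (k : ι), ∫ t, zc t ^ (l + 1) * ζ t k ∂circ = 0) {ε : ℝ≥0∞} (hε : ε ≠ 0) :
    ∃ p ∈ vpoly ι, eLpNorm (ζ - p) 2 circ ≤ ε := by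
  classical
  let e : ℤ → ι → Lp (H ι) 2 circ := fun n k => (memLp_chr_delta n k).toLp _
  have hinner : ∀ n k (y : Lp (H ι) 2 circ), inner ℂ (e n k) y = ∫ t, chr (-n) t * y t k ∂circ := by
    intro n k y
    rw [L2.inner_def]
    refine integral_congr_ae ?_
    filter_upwards [(memLp_chr_delta n k).coeFn_toLp] with t ht
    rw [ht, inner_chr_delta]
  have horth : ∀ n m k k', n ≠ m → inner ℂ (e n k) (e m k') = 0 := fun n m k k' h => by
    rw [inner_toLp_toLp]
    simp only [inner_chr_delta, lp.coeFn_smul, Pi.smul_apply, smul_eq_mul]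
    simp_rw [← mul_assoc, chr_mul]
    rw [integral_mul_const, integral_chr, if_neg (by omega), zero_mul]
  let K₀ : Submodule ℂ (Lp (H ι) 2 circ) :=
    Submodule.span ℂ (Set.range fun p : ℕ × ι => e (-p.1) p.2)
  have : CompleteSpace K₀.topologicalClosure := K₀.isClosed_topologicalClosure.completeSpace_coe
  set z := hζ.toLp ζ with hz
  obtain ⟨x, hx, y, hy, hxy⟩ := K₀.topologicalClosure.exists_add_mem_mem_orthogonal z
  have hy0 : ∀ n k, inner ℂ (e n k) y = 0 := fun n k => by
    rcases le_or_gt n 0 with hn | hn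
    · obtain ⟨m, rfl⟩ := Int.exists_eq_neg_ofNat hn
      exact (Submodule.mem_orthogonal _ _).1 hy _
        (K₀.le_topologicalClosure (Submodule.subset_span ⟨(m, k), rfl⟩))
    · have h1 : e n k ∈ K₀.topologicalClosureᗮ := by
        rw [Submodule.orthogonal_closure]
        rw [Submodule.mem_orthogonal']
        intro v hv
        induction hv using Submodule.span_induction with
        | mem v h =>
          obtain ⟨p, rfl⟩ := h
          exact horth _ _ _ _ (by omega)
        | zero => simp
        | add v w _ _ hv hw => rw [inner_add_right, hv, hw, add_zero]
        | smul a v _ hv => rw [inner_smul_right, hv, mul_zero]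
      have h2 : inner ℂ (e n k) x = 0 := (Submodule.mem_orthogonal' _ _).1 h1 _ hx
      have h3 : inner ℂ (e n k) z = 0 := by
        rw [hinner]
        obtain ⟨m, rfl⟩ := Int.eq_ofNat_of_zero_le hn.le
        obtain ⟨l, rfl⟩ : ∃ l, m = l + 1 := ⟨m - 1, by omega⟩
        rw [← hcoef l k]
        refine integral_congr_ae ?_
        filter_upwards [hζ.coeFn_toLp] with t ht
        rw [hz, ht, zc_pow]
      rw [hxy, inner_add_right, h2, zero_add] at h3
      exact h3
  have hcoord : ∀ k, (fun t => y t k) =ᵐ[circ] 0 := fun k => by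
    have hm : MemLp (fun t => y t k) 2 circ := by
      have := (Lp.memLp y).const_inner (𝕜 := ℂ) (delta k)
      simpa only [inner_delta] using this
    refine ae_eq_zero_of_forall_integral_chr hm fun n => ?_
    have := hy0 (-n) k
    rwa [hinner, neg_neg] at this
  have hyz : y = 0 := by
    rw [Lp.eq_zero_iff_ae_eq_zero]
    filter_upwards [ae_all_iff.2 hcoord] with t ht
    ext k
    exact ht k
  rw [hyz, add_zero] at hxy
  rw [← hxy] at hx
  obtain ⟨s, hs, hd⟩ := EMetric.mem_closure_iff.1 hx ε (pos_iff_ne_zero.2 hε)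
  have hrep : ∀ s ∈ K₀, ∃ p, ∃ hp : p ∈ vpoly ι, s = (vpoly_memLp hp).toLp p := by
    intro s hs
    induction hs using Submodule.span_induction with
    | mem s h =>
      obtain ⟨p, rfl⟩ := h
      refine ⟨vmono p, Submodule.subset_span ⟨p, rfl⟩, ?_⟩
      refine MemLp.toLp_congr _ _ (Eventually.of_forall fun t => ?_)
      simp only [vmono, zc_pow]
    | zero => exact ⟨0, (vpoly ι).zero_mem, rfl⟩
    | add v w _ _ hv hw =>
      obtain ⟨p, hp, rfl⟩ := hv
      obtain ⟨q, hq, rfl⟩ := hw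
      exact ⟨p + q, (vpoly ι).add_mem hp hq, rfl⟩
    | smul a v _ hv =>
      obtain ⟨p, hp, rfl⟩ := hv
      exact ⟨a • p, (vpoly ι).smul_mem a hp, rfl⟩
  obtain ⟨p, hp, rfl⟩ := hrep s hs
  refine ⟨p, hp, ?_⟩
  rw [hz, Lp.edist_toLp_toLp] at hd
  exact hd.le

end VectorPolynomials

/-! ## Analytic functions are limits of vector polynomials in weighted `L₂` spaces -/

section WeightedDensity

variable {ι : Type*}

/-- The squared norm `∫ ⟨h, A h⟩` in the space with the weight `A`. -/
def wSq (A : ℝ → H ι →L[ℂ] H ι) (h : ℝ → H ι) : ℝ≥0∞ := ∫⁻ t, ENNReal.ofReal (qf (A t) (h t)) ∂circ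

theorem aemeasurable_qf {A : ℝ → H ι →L[ℂ] H ι} (hA : StrMeas circ A) {h : ℝ → H ι}
    (hh : AEStronglyMeasurable h circ) : AEMeasurable (fun t => qf (A t) (h t)) circ :=
  Complex.measurable_re.comp_aemeasurable (hh.inner (hA.apply hh)).aemeasurable

theorem wSq_add_le {A : ℝ → H ι →L[ℂ] H ι} (hA : StrMeas circ A)
    (hp : ∀ᵐ t ∂circ, (A t).IsPositive) {g h : ℝ → H ι} (hg : AEStronglyMeasurable g circ)
    (hh : AEStronglyMeasurable h circ) : wSq A (g + h) ≤ 2 * wSq A g + 2 * wSq A h := by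
  rw [wSq, wSq, wSq, ← lintegral_const_mul'' _ (aemeasurable_qf hA hg).ennreal_ofReal,
    ← lintegral_const_mul'' _ (aemeasurable_qf hA hh).ennreal_ofReal,
    ← lintegral_add_left' ((aemeasurable_qf hA hg).ennreal_ofReal.const_mul _)]
  refine lintegral_mono_ae ?_
  filter_upwards [hp] with t ht
  have h1 := qf_add_right_le ht (g t) (h t)
  refine (ENNReal.ofReal_le_ofReal h1).trans (le_of_eq ?_)
  rw [ENNReal.ofReal_add (by have := qf_nonneg ht (g t); positivity)
      (by have := qf_nonneg ht (h t); positivity), ENNReal.ofReal_mul (by norm_num),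
    ENNReal.ofReal_mul (by norm_num), ENNReal.ofReal_ofNat]

/-- Choose an outer `O` near `1` such that `O φ` and `O W` are bounded. Two copies of `O` are
needed: one puts `φ` into `L₂`, the other tames the weight, so that unweighted approximation of `O
φ` becomes weighted approximation of `O² φ`. -/
theorem exists_vpoly_near [Countable ι] {W : ℝ → H ι →L[ℂ] H ι} {φ : ℝ → H ι}
    (hW : StrMeas circ W) (hpos : ∀ᵐ t ∂circ, (W t).IsPositive)
    (hWi : Integrable (fun t => ‖W t‖) circ) (hφ : Integrable φ circ) (hφW : wSq W φ ≠ ⊤)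
    (hcoef : ∀ (l : ℕ) (k : ι), ∫ t, zc t ^ (l + 1) * φ t k ∂circ = 0) {ε : ℝ≥0∞} (hε : ε ≠ 0) :
    ∃ p ∈ vpoly ι, wSq W (φ - p) ≤ ε := by
  wlog hεtop : ε ≠ ⊤ generalizing ε
  · obtain ⟨p, hp, -⟩ := this one_ne_zero ENNReal.one_ne_top
    exact ⟨p, hp, by rw [not_not.1 hεtop]; exact le_top⟩
  set u : ℝ → ℂ := fun t => ((‖φ t‖ + ‖W t‖ : ℝ) : ℂ) with hu
  have hui : Integrable u circ := (hφ.norm.add hWi).ofReal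
  have hun : ∀ t, ‖u t‖ = ‖φ t‖ + ‖W t‖ := fun t => by
    rw [hu]; simp only [norm_real]; exact Real.norm_of_nonneg (by positivity)
  have hdpos : ∀ n : ℕ, (0 : ℝ) < (1 / 2) ^ n := fun n => by positivity
  choose Os hOm hOA hO1 hOK hOd using fun n => exists_outer hui (hdpos n)
  have hmeas1 : ∀ n, AEStronglyMeasurable (fun t => (1 - Os n t * Os n t) • φ t) circ := fun n =>
    (aestronglyMeasurable_const.sub ((hOm n).mul (hOm n))).smul hφ.aestronglyMeasurable
  have hO1' : ∀ᵐ t ∂circ, ∀ n, ‖Os n t‖ ≤ 1 := ae_all_iff.2 hO1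
  have hOint : ∀ n, Integrable (fun t => ‖1 - Os n t‖) circ := fun n =>
    Integrable.of_bound (aestronglyMeasurable_const.sub (hOm n)).norm 2 <| by
      filter_upwards [hO1 n] with t ht
      rw [norm_norm]
      refine (norm_sub_le _ _).trans ?_
      rw [norm_one]; linarith
  have hOlim : ∀ᵐ t ∂circ, Tendsto (fun n => Os n t) atTop (𝓝 1) := by
    filter_upwards [ae_summable_of_summable_integral hOint (fun _ _ => norm_nonneg _)
      (summable_geometric_of_lt_one (by norm_num) (by norm_num)) hOd] with t ht
    have := ht.tendsto_atTop_zero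
    rw [tendsto_iff_norm_sub_tendsto_zero]
    simpa only [norm_sub_rev] using this
  -- the outer factor
  have hlim1 : Tendsto (fun n => wSq W fun t => (1 - Os n t * Os n t) • φ t) atTop (𝓝 0) := by
    have h := tendsto_lintegral_of_dominated_convergence' (μ := circ)
      (F := fun n t => ENNReal.ofReal (qf (W t) ((1 - Os n t * Os n t) • φ t)))
      (f := fun _ => 0) (fun t => 4 * ENNReal.ofReal (qf (W t) (φ t)))
      (fun n => (aemeasurable_qf hW (hmeas1 n)).ennreal_ofReal) (fun n => ?_) ?_ ?_
    · rw [lintegral_zero] at h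
      exact h
    · filter_upwards [hO1 n, hpos] with t ht hWt
      rw [qf_smul_right, show (4 : ℝ≥0∞) = ENNReal.ofReal 4 by simp,
        ← ENNReal.ofReal_mul (by norm_num)]
      refine ENNReal.ofReal_le_ofReal ?_
      have hle : ‖1 - Os n t * Os n t‖ ≤ 2 := by
        refine (norm_sub_le _ _).trans ?_
        rw [norm_one, norm_mul]
        nlinarith [norm_nonneg (Os n t)]
      gcongr
      · exact qf_nonneg hWt _
      · nlinarith [norm_nonneg (1 - Os n t * Os n t)]
    · rw [lintegral_const_mul' _ _ (by simp)]
      exact ENNReal.mul_ne_top (by simp) hφW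
    · filter_upwards [hOlim] with t ht
      simp only [qf_smul_right]
      have h1 : Tendsto (fun n => ‖1 - Os n t * Os n t‖ ^ 2 * qf (W t) (φ t)) atTop
          (𝓝 (‖(1 : ℂ) - 1‖ ^ 2 * qf (W t) (φ t))) :=
        ((tendsto_const_nhds.sub (by simpa using ht.mul ht)).norm.pow 2).mul_const _
      have h2 := (ENNReal.continuous_ofReal.tendsto _).comp h1
      rw [sub_self, norm_zero, zero_pow two_ne_zero, zero_mul, ENNReal.ofReal_zero] at h2
      exact h2
  -- Three errors of size `ε/16`; two uses of the quasi-triangle inequality with constant `2` give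
  -- `10 · ε/16`.
  have hε8 : 0 < ε / 16 := by
    rw [ENNReal.div_pos_iff]; exact ⟨hε, by simp⟩
  obtain ⟨n, hn⟩ := (hlim1.eventually (ge_mem_nhds hε8)).exists
  set O := Os n with hOdef
  obtain ⟨A, hA2, hAlim⟩ := hOA n
  obtain ⟨K, hK0, hK⟩ := hOK n
  have hAc : ∀ m, Continuous fun t => (A m).eval (zc t) := fun m =>
    (A m).continuous.comp continuous_zc
  have hKφ : ∀ᵐ t ∂circ, ‖O t‖ * ‖φ t‖ ≤ K := hK.mono fun t ht =>
    (mul_le_mul_of_nonneg_left (by rw [hun]; linarith [norm_nonneg (W t)])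
      (norm_nonneg _)).trans ht
  have hKW : ∀ᵐ t ∂circ, ‖O t‖ * ‖W t‖ ≤ K := hK.mono fun t ht =>
    (mul_le_mul_of_nonneg_left (by rw [hun]; linarith [norm_nonneg (φ t)])
      (norm_nonneg _)).trans ht
  -- the bounded analytic function
  set ζ : ℝ → H ι := fun t => O t • φ t with hζ
  have hζm : AEStronglyMeasurable ζ circ := (hOm n).smul hφ.aestronglyMeasurable
  have hζL : MemLp ζ 2 circ := MemLp.of_bound hζm K (hKφ.mono fun t ht => by
    rw [hζ, norm_smul]; exact ht)
  have hcoord : ∀ k, Integrable (fun t => φ t k) circ := fun k => by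
    have := hφ.const_inner (𝕜 := ℂ) (delta k)
    simpa only [inner_delta] using this
  -- Multiplication by a polynomial in `zc` only uses vanishing coefficients of `φ` of higher index;
  -- dominated convergence carries this over to `O`.
  have hζcoef : ∀ (l : ℕ) (k : ι), ∫ t, zc t ^ (l + 1) * ζ t k ∂circ = 0 := fun l k => by
    have hzero : ∀ m, ∫ t, zc t ^ (l + 1) * ((A m).eval (zc t) * φ t k) ∂circ = 0 := fun m => by
      have heq : ∀ t, zc t ^ (l + 1) * ((A m).eval (zc t) * φ t k) =
          ∑ j ∈ Finset.range ((A m).natDegree + 1),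
            (A m).coeff j * (zc t ^ (l + j + 1) * φ t k) := fun t => by
        rw [Polynomial.eval_eq_sum_range, Finset.sum_mul, Finset.mul_sum]
        refine Finset.sum_congr rfl fun j _ => ?_
        ring
      simp_rw [heq]
      rw [integral_finsetSum]
      · simp_rw [integral_const_mul, hcoef, mul_zero, Finset.sum_const_zero]
      · intro j _
        refine Integrable.const_mul ?_ _
        exact (hcoord k).bdd_mul (c := 1) (continuous_zc.pow _).aestronglyMeasurable
          (Eventually.of_forall fun t => by rw [norm_pow, norm_zc, one_pow])
    have hlim := tendsto_integral_of_dominated_convergence (μ := circ)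
      (F := fun m t => zc t ^ (l + 1) * ((A m).eval (zc t) * φ t k))
      (f := fun t => zc t ^ (l + 1) * ζ t k) (fun t => 2 * ‖φ t k‖)
      (fun m => (continuous_zc.pow _).aestronglyMeasurable.mul
        ((hAc m).aestronglyMeasurable.mul (hcoord k).aestronglyMeasurable))
      ((hcoord k).norm.const_mul 2)
      (fun m => Eventually.of_forall fun t => by
        rw [norm_mul, norm_pow, norm_zc, one_pow, one_mul, norm_mul]
        gcongr; exact hA2 m t)
      (hAlim.mono fun t ht => (ht.mul_const _).const_mul _)
    simp_rw [hzero] at hlim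
    exact (tendsto_nhds_unique hlim tendsto_const_nhds)
  -- polynomial approximation of the bounded function
  have hη : (ε / 16 / (ENNReal.ofReal K + 1)) ≠ 0 :=
    (ENNReal.div_pos_iff.2 ⟨hε8.ne', by simp⟩).ne'
  have hηtop : (ε / 16 / (ENNReal.ofReal K + 1)) ≠ ⊤ :=
    ENNReal.div_ne_top (ENNReal.div_ne_top hεtop (by simp)) (by simp)
  -- The power `1/2` accounts for `wSq` being a squared norm; the divisor absorbs the bound `K` for
  -- `‖O‖ ‖W‖`.
  obtain ⟨p, hp, hpζ⟩ := exists_vpoly_near_of_memLp hζL hζcoef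
    (ε := (ε / 16 / (ENNReal.ofReal K + 1)) ^ (1 / 2 : ℝ))
    ((ENNReal.rpow_pos (pos_iff_ne_zero.2 hη) hηtop).ne')
  have hpm := (vpoly_continuous hp).aestronglyMeasurable (μ := circ)
  have h2 : wSq W (fun t => O t • (ζ t - p t)) ≤ ε / 16 := by
    have hsq : ∫⁻ t, ‖ζ t - p t‖ₑ ^ 2 ∂circ ≤ ε / 16 / (ENNReal.ofReal K + 1) := by
      have h := ENNReal.rpow_le_rpow hpζ (z := 2) (by norm_num)
      rw [← ENNReal.rpow_mul, eLpNorm_eq_lintegral_rpow_enorm_toReal (by norm_num) (by norm_num),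
        ← ENNReal.rpow_mul] at h
      norm_num at h
      simpa using h
    calc wSq W (fun t => O t • (ζ t - p t))
        ≤ ∫⁻ t, ENNReal.ofReal K * ‖ζ t - p t‖ₑ ^ 2 ∂circ := by
          refine lintegral_mono_ae ?_
          filter_upwards [hKW, hO1 n, hpos] with t ht1 ht2 ht3
          rw [← ofReal_norm, ← ENNReal.ofReal_pow (norm_nonneg _), ← ENNReal.ofReal_mul hK0]
          refine ENNReal.ofReal_le_ofReal ?_
          rw [qf_smul_right]
          calc ‖O t‖ ^ 2 * qf (W t) (ζ t - p t)
              ≤ ‖O t‖ * 1 * (‖W t‖ * ‖ζ t - p t‖ ^ 2) := by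
                rw [sq]; gcongr
                · exact qf_nonneg ht3 _
                · exact qf_le_norm _ _
            _ = (‖O t‖ * ‖W t‖) * ‖ζ t - p t‖ ^ 2 := by ring
            _ ≤ _ := by gcongr
      _ = ENNReal.ofReal K * ∫⁻ t, ‖ζ t - p t‖ₑ ^ 2 ∂circ :=
          lintegral_const_mul' _ _ ENNReal.ofReal_ne_top
      _ ≤ (ENNReal.ofReal K + 1) * (ε / 16 / (ENNReal.ofReal K + 1)) := by
          gcongr; exact le_self_add
      _ = ε / 16 := ENNReal.mul_div_cancel (by simp) (by simp)
  -- replacing the outer function by polynomials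
  obtain ⟨L, hL⟩ := vpoly_bounded hp
  have hlim3 : Tendsto (fun m => wSq W fun t => (O t - (A m).eval (zc t)) • p t) atTop (𝓝 0) := by
    have h := tendsto_lintegral_of_dominated_convergence' (μ := circ)
      (F := fun m t => ENNReal.ofReal (qf (W t) ((O t - (A m).eval (zc t)) • p t)))
      (f := fun _ => 0) (fun t => ENNReal.ofReal (9 * L ^ 2 * ‖W t‖))
      (fun m => (aemeasurable_qf hW
        (((hOm n).sub (hAc m).aestronglyMeasurable).smul hpm)).ennreal_ofReal) (fun m => ?_) ?_ ?_
    · rw [lintegral_zero] at h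
      exact h
    · filter_upwards [hO1 n, hpos] with t ht hWt
      refine ENNReal.ofReal_le_ofReal ?_
      rw [qf_smul_right]
      have h9 : ‖O t - (A m).eval (zc t)‖ ≤ 3 := by
        refine (norm_sub_le _ _).trans ?_
        linarith [hA2 m t]
      calc ‖O t - (A m).eval (zc t)‖ ^ 2 * qf (W t) (p t)
          ≤ 3 ^ 2 * (‖W t‖ * L ^ 2) := by
            gcongr
            · exact qf_nonneg hWt _
            · refine (qf_le_norm _ _).trans ?_
              gcongr
              exact hL t
        _ = 9 * L ^ 2 * ‖W t‖ := by ring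
    · exact (hWi.const_mul (9 * L ^ 2)).lintegral_lt_top.ne
    · filter_upwards [hAlim] with t ht
      simp only [qf_smul_right]
      have h1 : Tendsto (fun m => ‖O t - (A m).eval (zc t)‖ ^ 2 * qf (W t) (p t)) atTop
          (𝓝 (‖O t - O t‖ ^ 2 * qf (W t) (p t))) :=
        ((tendsto_const_nhds.sub ht).norm.pow 2).mul_const _
      have h2 := (ENNReal.continuous_ofReal.tendsto _).comp h1
      rw [sub_self, norm_zero, zero_pow two_ne_zero, zero_mul, ENNReal.ofReal_zero] at h2
      exact h2
  obtain ⟨m, hm⟩ := (hlim3.eventually (ge_mem_nhds hε8)).exists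
  refine ⟨fun t => (A m).eval (zc t) • p t, poly_smul_vpoly (A m) hp, ?_⟩
  -- The three errors: `O²` in place of `1`, `p` in place of `O φ`, and a polynomial in place of the
  -- remaining `O`.
  have hdec : (φ - fun t => (A m).eval (zc t) • p t) =
      ((fun t => (1 - O t * O t) • φ t) + fun t => O t • (ζ t - p t)) +
        fun t => (O t - (A m).eval (zc t)) • p t := by
    funext t
    simp only [Pi.sub_apply, Pi.add_apply, hζ, sub_smul, one_smul, smul_sub, mul_smul]
    abel
  rw [hdec]
  have hm2 : AEStronglyMeasurable (fun t => O t • (ζ t - p t)) circ :=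
    (hOm n).smul (hζm.sub hpm)
  have hm3 : AEStronglyMeasurable (fun t => (O t - (A m).eval (zc t)) • p t) circ :=
    ((hOm n).sub (hAc m).aestronglyMeasurable).smul hpm
  calc _ ≤ 2 * wSq W ((fun t => (1 - O t * O t) • φ t) + fun t => O t • (ζ t - p t))
        + 2 * wSq W (fun t => (O t - (A m).eval (zc t)) • p t) :=
        wSq_add_le hW hpos ((hmeas1 n).add hm2) hm3
    _ ≤ 2 * (2 * (ε / 16) + 2 * (ε / 16)) + 2 * (ε / 16) := by
        gcongr
        exact (wSq_add_le hW hpos (hmeas1 n) hm2).trans (by gcongr)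
    _ = 10 * (ε / 16) := by ring
    _ ≤ 16 * (ε / 16) := by gcongr; norm_num
    _ = ε := ENNReal.mul_div_cancel (by simp) (by simp)

end WeightedDensity

/-! ## The weights -/

section Weights

theorem conj_incr (d τ : ℕ) (l : ℝ) :
    (starRingEnd ℂ) (incr d τ l) = (1 - exp (I * l * τ)) ^ d / (-(I * l)) ^ d := by
  rw [incr, map_div₀, map_pow, map_pow, map_sub, map_one, ← exp_conj]
  simp

theorem norm_incr_sq (d τ : ℕ) (l : ℝ) : ‖incr d τ l‖ ^ 2 = wt d τ l := by
  rw [← RCLike.norm_conj, conj_incr, wt, norm_div, norm_pow, norm_pow, div_pow, ← pow_mul, ← pow_mul,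
    mul_comm d 2]
  congr 1
  rw [norm_neg, norm_mul, norm_I, one_mul, norm_real, Real.norm_eq_abs, pow_mul, sq_abs, ← pow_mul]

theorem measurable_incr (d τ : ℕ) : Measurable (incr d τ) := by unfold incr; fun_prop

theorem measurable_wt (d τ : ℕ) : Measurable (wt d τ) := by
  have : wt d τ = fun l => ‖incr d τ l‖ ^ 2 := funext fun l => (norm_incr_sq d τ l).symm
  rw [this]
  exact (measurable_incr d τ).norm.pow_const 2

theorem wt_nonneg (d τ : ℕ) (l : ℝ) : 0 ≤ wt d τ l := by rw [← norm_incr_sq]; positivity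

/-- The exceptional points `lτ ∈ 2πℤ`, and `l = 0` where division takes its default value, form a
countable set. -/
theorem ae_incr_ne_zero (d : ℕ) {τ : ℕ} (hτ : 0 < τ) : ∀ᵐ l ∂circ, incr d τ l ≠ 0 := by
  have hc : Set.Countable {l : ℝ | exp (I * l * τ) = 1 ∨ l = 0} := by
    refine Set.Countable.mono (s₂ := (Set.range fun n : ℤ => n * (2 * Real.pi) / τ) ∪ {0}) ?_
      ((Set.countable_range _).union (Set.countable_singleton _))
    rintro l (h | h)
    · left
      obtain ⟨n, hn⟩ := exp_eq_one_iff.1 h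
      refine ⟨n, ?_⟩
      have hτ' : (τ : ℝ) ≠ 0 := by positivity
      have : ((l * τ : ℝ) : ℂ) * I = ((n * (2 * Real.pi) : ℝ) : ℂ) * I := by
        push_cast
        rw [show (l : ℂ) * τ * I = I * l * τ by ring, hn]; ring
      have h2 := mul_right_cancel₀ I_ne_zero this
      have h3 : l * τ = n * (2 * Real.pi) := by exact_mod_cast h2
      simp only
      rw [div_eq_iff hτ', h3]
    · right; exact h
  have h0 : ∀ᵐ l ∂circ, l ∉ {l : ℝ | exp (I * l * τ) = 1 ∨ l = 0} := by
    refine Measure.ae_smul_measure (ae_restrict_of_ae ?_) _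
    exact (measure_eq_zero_iff_ae_notMem).1 (hc.measure_zero volume)
  filter_upwards [h0] with l hl
  simp only [not_or] at hl
  intro h
  have h2 : (starRingEnd ℂ) (incr d τ l) = 0 := by rw [h, map_zero]
  rw [conj_incr] at h2
  refine absurd h2 (div_ne_zero (pow_ne_zero _ ?_) (pow_ne_zero _ ?_))
  · exact sub_ne_zero.2 fun h3 => hl.1 h3.symm
  · simpa using hl.2

theorem wt_pos_of_incr {d τ : ℕ} {l : ℝ} (h : incr d τ l ≠ 0) : 0 < wt d τ l := by
  rw [← norm_incr_sq]; positivity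

end Weights

/-! ### The weighted spaces `L₂(A)` and the closed span of the observed functions -/

section WeightedSpaces

set_option linter.unusedSectionVars false

variable {ι : Type*}

theorem IsSpectralDensity.transpose {d τ : ℕ} {f : ℝ → H ι →L[ℂ] H ι}
    (hf : IsSpectralDensity d τ f) : IsSpectralDensity d τ fun l => transp (f l) where
  measurable := hf.strMeas.transp hf.positive
  positive := hf.positive.mono fun _ h => isPositive_transp h
  integrable := by simpa only [norm_transp] using hf.integrable

theorem sumInv_transpose (f g : ℝ → H ι →L[ℂ] H ι) (l : ℝ) :
    sumInv (fun l => transp (f l)) (fun l => transp (g l)) l = transp (sumInv f g l) := by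
  rw [sumInv, sumInv, transp_inverse, transp_add]

theorem Minimality.transpose {d τ : ℕ} {f g : ℝ → H ι →L[ℂ] H ι} (h : Minimality d τ f g) :
    Minimality d τ (fun l => transp (f l)) (fun l => transp (g l)) where
  invertible := h.invertible.mono fun l hl => by rw [← transp_add]; exact isUnit_transp hl
  integrable := by simpa only [sumInv_transpose, norm_transp] using h.integrable

theorem normSq_eq_wSq (S : ℝ → H ι →L[ℂ] H ι) (h : ℝ → H ι) :
    normSq S h = wSq (fun l => transp (S l)) h := by
  simp only [normSq, wSq, quad_eq_qf]

theorem wSq_congr {A : ℝ → H ι →L[ℂ] H ι} {g h : ℝ → H ι} (hgh : g =ᵐ[circ] h) :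
    wSq A g = wSq A h :=
  lintegral_congr_ae (hgh.mono fun t ht => by simp only [ht])

theorem wSq_neg (A : ℝ → H ι →L[ℂ] H ι) (h : ℝ → H ι) : wSq A (-h) = wSq A h := by
  simp only [wSq, Pi.neg_apply, qf_neg_right]

theorem wSq_sub_comm (A : ℝ → H ι →L[ℂ] H ι) (g h : ℝ → H ι) : wSq A (g - h) = wSq A (h - g) := by
  rw [← neg_sub, wSq_neg]

theorem wSq_sub_le {A : ℝ → H ι →L[ℂ] H ι} (hA : StrMeas circ A)
    (hp : ∀ᵐ t ∂circ, (A t).IsPositive) {g h : ℝ → H ι} (hg : AEStronglyMeasurable g circ)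
    (hh : AEStronglyMeasurable h circ) : wSq A (g - h) ≤ 2 * wSq A g + 2 * wSq A h := by
  rw [sub_eq_add_neg, ← wSq_neg A h]
  exact wSq_add_le hA hp hg hh.neg

theorem wSq_sub_triangle {A : ℝ → H ι →L[ℂ] H ι} (hA : StrMeas circ A)
    (hp : ∀ᵐ t ∂circ, (A t).IsPositive) {f g h : ℝ → H ι} (hf : AEStronglyMeasurable f circ)
    (hg : AEStronglyMeasurable g circ) (hh : AEStronglyMeasurable h circ) :
    wSq A (f - h) ≤ 2 * wSq A (f - g) + 2 * wSq A (g - h) := by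
  rw [← sub_add_sub_cancel f g h]
  exact wSq_add_le hA hp (hf.sub hg) (hg.sub hh)

/-- The closed linear span of the observed functions, described with the transposed density. -/
def obsClosure (d τ : ℕ) (A : ℝ → H ι →L[ℂ] H ι) : Set (ℝ → H ι) :=
  {h | AEStronglyMeasurable h circ ∧
    ∀ ε ≠ 0, ∃ p ∈ vpoly ι, wSq A (h - fun l => incr d τ l • p l) ≤ ε}

theorem mem_span_observed_iff (d τ : ℕ) (h : ℝ → H ι) :
    h ∈ Submodule.span ℂ (Set.range (observed (ι := ι) d τ)) ↔
      ∃ p ∈ vpoly ι, h = fun l => incr d τ l • p l := by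
  let M : (ℝ → H ι) →ₗ[ℂ] (ℝ → H ι) :=
    { toFun := fun p l => incr d τ l • p l
      map_add' := fun p q => by funext l; simp
      map_smul' := fun c p => by funext l; simp [smul_comm c] }
  have hobs : (observed (ι := ι) d τ) = M ∘ vmono := by
    funext p l
    simp only [observed, Function.comp, M, LinearMap.coe_mk, AddHom.coe_mk, vmono, zc_pow, smul_smul]
    rw [mul_comm, chr]
    congr 3
    push_cast; ring
  rw [hobs, Set.range_comp, ← Submodule.map_span]
  constructor
  · rintro ⟨p, hp, rfl⟩; exact ⟨p, hp, rfl⟩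
  · rintro ⟨p, hp, rfl⟩; exact ⟨p, hp, rfl⟩

theorem mem_L20_iff {d τ : ℕ} {S : ℝ → H ι →L[ℂ] H ι} {h : ℝ → H ι} :
    h ∈ L20 d τ S ↔ h ∈ obsClosure d τ fun l => transp (S l) := by
  constructor
  · rintro ⟨hm, p, hp, hlim⟩
    refine ⟨hm, fun ε hε => ?_⟩
    obtain ⟨n, hn⟩ := (hlim.eventually (ge_mem_nhds (pos_iff_ne_zero.2 hε))).exists
    obtain ⟨q, hq, hpq⟩ := (mem_span_observed_iff d τ _).1 (hp n)
    refine ⟨q, hq, ?_⟩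
    rw [← hpq, ← normSq_eq_wSq]
    exact hn
  · rintro ⟨hm, h⟩
    have hpos : ∀ n : ℕ, ((n : ℝ≥0∞) + 1)⁻¹ ≠ 0 := fun n => by simp
    choose p hp hle using fun n => h _ (hpos n)
    refine ⟨hm, fun n l => incr d τ l • p n l,
      fun n => (mem_span_observed_iff d τ _).2 ⟨p n, hp n, rfl⟩, ?_⟩
    refine tendsto_of_tendsto_of_tendsto_of_le_of_le tendsto_const_nhds
      (h := fun n : ℕ => ((n : ℝ≥0∞) + 1)⁻¹) ?_ (fun _ => zero_le) fun n => ?_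
    · have := (tendsto_add_atTop_iff_nat 1).2 ENNReal.tendsto_inv_nat_nhds_zero
      exact_mod_cast this
    · simp only [normSq_eq_wSq]; exact hle n

theorem incr_vpoly_aestronglyMeasurable (d τ : ℕ) {p : ℝ → H ι} (hp : p ∈ vpoly ι) :
    AEStronglyMeasurable (fun l => incr d τ l • p l) circ :=
  (measurable_incr d τ).aestronglyMeasurable.smul (vpoly_continuous hp).aestronglyMeasurable

theorem wSq_incr_vpoly_ne_top {d τ : ℕ} {A : ℝ → H ι →L[ℂ] H ι} (hA : IsSpectralDensity d τ A)
    {p : ℝ → H ι} {K : ℝ} (hp : ∀ t, ‖p t‖ ≤ K) : wSq A (fun l => incr d τ l • p l) ≠ ⊤ := by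
  refine ne_top_of_le_ne_top (hA.integrable.const_mul (K ^ 2)).lintegral_lt_top.ne
    (lintegral_mono fun l => ENNReal.ofReal_le_ofReal ?_)
  rw [qf_smul_right, norm_incr_sq, mul_left_comm]
  refine mul_le_mul_of_nonneg_left ((qf_le_norm _ _).trans ?_) (wt_nonneg d τ l)
  rw [mul_comm]
  gcongr
  exact hp l

theorem obsClosure_wSq_ne_top {d τ : ℕ} {A : ℝ → H ι →L[ℂ] H ι} (hA : IsSpectralDensity d τ A)
    {h : ℝ → H ι} (hh : h ∈ obsClosure d τ A) : wSq A h ≠ ⊤ := by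
  obtain ⟨p, hp, hle⟩ := hh.2 1 one_ne_zero
  obtain ⟨K, hK⟩ := vpoly_bounded hp
  have hpm := incr_vpoly_aestronglyMeasurable d τ hp
  have := wSq_add_le hA.strMeas hA.positive (hh.1.sub hpm) hpm
  rw [sub_add_cancel] at this
  refine ne_top_of_le_ne_top ?_ this
  exact ENNReal.add_ne_top.2 ⟨ENNReal.mul_ne_top (by simp) (ne_top_of_le_ne_top (by simp) hle),
    ENNReal.mul_ne_top (by simp) (wSq_incr_vpoly_ne_top hA hK)⟩

theorem obsClosure_congr {d τ : ℕ} {A : ℝ → H ι →L[ℂ] H ι} {g h : ℝ → H ι}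
    (hg : g ∈ obsClosure d τ A) (hgh : g =ᵐ[circ] h) : h ∈ obsClosure d τ A := by
  refine ⟨hg.1.congr hgh, fun ε hε => ?_⟩
  obtain ⟨p, hp, hle⟩ := hg.2 ε hε
  refine ⟨p, hp, ?_⟩
  rwa [← wSq_congr (hgh.sub (ae_eq_refl _))]

theorem obsClosure_of_limit {d τ : ℕ} {A : ℝ → H ι →L[ℂ] H ι} (hA : StrMeas circ A)
    (hpos : ∀ᵐ t ∂circ, (A t).IsPositive) {h : ℝ → H ι} (hm : AEStronglyMeasurable h circ)
    (hlim : ∀ ε ≠ 0, ∃ g ∈ obsClosure d τ A, wSq A (h - g) ≤ ε) : h ∈ obsClosure d τ A := by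
  refine ⟨hm, fun ε hε => ?_⟩
  have hε4 : ε / 4 ≠ 0 := by simp [ENNReal.div_eq_zero_iff, hε]
  obtain ⟨g, hg, hle⟩ := hlim _ hε4
  obtain ⟨p, hp, hle'⟩ := hg.2 _ hε4
  refine ⟨p, hp, ?_⟩
  calc _ ≤ _ := wSq_sub_triangle hA hpos hm hg.1 (incr_vpoly_aestronglyMeasurable d τ hp)
    _ ≤ 2 * (ε / 4) + 2 * (ε / 4) := by gcongr
    _ = 4 * (ε / 4) := by ring
    _ = ε := ENNReal.mul_div_cancel (by simp) (by simp)

theorem obsClosure_mono {d τ : ℕ} {A A' : ℝ → H ι →L[ℂ] H ι} {K : ℝ≥0∞} (hK : K ≠ ⊤)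
    (hle : ∀ h, wSq A h ≤ K * wSq A' h) : obsClosure d τ A' ⊆ obsClosure d τ A := by
  rintro h ⟨hm, hh⟩
  refine ⟨hm, fun ε hε => ?_⟩
  obtain ⟨p, hp, hp'⟩ := hh (ε / (K + 1))
    (ENNReal.div_pos_iff.2 ⟨hε, ENNReal.add_ne_top.2 ⟨hK, by simp⟩⟩).ne'
  refine ⟨p, hp, (hle _).trans ?_⟩
  calc K * _ ≤ (K + 1) * (ε / (K + 1)) := by gcongr; exact le_self_add
    _ ≤ ε := ENNReal.mul_div_le

/-! ## The embedding into `L₂` -/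

variable [Countable ι]

/-- `A^{1/2} h`. -/
def rt (A : ℝ → H ι →L[ℂ] H ι) (h : ℝ → H ι) (t : ℝ) : H ι := opSqrt (A t) (h t)

theorem enorm_rt_sq {A : ℝ → H ι →L[ℂ] H ι} {t : ℝ} (hA : (A t).IsPositive) (h : ℝ → H ι) :
    ‖rt A h t‖ₑ ^ 2 = ENNReal.ofReal (qf (A t) (h t)) := by
  rw [← norm_opSqrt_sq hA, ENNReal.ofReal_pow (norm_nonneg _), ofReal_norm]; rfl

theorem lintegral_enorm_rt_sq {A : ℝ → H ι →L[ℂ] H ι} (hpos : ∀ᵐ t ∂circ, (A t).IsPositive)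
    (h : ℝ → H ι) : ∫⁻ t, ‖rt A h t‖ₑ ^ 2 ∂circ = wSq A h :=
  lintegral_congr_ae (hpos.mono fun _ ht => enorm_rt_sq ht h)

theorem eLpNorm_two_sq (u : ℝ → H ι) : eLpNorm u 2 circ ^ 2 = ∫⁻ t, ‖u t‖ₑ ^ 2 ∂circ := by
  rw [eLpNorm_eq_lintegral_rpow_enorm_toReal (by norm_num) (by norm_num), ← ENNReal.rpow_natCast,
    ← ENNReal.rpow_mul]
  norm_num

theorem memLp_rt {A : ℝ → H ι →L[ℂ] H ι} (hA : StrMeas circ A)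
    (hpos : ∀ᵐ t ∂circ, (A t).IsPositive) {h : ℝ → H ι} (hm : AEStronglyMeasurable h circ)
    (hfin : wSq A h ≠ ⊤) : MemLp (rt A h) 2 circ := by
  refine ⟨(hA.opSqrt hpos).apply hm, ?_⟩
  have : eLpNorm (rt A h) 2 circ ^ 2 ≠ ⊤ := by
    rw [eLpNorm_two_sq, lintegral_enorm_rt_sq hpos]; exact hfin
  rw [lt_top_iff_ne_top]
  intro htop
  rw [htop] at this
  simp at this

theorem norm_toLp_rt_sq {A : ℝ → H ι →L[ℂ] H ι} (hpos : ∀ᵐ t ∂circ, (A t).IsPositive)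
    {h : ℝ → H ι} (hL : MemLp (rt A h) 2 circ) :
    ENNReal.ofReal (‖hL.toLp (rt A h)‖ ^ 2) = wSq A h := by
  rw [Lp.norm_toLp, ENNReal.ofReal_pow ENNReal.toReal_nonneg, ENNReal.ofReal_toReal hL.2.ne,
    eLpNorm_two_sq, lintegral_enorm_rt_sq hpos]

theorem inner_toLp_rt {A : ℝ → H ι →L[ℂ] H ι} (hpos : ∀ᵐ t ∂circ, (A t).IsPositive)
    {g h : ℝ → H ι} (hg : MemLp (rt A g) 2 circ) (hh : MemLp (rt A h) 2 circ) :
    inner ℂ (hg.toLp (rt A g)) (hh.toLp (rt A h)) = ∫ t, inner ℂ (g t) (A t (h t)) ∂circ := by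
  rw [inner_toLp_toLp]
  exact integral_congr_ae (hpos.mono fun t ht => inner_opSqrt ht _ _)

theorem rt_sub (A : ℝ → H ι →L[ℂ] H ι) (g h : ℝ → H ι) : rt A (g - h) = rt A g - rt A h := by
  funext t; simp [rt]

theorem rt_add (A : ℝ → H ι →L[ℂ] H ι) (g h : ℝ → H ι) : rt A (g + h) = rt A g + rt A h := by
  funext t; simp [rt]

theorem rt_smul (A : ℝ → H ι →L[ℂ] H ι) (c : ℂ) (h : ℝ → H ι) : rt A (c • h) = c • rt A h := by
  funext t; simp [rt]

/-! ## The symbol of the coefficients -/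

theorem symB_eq (b : ℕ → H ι) (t : ℝ) : symB b t = ∑' j, zc t ^ j • b j := by
  simp only [symB, zc_pow, chr]
  refine tsum_congr fun j => ?_
  congr 2
  push_cast; ring

theorem norm_zc_pow_smul (b : ℕ → H ι) (j : ℕ) (t : ℝ) : ‖zc t ^ j • b j‖ = ‖b j‖ := by
  rw [norm_smul, norm_pow, norm_zc, one_pow, one_mul]

theorem hasSum_symB {b : ℕ → H ι} (hb : Summable fun j => ‖b j‖) (t : ℝ) :
    HasSum (fun j => zc t ^ j • b j) (symB b t) := by
  rw [symB_eq]
  exact (Summable.of_norm (by simpa only [norm_zc_pow_smul] using hb)).hasSum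

theorem continuous_symB {b : ℕ → H ι} (hb : Summable fun j => ‖b j‖) : Continuous (symB b) := by
  have : symB b = fun t => ∑' j, zc t ^ j • b j := funext (symB_eq b)
  rw [this]
  exact continuous_tsum (fun j => (continuous_zc.pow j).smul continuous_const) hb
    fun j t => (norm_zc_pow_smul b j t).le

theorem norm_symB_le {b : ℕ → H ι} (hb : Summable fun j => ‖b j‖) (t : ℝ) :
    ‖symB b t‖ ≤ ∑' j, ‖b j‖ := by
  rw [symB_eq]
  exact (norm_tsum_le_tsum_norm (by simpa only [norm_zc_pow_smul] using hb)).trans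
    (by simp only [norm_zc_pow_smul, le_refl])

/-- Expands an integral against `B` into matrix entries times coefficients of `b`; this is how each
row of the block matrices is summed. -/
theorem hasSum_integral_symB {b : ℕ → H ι} (hb : Summable fun j => ‖b j‖) {Y : ℝ → H ι}
    (hY : Integrable Y circ) :
    HasSum (fun q : ℕ × ι => (∫ t, zc t ^ q.1 * inner ℂ (Y t) (delta q.2) ∂circ) * stack b q)
      (∫ t, inner ℂ (Y t) (symB b t) ∂circ) := by
  have hint : ∀ j : ℕ, Integrable (fun t => (starRingEnd ℂ) (zc t ^ j) • Y t) circ := fun j =>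
    hY.norm.mono' ((Complex.continuous_conj.comp
      (continuous_zc.pow j)).aestronglyMeasurable.smul hY.aestronglyMeasurable)
      (Eventually.of_forall fun t => by
        rw [norm_smul, RCLike.norm_conj, norm_pow, norm_zc, one_pow, one_mul])
  let y : ℕ → H ι := fun j => ∫ t, (starRingEnd ℂ) (zc t ^ j) • Y t ∂circ
  have hy : ∀ j x, inner ℂ (y j) x = ∫ t, zc t ^ j * inner ℂ (Y t) x ∂circ := fun j x => by
    rw [← inner_conj_symm, ← integral_inner (hint j), ← integral_conj]
    refine integral_congr_ae (Eventually.of_forall fun t => ?_)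
    simp only
    rw [inner_conj_symm, inner_smul_left, starRingEnd_self_apply]
  have hyn : ∀ j, ‖y j‖ ≤ ∫ t, ‖Y t‖ ∂circ := fun j => by
    refine (norm_integral_le_integral_norm _).trans (le_of_eq ?_)
    refine integral_congr_ae (Eventually.of_forall fun t => ?_)
    simp only
    rw [norm_smul, RCLike.norm_conj, norm_pow, norm_zc, one_pow, one_mul]
  simp_rw [← hy, stack]
  have hrow : ∀ j, HasSum (fun k => inner ℂ (y j) (delta k) * (b j) k) (inner ℂ (y j) (b j)) :=
    fun j => by
    have := (hasSum_delta (b j)).mapL (innerSL ℂ (y j))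
    simpa [inner_smul_right, mul_comm] using this
  -- Cauchy–Schwarz in the coordinates. Absolute summability is needed because the sum over `ℕ × ι`
  -- is unordered.
  have hrown : ∀ j, Summable (fun k => ‖inner ℂ (y j) (delta k) * (b j) k‖) ∧
      ∑' k, ‖inner ℂ (y j) (delta k) * (b j) k‖ ≤ (∫ t, ‖Y t‖ ∂circ) * ‖b j‖ := fun j => by
    have hs := Real.summable_and_inner_le_Lp_mul_Lq_tsum_of_nonneg (p := 2) (q := 2)
      (f := fun k => ‖y j k‖) (g := fun k => ‖b j k‖) (by
        rw [Real.holderConjugate_iff]; norm_num) (fun _ => norm_nonneg _)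
      (fun _ => norm_nonneg _) (by simpa using (lp.memℓp (y j)).summable (by norm_num))
      (by simpa using (lp.memℓp (b j)).summable (by norm_num))
    have heq : ∀ k, ‖inner ℂ (y j) (delta k) * (b j) k‖ = ‖y j k‖ * ‖b j k‖ := fun k => by
      rw [norm_mul, ← inner_conj_symm, RCLike.norm_conj, inner_delta]
    simp_rw [heq]
    refine ⟨hs.1, hs.2.trans ?_⟩
    have h1 := lp.norm_eq_tsum_rpow (p := 2) (by norm_num) (y j)
    have h2 := lp.norm_eq_tsum_rpow (p := 2) (by norm_num) (b j)
    simp only [ENNReal.toReal_ofNat] at h1 h2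
    rw [← h1, ← h2]
    gcongr
    exact hyn j
  have hsum : Summable fun q : ℕ × ι => inner ℂ (y q.1) (delta q.2) * (b q.1) q.2 := by
    refine Summable.of_norm ((summable_prod_of_nonneg fun _ => norm_nonneg _).2
      ⟨fun j => (hrown j).1, ?_⟩)
    exact Summable.of_nonneg_of_le (fun j => tsum_nonneg fun _ => norm_nonneg _)
      (fun j => (hrown j).2) (hb.mul_left _)
  have hcol : HasSum (fun j => inner ℂ (y j) (b j)) (∫ t, inner ℂ (Y t) (symB b t) ∂circ) := by
    have hval : ∀ j, inner ℂ (y j) (b j) = ∫ t, inner ℂ (Y t) (zc t ^ j • b j) ∂circ := fun j => by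
      rw [hy]
      exact integral_congr_ae (Eventually.of_forall fun t => by
        simp only; rw [inner_smul_right])
    simp_rw [hval]
    have hb' : ∀ j t, ‖inner ℂ (Y t) (zc t ^ j • b j)‖ ≤ ‖b j‖ * ‖Y t‖ := fun j t => by
      refine (norm_inner_le_norm _ _).trans (le_of_eq ?_)
      rw [norm_zc_pow_smul, mul_comm]
    have hi : ∀ j, Integrable (fun t => inner ℂ (Y t) (zc t ^ j • b j)) circ := fun j =>
      (hY.norm.const_mul ‖b j‖).mono' (hY.aestronglyMeasurable.inner
        ((continuous_zc.pow j).smul continuous_const).aestronglyMeasurable)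
        (Eventually.of_forall (hb' j))
    have h := hasSum_integral_of_summable_integral_norm hi (by
      refine Summable.of_nonneg_of_le (fun j => integral_nonneg fun _ => norm_nonneg _)
        (fun j => ?_) (hb.mul_right (∫ t, ‖Y t‖ ∂circ))
      rw [← integral_const_mul]
      exact integral_mono (hi j).norm (hY.norm.const_mul _) (hb' j))
    have h' : ∫ t, inner ℂ (Y t) (symB b t) ∂circ =
        ∫ t, ∑' j, inner ℂ (Y t) (zc t ^ j • b j) ∂circ :=
      integral_congr_ae (Eventually.of_forall fun t =>
        ((hasSum_symB hb t).mapL (innerSL ℂ (Y t))).tsum_eq.symm)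
    rw [h']
    exact h
  have hfin := hsum.hasSum.prod_fiberwise hrow
  rw [hcol.unique hfin]
  exact hsum.hasSum

end WeightedSpaces

/-! ## Gram matrices and projections -/

section Gram

set_option linter.unusedSectionVars false

variable {κ 𝓔 : Type*} [NormedAddCommGroup 𝓔] [InnerProductSpace ℂ 𝓔]

/-- The Gram matrix of a family of vectors. -/
def gram (v : κ → 𝓔) : Matrix κ κ ℂ := fun p q => inner ℂ (v p) (v q)

/-- The finite linear combination with the coefficients `x`. -/
def comb (v : κ → 𝓔) (x : κ →₀ ℂ) : 𝓔 := Finsupp.linearCombination ℂ v x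

theorem comb_eq_sum (v : κ → 𝓔) (x : κ →₀ ℂ) : comb v x = ∑ p ∈ x.support, x p • v p := rfl

theorem app_gram (v : κ → 𝓔) (x : κ →₀ ℂ) (p : κ) :
    app (gram v) x p = inner ℂ (v p) (comb v x) := by
  rw [app, tsum_eq_sum (s := x.support) (fun q hq => by
    rw [Finsupp.notMem_support_iff.1 hq, mul_zero]), comb_eq_sum, inner_sum]
  refine Finset.sum_congr rfl fun q _ => ?_
  rw [inner_smul_right, gram, mul_comm]

theorem sum_inner_star (v : κ → 𝓔) (x : κ →₀ ℂ) (y : 𝓔) :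
    ∑ p ∈ x.support, inner ℂ (v p) y * star (x p) = inner ℂ (comb v x) y := by
  rw [comb_eq_sum, sum_inner]
  refine Finset.sum_congr rfl fun p _ => ?_
  rw [inner_smul_left, mul_comm]; rfl

theorem energy_gram (v : κ → 𝓔) (x : κ →₀ ℂ) : energy (gram v) x = ‖comb v x‖ ^ 2 := by
  simp only [energy, app_gram]
  rw [sum_inner_star, inner_self_eq_norm_sq_to_K]
  norm_cast

theorem comb_sub (v : κ → 𝓔) (x y : κ →₀ ℂ) : comb v (x - y) = comb v x - comb v y := by
  simp [comb]

theorem comb_mem_span (v : κ → 𝓔) (x : κ →₀ ℂ) : comb v x ∈ Submodule.span ℂ (Set.range v) :=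
  Finsupp.mem_span_range_iff_exists_finsupp.2 ⟨x, rfl⟩

/-- The closed span of a family. -/
def closedSpan (v : κ → 𝓔) : Submodule ℂ 𝓔 := (Submodule.span ℂ (Set.range v)).topologicalClosure

variable [CompleteSpace 𝓔]

instance (v : κ → 𝓔) : CompleteSpace (closedSpan v) :=
  (Submodule.isClosed_topologicalClosure _).completeSpace_coe

theorem inner_eq_zero_of_mem_closedSpan {v : κ → 𝓔} {y z : 𝓔} (hy : ∀ p, inner ℂ (v p) y = 0)
    (hz : z ∈ closedSpan v) : inner ℂ z y = 0 := by
  have h : y ∈ (closedSpan v)ᗮ := by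
    rw [closedSpan, Submodule.orthogonal_closure, Submodule.mem_orthogonal]
    intro u hu
    induction hu using Submodule.span_induction with
    | mem u h => obtain ⟨p, rfl⟩ := h; exact hy p
    | zero => simp
    | add u w _ _ hu hw => rw [inner_add_left, hu, hw, add_zero]
    | smul a u _ hu => rw [inner_smul_left, hu, mul_zero]
  exact (Submodule.mem_orthogonal _ _).1 h z hz

/-- The orthogonal projection to the closed span of a family. -/
def gproj (v : κ → 𝓔) (β : 𝓔) : 𝓔 := (closedSpan v).starProjection β

theorem gproj_mem (v : κ → 𝓔) (β : 𝓔) : gproj v β ∈ closedSpan v :=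
  Submodule.starProjection_apply_mem _ _

theorem inner_sub_gproj (v : κ → 𝓔) (β : 𝓔) (p : κ) : inner ℂ (v p) (β - gproj v β) = 0 :=
  (Submodule.mem_orthogonal _ _).1 (Submodule.sub_starProjection_mem_orthogonal β) _
    (Submodule.le_topologicalClosure _ (Submodule.subset_span ⟨p, rfl⟩))

theorem eq_gproj {v : κ → 𝓔} {β y : 𝓔} (hy : y ∈ closedSpan v)
    (h : ∀ p, inner ℂ (v p) y = inner ℂ (v p) β) : y = gproj v β :=
  (Submodule.eq_starProjection_of_mem_of_inner_eq_zero hy fun z hz => by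
    rw [← inner_conj_symm, inner_eq_zero_of_mem_closedSpan (fun p => by
      rw [inner_sub_right, h, sub_self]) hz, map_zero]).symm

/-- For a Gram matrix, `energy` is the squared norm of the combination and `app` lists its inner
products with the family. Cauchy in energy then means convergence of the combinations, and the
entrywise limits identify the limit as the projection of `β`. -/
theorem convergesToInv_iff {v : κ → 𝓔} {β : 𝓔} {x : ℕ → κ →₀ ℂ} :
    ConvergesToInv (gram v) (fun p => inner ℂ (v p) β) x ↔
      Tendsto (fun n => comb v (x n)) atTop (𝓝 (gproj v β)) := by
  simp only [ConvergesToInv, energy_gram, app_gram, comb_sub]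
  constructor
  · rintro ⟨h1, h2⟩
    have hc : CauchySeq fun n => comb v (x n) := by
      refine Metric.cauchySeq_iff.2 fun ε hε => ?_
      obtain ⟨N, hN⟩ := h1 (ε ^ 2) (by positivity)
      refine ⟨N, fun m hm n hn => ?_⟩
      rw [dist_eq_norm]
      exact lt_of_pow_lt_pow_left₀ 2 hε.le (hN m hm n hn)
    obtain ⟨y, hy⟩ := cauchySeq_tendsto_of_complete hc
    have hmem : y ∈ closedSpan v :=
      mem_closure_of_tendsto hy (Eventually.of_forall fun n => comb_mem_span v _)
    rwa [← eq_gproj hmem fun p => tendsto_nhds_unique (tendsto_const_nhds.inner hy) (h2 p)]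
  · intro h
    refine ⟨fun δ hδ => ?_, fun p => ?_⟩
    · obtain ⟨N, hN⟩ := Metric.cauchySeq_iff.1 h.cauchySeq (√δ) (Real.sqrt_pos.2 hδ)
      refine ⟨N, fun m hm n hn => ?_⟩
      have := hN m hm n hn
      rw [dist_eq_norm] at this
      calc _ < √δ ^ 2 := by gcongr
        _ = δ := Real.sq_sqrt hδ.le
    · have h2 := inner_sub_gproj v β p
      rw [inner_sub_right, sub_eq_zero] at h2
      rw [h2]
      exact tendsto_const_nhds.inner h

theorem exists_convergesToInv (v : κ → 𝓔) (β : 𝓔) :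
    ∃ x, ConvergesToInv (gram v) (fun p => inner ℂ (v p) β) x := by
  obtain ⟨s, hs, hlim⟩ := mem_closure_iff_seq_limit.1 (gproj_mem v β)
  choose x hx using fun n => Finsupp.mem_span_range_iff_exists_finsupp.1 (hs n)
  refine ⟨x, convergesToInv_iff.2 ?_⟩
  convert hlim using 2 with n
  exact hx n

/-- Along any such sequence `⟨r, x_n⟩` tends to `⟨gproj β, β⟩`, which is `‖gproj β‖²` by
orthogonality of `β - gproj β`. Hence the value exists and does not depend on the sequence. -/
theorem hasInvForm_iff {v : κ → 𝓔} {β : 𝓔} {u : ℝ} :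
    HasInvForm (gram v) (fun p => inner ℂ (v p) β) u ↔ u = ‖gproj v β‖ ^ 2 := by
  have key : ∀ x, ConvergesToInv (gram v) (fun p => inner ℂ (v p) β) x → Tendsto
      (fun n => (∑ p ∈ (x n).support, inner ℂ (v p) β * star (x n p)).re) atTop
      (𝓝 (‖gproj v β‖ ^ 2)) := fun x hx => by
    have h := (convergesToInv_iff.1 hx).inner (𝕜 := ℂ) (tendsto_const_nhds (x := β))
    simp only [sum_inner_star]
    have h2 : inner ℂ (gproj v β) (β - gproj v β) = 0 :=
      inner_eq_zero_of_mem_closedSpan (inner_sub_gproj v β) (gproj_mem v β)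
    rw [inner_sub_right, sub_eq_zero] at h2
    rw [h2, inner_self_eq_norm_sq_to_K] at h
    have h3 := (Complex.continuous_re.tendsto _).comp h
    have h4 : ((((‖gproj v β‖ : ℝ) : ℂ)) ^ 2).re = ‖gproj v β‖ ^ 2 := by
      rw [← ofReal_pow, ofReal_re]
    rw [← h4]
    exact h3
  constructor
  · rintro ⟨x, hx, hlim⟩
    exact tendsto_nhds_unique hlim (key x hx)
  · rintro rfl
    obtain ⟨x, hx⟩ := exists_convergesToInv v β
    exact ⟨x, hx, key x hx⟩

end Gram

/-! ## The weighted `L₂` space of a density -/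

section Embedding

set_option linter.unusedSectionVars false

variable {ι : Type*} [Countable ι]

/-- Measurable functions of finite norm in `L₂(A)`. -/
def FinNorm (A : ℝ → H ι →L[ℂ] H ι) (h : ℝ → H ι) : Prop :=
  AEStronglyMeasurable h circ ∧ wSq A h ≠ ⊤

open Classical in
/-- The image of a function of `L₂(A)` under multiplication by `A^{1/2}`. -/
def emb (A : ℝ → H ι →L[ℂ] H ι) (h : ℝ → H ι) : Lp (H ι) 2 circ :=
  if hL : MemLp (rt A h) 2 circ then hL.toLp _ else 0

/-- Strongly measurable families of positive operators. -/
structure IsWeight (A : ℝ → H ι →L[ℂ] H ι) : Prop where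
  strMeas : StrMeas circ A
  positive : ∀ᵐ l ∂circ, (A l).IsPositive

theorem IsSpectralDensity.isWeight {d τ : ℕ} {A : ℝ → H ι →L[ℂ] H ι}
    (h : IsSpectralDensity d τ A) : IsWeight A := ⟨h.strMeas, h.positive⟩

variable {A : ℝ → H ι →L[ℂ] H ι} (hA : IsWeight A)
include hA

theorem FinNorm.add {g h : ℝ → H ι} (hg : FinNorm A g) (hh : FinNorm A h) : FinNorm A (g + h) :=
  ⟨hg.1.add hh.1, ne_top_of_le_ne_top (ENNReal.add_ne_top.2
    ⟨ENNReal.mul_ne_top (by simp) hg.2, ENNReal.mul_ne_top (by simp) hh.2⟩)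
    (wSq_add_le hA.strMeas hA.positive hg.1 hh.1)⟩

theorem FinNorm.sub {g h : ℝ → H ι} (hg : FinNorm A g) (hh : FinNorm A h) : FinNorm A (g - h) :=
  ⟨hg.1.sub hh.1, ne_top_of_le_ne_top (ENNReal.add_ne_top.2
    ⟨ENNReal.mul_ne_top (by simp) hg.2, ENNReal.mul_ne_top (by simp) hh.2⟩)
    (wSq_sub_le hA.strMeas hA.positive hg.1 hh.1)⟩

theorem FinNorm.zero : FinNorm A 0 :=
  ⟨aestronglyMeasurable_const, by simp [wSq, qf]⟩

theorem FinNorm.smul {h : ℝ → H ι} (c : ℂ) (hh : FinNorm A h) : FinNorm A (c • h) := by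
  refine ⟨hh.1.const_smul c, ?_⟩
  have : wSq A (c • h) = ENNReal.ofReal (‖c‖ ^ 2) * wSq A h := by
    simp only [wSq, Pi.smul_apply, qf_smul_right]
    rw [← lintegral_const_mul' _ _ ENNReal.ofReal_ne_top]
    exact lintegral_congr fun t => ENNReal.ofReal_mul (by positivity)
  rw [this]
  exact ENNReal.mul_ne_top ENNReal.ofReal_ne_top hh.2

theorem FinNorm.sum {κ : Type*} {u : κ → ℝ → H ι} (hu : ∀ p, FinNorm A (u p)) (s : Finset κ)
    (x : κ → ℂ) : FinNorm A (∑ p ∈ s, x p • u p) := by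
  classical
  induction s using Finset.induction_on with
  | empty => exact FinNorm.zero hA
  | insert p s hp ih => rw [Finset.sum_insert hp]; exact ((hu p).smul hA _).add hA ih

theorem FinNorm.memLp {h : ℝ → H ι} (hh : FinNorm A h) : MemLp (rt A h) 2 circ :=
  memLp_rt hA.strMeas hA.positive hh.1 hh.2

theorem emb_eq {h : ℝ → H ι} (hh : FinNorm A h) : emb A h = (hh.memLp hA).toLp _ :=
  dif_pos (hh.memLp hA)

theorem inner_emb {g h : ℝ → H ι} (hg : FinNorm A g) (hh : FinNorm A h) :
    inner ℂ (emb A g) (emb A h) = ∫ t, inner ℂ (g t) (A t (h t)) ∂circ := by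
  rw [emb_eq hA hg, emb_eq hA hh, inner_toLp_rt hA.positive]

theorem norm_emb_sq {h : ℝ → H ι} (hh : FinNorm A h) :
    ENNReal.ofReal (‖emb A h‖ ^ 2) = wSq A h := by
  rw [emb_eq hA hh, norm_toLp_rt_sq hA.positive]

theorem emb_sub {g h : ℝ → H ι} (hg : FinNorm A g) (hh : FinNorm A h) :
    emb A (g - h) = emb A g - emb A h := by
  rw [emb_eq hA hg, emb_eq hA hh, emb_eq hA (hg.sub hA hh), ← MemLp.toLp_sub]
  exact MemLp.toLp_congr _ _ (EventuallyEq.of_eq (rt_sub _ _ _))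

theorem emb_add {g h : ℝ → H ι} (hg : FinNorm A g) (hh : FinNorm A h) :
    emb A (g + h) = emb A g + emb A h := by
  rw [emb_eq hA hg, emb_eq hA hh, emb_eq hA (hg.add hA hh), ← MemLp.toLp_add]
  exact MemLp.toLp_congr _ _ (EventuallyEq.of_eq (rt_add _ _ _))

theorem emb_smul {h : ℝ → H ι} (c : ℂ) (hh : FinNorm A h) : emb A (c • h) = c • emb A h := by
  rw [emb_eq hA hh, emb_eq hA (hh.smul hA c), ← MemLp.toLp_const_smul]
  exact MemLp.toLp_congr _ _ (EventuallyEq.of_eq (rt_smul _ _ _))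

theorem emb_zero : emb A 0 = 0 := by
  have h := emb_smul hA 0 (FinNorm.zero hA)
  rwa [zero_smul, zero_smul] at h

theorem emb_sum {κ : Type*} {u : κ → ℝ → H ι} (hu : ∀ p, FinNorm A (u p)) (s : Finset κ)
    (x : κ → ℂ) : emb A (∑ p ∈ s, x p • u p) = ∑ p ∈ s, x p • emb A (u p) := by
  classical
  induction s using Finset.induction_on with
  | empty => simpa using emb_zero hA
  | insert p s hp ih =>
    rw [Finset.sum_insert hp, Finset.sum_insert hp, emb_add hA ((hu p).smul hA _)
      (FinNorm.sum hA hu s x), emb_smul hA _ (hu p), ih]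

theorem tendsto_emb_iff {u : ℕ → ℝ → H ι} {h : ℝ → H ι} (hu : ∀ n, FinNorm A (u n))
    (hh : FinNorm A h) : Tendsto (fun n => emb A (u n)) atTop (𝓝 (emb A h)) ↔
      Tendsto (fun n => wSq A (h - u n)) atTop (𝓝 0) := by
  have h1 : ∀ n, wSq A (h - u n) = ENNReal.ofReal (‖emb A (u n) - emb A h‖ ^ 2) := fun n => by
    rw [← emb_sub hA (hu n) hh, norm_emb_sq hA ((hu n).sub hA hh), wSq_sub_comm]
  simp only [h1]
  rw [tendsto_iff_norm_sub_tendsto_zero]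
  constructor
  · intro h2
    have := (ENNReal.continuous_ofReal.tendsto _).comp (h2.pow 2)
    rw [zero_pow two_ne_zero, ENNReal.ofReal_zero] at this
    exact this
  · intro h2
    have h3 := (ENNReal.tendsto_toReal ENNReal.zero_ne_top).comp h2
    have h4 : Tendsto (fun n => ‖emb A (u n) - emb A h‖ ^ 2) atTop (𝓝 0) := by
      refine h3.congr fun n => ?_
      exact ENNReal.toReal_ofReal (by positivity)
    have h5 := (Real.continuous_sqrt.tendsto _).comp h4
    rw [Real.sqrt_zero] at h5
    refine h5.congr fun n => ?_
    exact Real.sqrt_sq (norm_nonneg _)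

end Embedding

/-! ## Pairs of densities that satisfy the minimality condition -/

section MinimalPair

variable {ι : Type*}

theorem IsSpectralDensity.add [Countable ι] {d τ : ℕ} {f g : ℝ → H ι →L[ℂ] H ι}
    (hf : IsSpectralDensity d τ f) (hg : IsSpectralDensity d τ g) :
    IsSpectralDensity d τ fun l => f l + g l where
  measurable := hf.strMeas.add hg.strMeas
  positive := by filter_upwards [hf.positive, hg.positive] with l h1 h2 using h1.add h2
  integrable := by
    refine (hf.integrable.add hg.integrable).mono' ?_ (Eventually.of_forall fun l => ?_)
    · exact ((measurable_wt d τ).aemeasurable.mul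
        (hf.strMeas.add hg.strMeas).norm).aestronglyMeasurable
    · rw [Real.norm_of_nonneg (mul_nonneg (wt_nonneg _ _ _) (norm_nonneg _)), Pi.add_apply,
        ← mul_add]
      exact mul_le_mul_of_nonneg_left (norm_add_le _ _) (wt_nonneg _ _ _)

theorem IsSpectralDensity.smul [Countable ι] {d τ : ℕ} {f : ℝ → H ι →L[ℂ] H ι}
    (hf : IsSpectralDensity d τ f) {r : ℝ} (hr : 0 ≤ r) :
    IsSpectralDensity d τ fun l => (r : ℂ) • f l where
  measurable := hf.strMeas.smul aestronglyMeasurable_const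
  positive := hf.positive.mono fun l h => isPositive_real_smul h hr
  integrable := by
    refine (hf.integrable.const_mul r).congr (Eventually.of_forall fun l => ?_)
    simp only
    rw [norm_smul, norm_real, Real.norm_of_nonneg hr]; ring

/-- A pair of densities that satisfies the minimality condition. -/
structure MinPair (d τ : ℕ) (F G : ℝ → H ι →L[ℂ] H ι) : Prop where
  step : 0 < τ
  left : IsSpectralDensity d τ F
  right : IsSpectralDensity d τ G
  minimal : Minimality d τ F G

/-- `F + G`. -/
def dsum (F G : ℝ → H ι →L[ℂ] H ι) (l : ℝ) : H ι →L[ℂ] H ι := F l + G l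

/-- `(1 - e^{iλτ})^{-d} (-iλ)^d (F + G)⁻¹ C`. -/
def lft (d τ : ℕ) (F G : ℝ → H ι →L[ℂ] H ι) (C : ℝ → H ι) (l : ℝ) : H ι :=
  ((starRingEnd ℂ) (incr d τ l))⁻¹ • sumInv F G l (C l)

/-- The dual monomials. -/
def dualMono (p : ℕ × ι) (l : ℝ) : H ι := chr (p.1 + 1) l • delta p.2

/-- The function whose orthogonal projection is the spectral characteristic of the estimate. -/
def target (d τ : ℕ) (F G : ℝ → H ι →L[ℂ] H ι) (b : ℕ → H ι) (l : ℝ) : H ι :=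
  incr d τ l • sumInv F G l (F l (symB b l))

/-- The family that spans the orthogonal complement of the observed functions. -/
def dualFamily (d τ : ℕ) (F G : ℝ → H ι →L[ℂ] H ι) (p : ℕ × ι) : Lp (H ι) 2 circ :=
  emb (dsum F G) (lft d τ F G (dualMono p))

theorem norm_dualMono (p : ℕ × ι) (l : ℝ) : ‖dualMono p l‖ = 1 := by
  rw [dualMono, norm_smul, norm_chr, norm_delta, one_mul]

theorem continuous_dualMono (p : ℕ × ι) : Continuous (dualMono p) :=
  Continuous.smul (f := chr (p.1 + 1)) (g := fun _ => delta p.2) (continuous_chr _) continuous_const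

variable [Countable ι] {d τ : ℕ} {F G : ℝ → H ι →L[ℂ] H ι} (h : MinPair d τ F G)
include h

theorem MinPair.sum_density : IsSpectralDensity d τ (dsum F G) := h.left.add h.right

theorem MinPair.isWeight : IsWeight (dsum F G) := h.sum_density.isWeight

theorem MinPair.strMeas_inv : StrMeas circ (sumInv F G) :=
  h.isWeight.strMeas.inverse h.isWeight.positive h.minimal.invertible

theorem MinPair.positive_inv : ∀ᵐ l ∂circ, (sumInv F G l).IsPositive := by
  filter_upwards [h.isWeight.positive, h.minimal.invertible] with l h1 h2
  exact isPositive_inverse h1 h2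

theorem MinPair.lft_aestronglyMeasurable {C : ℝ → H ι} (hC : AEStronglyMeasurable C circ) :
    AEStronglyMeasurable (lft d τ F G C) circ := by
  have h1 : AEStronglyMeasurable (fun l => ((starRingEnd ℂ) (incr d τ l))⁻¹) circ :=
    (Complex.continuous_conj.measurable.comp (measurable_incr d τ)).inv.aestronglyMeasurable
  exact h1.smul (h.strMeas_inv.apply hC)

/-- The factor `w̄⁻¹ S⁻¹` is chosen so that the norm of `L₂(S)` becomes the norm with the weight
`wt⁻¹ S⁻¹` that defines `C`. -/
theorem MinPair.qf_lft (C : ℝ → H ι) : ∀ᵐ l ∂circ, qf (dsum F G l) (lft d τ F G C l) =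
    (wt d τ l)⁻¹ * qf (sumInv F G l) (C l) := by
  filter_upwards [h.isWeight.positive, h.minimal.invertible] with l h1 h2
  rw [lft, qf_smul_right, norm_inv, RCLike.norm_conj, inv_pow, norm_incr_sq]
  congr 1
  exact qf_inverse h1 h2 _

theorem MinPair.wSq_lft (C : ℝ → H ι) : wSq (dsum F G) (lft d τ F G C) =
    ∫⁻ l, ENNReal.ofReal ((wt d τ l)⁻¹ * qf (sumInv F G l) (C l)) ∂circ :=
  lintegral_congr_ae ((h.qf_lft C).mono fun l hl => by simp only [hl])

theorem MinPair.finNorm_dual (p : ℕ × ι) :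
    FinNorm (dsum F G) (lft d τ F G (dualMono p)) := by
  refine ⟨h.lft_aestronglyMeasurable
    (continuous_dualMono p).aestronglyMeasurable, ?_⟩
  rw [h.wSq_lft]
  refine ne_top_of_le_ne_top h.minimal.integrable.lintegral_lt_top.ne
    (lintegral_mono fun l => ENNReal.ofReal_le_ofReal ?_)
  refine mul_le_mul_of_nonneg_left ((qf_le_norm _ _).trans ?_) (inv_nonneg.2 (wt_nonneg _ _ _))
  rw [norm_dualMono, one_pow, mul_one]

theorem MinPair.dual_inner {u : ℝ → H ι} (C : ℝ → H ι) : ∀ᵐ l ∂circ,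
    inner ℂ (lft d τ F G C l) (dsum F G l (u l)) =
      (incr d τ l)⁻¹ * inner ℂ (C l) (u l) := by
  filter_upwards [h.isWeight.positive, h.minimal.invertible] with l h1 h2
  rw [← h1.inner_left_eq_inner_right, lft, map_smul, dsum, sumInv, self_apply_inverse h2,
    inner_smul_left, map_inv₀, starRingEnd_self_apply]

/-- In the inner product of `L₂(S)` the factor `S⁻¹` cancels the weight, leaving Fourier
coefficients of `w⁻¹ u` at `e^{iλ(j+1)}`, precisely those absent from polynomials in `e^{-iλ}`. -/
theorem MinPair.inner_dualFamily {u : ℝ → H ι} (hu : FinNorm (dsum F G) u) (p : ℕ × ι) :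
    inner ℂ (dualFamily d τ F G p) (emb (dsum F G) u) =
      ∫ t, zc t ^ (p.1 + 1) * ((incr d τ t)⁻¹ • u t) p.2 ∂circ := by
  rw [dualFamily, inner_emb h.isWeight (h.finNorm_dual p) hu]
  refine integral_congr_ae ((h.dual_inner (u := u) (dualMono p)).mono fun t ht => ht.trans ?_)
  rw [dualMono, inner_chr_delta]
  beta_reduce
  rw [zc_pow, lp.coeFn_smul, Pi.smul_apply, smul_eq_mul]
  push_cast
  ring

/-- Observed functions have no such coefficients, and orthogonality passes to limits. Conversely,
divide by `w` and apply the weighted density theorem. -/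
theorem MinPair.mem_obsClosure_iff {u : ℝ → H ι} (hu : FinNorm (dsum F G) u) :
    u ∈ obsClosure d τ (dsum F G) ↔ ∀ p, inner ℂ (dualFamily d τ F G p) (emb (dsum F G) u) = 0 := by
  have hne := ae_incr_ne_zero d h.step
  constructor
  · rintro ⟨-, hcl⟩ p
    have hpoly : ∀ q, q ∈ vpoly ι → FinNorm (dsum F G) (fun l => incr d τ l • q l) ∧
        inner ℂ (dualFamily d τ F G p) (emb (dsum F G) (fun l => incr d τ l • q l)) = 0 := by
      intro q hq
      obtain ⟨K, hK⟩ := vpoly_bounded hq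
      have hfin : FinNorm (dsum F G) (fun l => incr d τ l • q l) :=
        ⟨incr_vpoly_aestronglyMeasurable d τ hq, wSq_incr_vpoly_ne_top h.sum_density hK⟩
      refine ⟨hfin, ?_⟩
      rw [h.inner_dualFamily hfin]
      have heq : ∫ t, zc t ^ (p.1 + 1) * ((incr d τ t)⁻¹ • incr d τ t • q t) p.2 ∂circ =
          ∫ t, zc t ^ (p.1 + 1) * q t p.2 ∂circ :=
        integral_congr_ae (hne.mono fun t ht => by simp only [inv_smul_smul₀ ht])
      rw [heq]
      have hint : ∀ q, q ∈ vpoly ι → Integrable (fun t => zc t ^ (p.1 + 1) * q t p.2) circ := by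
        intro q hq
        obtain ⟨K, hK⟩ := vpoly_bounded hq
        have hqc : Continuous fun t => q t p.2 := by
          have := (continuous_const (y := delta p.2)).inner (vpoly_continuous hq) (𝕜 := ℂ)
          simpa only [inner_delta] using this
        refine Integrable.of_bound ((continuous_zc.pow _).mul hqc).aestronglyMeasurable K
          (Eventually.of_forall fun t => ?_)
        rw [norm_mul, norm_pow, norm_zc, one_pow, one_mul]
        exact (lp.norm_apply_le_norm (by norm_num) _ _).trans (hK t)
      clear heq hfin hK
      induction hq using Submodule.span_induction with
      | mem q hq =>
        obtain ⟨r, rfl⟩ := hq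
        simp only [vmono, lp.coeFn_smul, Pi.smul_apply, smul_eq_mul]
        simp_rw [← mul_assoc, ← pow_add]
        rw [integral_mul_const]
        simp_rw [zc_pow]
        rw [integral_chr, if_neg (by push_cast; omega), zero_mul]
      | zero => simp
      | add x y hx hy ihx ihy =>
        simp only [Pi.add_apply, lp.coeFn_add, mul_add]
        rw [integral_add (hint x hx) (hint y hy), ihx, ihy, add_zero]
      | smul a x _ ih =>
        simp only [Pi.smul_apply, lp.coeFn_smul, smul_eq_mul, mul_left_comm _ a]
        rw [integral_const_mul, ih, mul_zero]
    have hb : ∀ ε > 0, ‖inner ℂ (dualFamily d τ F G p) (emb (dsum F G) u)‖ ≤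
        ‖dualFamily d τ F G p‖ * ε := fun ε hε => by
      obtain ⟨q, hq, hle⟩ := hcl (ENNReal.ofReal (ε ^ 2)) (by simpa using hε.ne')
      obtain ⟨hqf, hq0⟩ := hpoly q hq
      have h1 : inner ℂ (dualFamily d τ F G p) (emb (dsum F G) u) =
          inner ℂ (dualFamily d τ F G p) (emb (dsum F G) (u - fun l => incr d τ l • q l)) := by
        rw [emb_sub h.isWeight hu hqf, inner_sub_right, hq0, sub_zero]
      rw [h1]
      refine (norm_inner_le_norm _ _).trans (mul_le_mul_of_nonneg_left ?_ (norm_nonneg _))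
      rw [← norm_emb_sq h.isWeight (hu.sub h.isWeight hqf),
        ENNReal.ofReal_le_ofReal_iff (by positivity)] at hle
      exact (sq_le_sq₀ (norm_nonneg _) hε.le).1 hle
    rw [← norm_le_zero_iff]
    refine le_of_forall_pos_le_add fun ε hε => ?_
    refine (hb (ε / (‖dualFamily d τ F G p‖ + 1)) (by positivity)).trans ?_
    rw [zero_add, mul_div_assoc', div_le_iff₀ (by positivity)]
    nlinarith [norm_nonneg (dualFamily d τ F G p)]
  · intro horth
    refine ⟨hu.1, fun ε hε => ?_⟩
    -- With `φ = w⁻¹ u` and `W = |w|² S`, the norm of `φ` in `L₂(W)` is that of `u` in `L₂(S)`, and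
    -- `W` is integrable.
    set W : ℝ → H ι →L[ℂ] H ι := fun l => ((wt d τ l : ℝ) : ℂ) • dsum F G l with hW
    set φ : ℝ → H ι := fun l => (incr d τ l)⁻¹ • u l with hφ
    have hWm : StrMeas circ W := h.isWeight.strMeas.smul
      (Complex.measurable_ofReal.comp (measurable_wt d τ)).aestronglyMeasurable
    have hWp : ∀ᵐ t ∂circ, (W t).IsPositive :=
      h.isWeight.positive.mono fun t ht => isPositive_real_smul ht (wt_nonneg _ _ _)
    have hWi : Integrable (fun t => ‖W t‖) circ :=
      h.sum_density.integrable.congr (Eventually.of_forall fun t => by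
        simp only [hW]
        rw [norm_smul, norm_real, Real.norm_of_nonneg (wt_nonneg _ _ _)])
    have hqf : ∀ v : ℝ → H ι, wSq W v = wSq (dsum F G) (fun l => incr d τ l • v l) := fun v =>
      lintegral_congr fun t => by rw [hW, qf_real_smul_left, qf_smul_right, norm_incr_sq]
    have hcancel : (fun l => incr d τ l • φ l) =ᵐ[circ] u :=
      hne.mono fun t ht => by simp only [hφ, smul_inv_smul₀ ht]
    have hφm : AEStronglyMeasurable φ circ :=
      (measurable_incr d τ).inv.aestronglyMeasurable.smul hu.1
    have hui : Integrable (fun t => qf (dsum F G t) (u t)) circ := by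
      refine ⟨(aemeasurable_qf h.isWeight.strMeas hu.1).aestronglyMeasurable, ?_⟩
      rw [hasFiniteIntegral_iff_ofReal (h.isWeight.positive.mono fun t ht => qf_nonneg ht _)]
      exact lt_top_iff_ne_top.2 hu.2
    -- `‖φ‖²` is at most the product of the integrable functions `wt⁻¹ ‖S⁻¹‖` and `⟨u, S u⟩`, so
    -- `‖φ‖` is bounded by their sum.
    have hφi : Integrable φ circ := by
      refine ((h.minimal.integrable.add hui)).mono' hφm ?_
      filter_upwards [h.isWeight.positive, h.minimal.invertible, hne] with t h1 h2 h3
      have h4 := norm_sq_le_inverse h1 h2 (u t)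
      have hw := wt_pos_of_incr h3
      have h5 : ‖φ t‖ ^ 2 ≤ ((wt d τ t)⁻¹ * ‖sumInv F G t‖) * qf (dsum F G t) (u t) := by
        rw [hφ]
        simp only [norm_smul, mul_pow, norm_inv, inv_pow, norm_incr_sq]
        rw [mul_assoc]
        exact mul_le_mul_of_nonneg_left h4 (inv_nonneg.2 hw.le)
      simp only [Pi.add_apply]
      have ha : 0 ≤ (wt d τ t)⁻¹ * ‖sumInv F G t‖ := by positivity
      have hb := qf_nonneg h1 (u t)
      change 0 ≤ qf (dsum F G t) (u t) at hb
      refine (sq_le_sq₀ (norm_nonneg _) (add_nonneg ha hb)).1 (h5.trans ?_)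
      nlinarith
    obtain ⟨p, hp, hle⟩ := exists_vpoly_near hWm hWp hWi hφi
      (by rw [hqf, wSq_congr hcancel]; exact hu.2)
      (fun l k => by
        have := horth (l, k)
        rwa [h.inner_dualFamily hu] at this) hε
    refine ⟨p, hp, ?_⟩
    rw [hqf] at hle
    convert hle using 1
    refine wSq_congr (hne.mono fun t ht => ?_)
    simp only [Pi.sub_apply, smul_sub, hφ, smul_inv_smul₀ ht]

end MinimalPair

/-! ## The parallel sum of two positive operators -/

section ParallelSum

variable {E : Type*} [NormedAddCommGroup E] [InnerProductSpace ℂ E]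

/-- `A - A (A + B)⁻¹ A = B (A + B)⁻¹ A`. -/
def parSum (A B : E →L[ℂ] E) : E →L[ℂ] E := A - A * Ring.inverse (A + B) * A

theorem mul_inverse_mul_eq_parSum {A B : E →L[ℂ] E} (hS : IsUnit (A + B)) :
    B * Ring.inverse (A + B) * A = parSum A B := by
  rw [parSum, eq_sub_iff_add_eq, ← add_mul, ← add_mul, add_comm B, Ring.mul_inverse_cancel _ hS,
    one_mul]

theorem qf_parSum {A B : E →L[ℂ] E} (hA : A.IsPositive) (x : E) :
    qf (parSum A B) x = qf A x - qf (Ring.inverse (A + B)) (A x) := by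
  rw [qf, qf, qf, parSum, sub_apply, inner_sub_right, sub_re]
  congr 2
  exact (hA.inner_left_eq_inner_right _ _).symm

theorem qf_sub_right {A : E →L[ℂ] E} (hA : A.IsPositive) (x y : E) :
    qf A (x - y) = qf A x - 2 * (inner ℂ y (A x)).re + qf A y := by
  have h : (inner ℂ x (A y)).re = (inner ℂ y (A x)).re := by
    rw [← hA.inner_left_eq_inner_right, ← inner_conj_symm, conj_re]
  simp only [qf, map_sub, inner_sub_left, inner_sub_right, sub_re, h]
  ring

variable [CompleteSpace E]

theorem isPositive_parSum {A B : E →L[ℂ] E} (hA : A.IsPositive) (hB : B.IsPositive)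
    (hS : IsUnit (A + B)) : (parSum A B).IsPositive := by
  refine (ContinuousLinearMap.isPositive_def').2 ⟨?_, fun x => ?_⟩
  · have hV := (isPositive_inverse (hA.add hB) hS).isSelfAdjoint
    have hA' := hA.isSelfAdjoint
    refine hA'.sub ?_
    rw [IsSelfAdjoint, star_mul, star_mul, hA'.star_eq, hV.star_eq, mul_assoc]
  · have h : 0 ≤ qf (parSum A B) x := by
      rw [qf_parSum hA, sub_nonneg]
      exact qf_inverse_apply_le hA hB hS x
    rw [ContinuousLinearMap.reApplyInnerSelf_apply, ← inner_conj_symm, RCLike.conj_re]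
    exact h

theorem norm_parSum_le {A B : E →L[ℂ] E} (hA : A.IsPositive) (hB : B.IsPositive)
    (hS : IsUnit (A + B)) : ‖parSum A B‖ ≤ ‖A‖ := by
  refine norm_le_of_qf_le (isPositive_parSum hA hB hS) (norm_nonneg _) fun x => ?_
  rw [qf_parSum hA]
  linarith [qf_le_norm A x, qf_nonneg (isPositive_inverse (hA.add hB) hS) (A x)]

/-- Completing the square in `y`: the minimum is at `(A + B)⁻¹ A x`, with the form of the parallel
sum as its value. -/
theorem qf_sub_add_qf {A B : E →L[ℂ] E} (hA : A.IsPositive) (hB : B.IsPositive)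
    (hS : IsUnit (A + B)) (x y : E) : qf A (x - y) + qf B y =
      qf (A + B) (y - Ring.inverse (A + B) (A x)) + qf (parSum A B) x := by
  have h : (inner ℂ (Ring.inverse (A + B) (A x)) ((A + B) y)).re = (inner ℂ y (A x)).re := by
    rw [← (hA.add hB).inner_left_eq_inner_right, self_apply_inverse hS, ← inner_conj_symm, conj_re]
  rw [qf_sub_right hA, qf_sub_right (hA.add hB), qf_parSum hA, qf_inverse (hA.add hB) hS,
    qf_add_left A B y, h]
  ring

theorem norm_mul_inverse_apply_sq_le {A B : E →L[ℂ] E} (hA : A.IsPositive) (hB : B.IsPositive)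
    (hS : IsUnit (A + B)) (x : E) :
    ‖A (Ring.inverse (A + B) x)‖ ^ 2 ≤ ‖A‖ * (‖Ring.inverse (A + B)‖ * ‖x‖ ^ 2) := by
  refine (norm_apply_sq_le hA _).trans (mul_le_mul_of_nonneg_left ?_ (norm_nonneg _))
  refine le_trans ?_ (qf_le_norm (Ring.inverse (A + B)) x)
  rw [← qf_inverse (hA.add hB) hS, qf_add_left]
  linarith [qf_nonneg hB (Ring.inverse (A + B) x)]

end ParallelSum

/-! ## The optimal estimate for a minimal pair -/

section OptimalEstimate

variable {ι : Type*}

/-- The pointwise transpose. -/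
abbrev trn (f : ℝ → H ι →L[ℂ] H ι) (l : ℝ) : H ι →L[ℂ] H ι := transp (f l)

/-- The error that remains for a completely observed sum `ξ + η`. -/
def interpError (d τ : ℕ) (b : ℕ → H ι) (F G : ℝ → H ι →L[ℂ] H ι) : ℝ :=
  ∫ t, wt d τ t * qf (parSum (F t) (G t)) (symB b t) ∂circ

/-- The projection of the target to the complement of the observed functions. -/
def dualProj (d τ : ℕ) (b : ℕ → H ι) (F G : ℝ → H ι →L[ℂ] H ι) : Lp (H ι) 2 circ :=
  gproj (dualFamily d τ F G) (emb (dsum F G) (target d τ F G b))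

/-- The mean square error of the optimal estimate. -/
def minError (d τ : ℕ) (b : ℕ → H ι) (F G : ℝ → H ι →L[ℂ] H ι) : ℝ :=
  ‖dualProj d τ b F G‖ ^ 2 + interpError d τ b F G

theorem finNorm_of_qf_le {A : ℝ → H ι →L[ℂ] H ι} {u : ℝ → H ι} (hu : AEStronglyMeasurable u circ)
    {φ : ℝ → ℝ} (hφ : Integrable φ circ)
    (hle : ∀ᵐ t ∂circ, qf (A t) (u t) ≤ φ t) : FinNorm (A) u :=
  ⟨hu, ne_top_of_le_ne_top hφ.lintegral_lt_top.ne
    (lintegral_mono_ae (hle.mono fun _ ht => ENNReal.ofReal_le_ofReal ht))⟩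

theorem integrable_inner_symB [Countable ι] {b : ℕ → H ι} (hb : Summable fun j => ‖b j‖) {Y : ℝ → H ι}
    (hY : Integrable Y circ) : Integrable (fun t => inner ℂ (Y t) (symB b t)) circ := by
  refine (hY.norm.mul_const (∑' j, ‖b j‖)).mono'
    (hY.aestronglyMeasurable.inner (continuous_symB hb).aestronglyMeasurable)
    (Eventually.of_forall fun t => ?_)
  exact (norm_inner_le_norm _ _).trans
    (mul_le_mul_of_nonneg_left (norm_symB_le hb t) (norm_nonneg _))

theorem mse_eq (d τ : ℕ) (b : ℕ → H ι) (h : ℝ → H ι) (f g : ℝ → H ι →L[ℂ] H ι) :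
    mse d τ b h f g = ∫⁻ l, (ENNReal.ofReal (qf (trn f l) (incr d τ l • symB b l - h l))
      + ENNReal.ofReal (qf (trn g l) (h l))) ∂circ := by
  simp only [mse, quad_eq_qf]

theorem lft_sub (d τ : ℕ) (F G : ℝ → H ι →L[ℂ] H ι) (C X : ℝ → H ι) :
    lft d τ F G (C - X) = lft d τ F G C - lft d τ F G X := by
  funext l; simp only [lft, Pi.sub_apply, map_sub, smul_sub]

theorem lft_sum (d τ : ℕ) (F G : ℝ → H ι →L[ℂ] H ι) (s : Finset (ℕ × ι)) (x : ℕ × ι → ℂ)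
    (u : ℕ × ι → ℝ → H ι) : lft d τ F G (∑ p ∈ s, x p • u p) =
      ∑ p ∈ s, x p • lft d τ F G (u p) := by
  funext l
  simp only [lft, Finset.sum_apply, Pi.smul_apply, map_sum, map_smul, Finset.smul_sum]
  exact Finset.sum_congr rfl fun p _ => smul_comm _ _ _

theorem symFin_eq (x : ℕ × ι →₀ ℂ) : symFin x = ∑ p ∈ x.support, x p • dualMono p := by
  funext l
  rw [symFin, Finset.sum_apply]
  refine Finset.sum_congr rfl fun p _ => ?_
  rw [Pi.smul_apply, dualMono, smul_smul, chr]
  push_cast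
  rfl

/-- Reads the formula as the target minus its component in the complement of the observations. -/
theorem spectralA_eq (d τ : ℕ) (b : ℕ → H ι) (f g : ℝ → H ι →L[ℂ] H ι) (C : ℝ → H ι) :
    spectralA d τ b f g C = target d τ (trn f) (trn g) b - lft d τ (trn f) (trn g) C := by
  funext l
  rw [spectralA, Pi.sub_apply, target, lft, rowMul, rowMul, transp_mul, sumInv_transpose,
    conj_incr, inv_div]
  rfl

section MinimalPair

set_option linter.unusedSectionVars false

variable [Countable ι] {d τ : ℕ} {b : ℕ → H ι} {F G : ℝ → H ι →L[ℂ] H ι} (h : MinPair d τ F G)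
  (hb : Summable fun j => ‖b j‖)
include h

theorem MinPair.ae_parSum : ∀ᵐ t ∂circ, (parSum (F t) (G t)).IsPositive ∧
    ‖parSum (F t) (G t)‖ ≤ ‖F t‖ := by
  filter_upwards [h.left.positive, h.right.positive, h.minimal.invertible] with t h1 h2 h3
  exact ⟨isPositive_parSum h1 h2 h3, norm_parSum_le h1 h2 h3⟩

theorem MinPair.strMeas_parSum : StrMeas circ fun t => parSum (F t) (G t) :=
  h.left.strMeas.sub ((h.left.strMeas.mul h.strMeas_inv).mul h.left.strMeas)

theorem MinPair.integrable_parSum {u : ℝ → H ι} (hu : AEStronglyMeasurable u circ) {K : ℝ}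
    (hK : ∀ t, ‖u t‖ ≤ K) :
    Integrable (fun t => ((wt d τ t : ℝ) : ℂ) • parSum (F t) (G t) (u t)) circ := by
  refine (h.left.integrable.mul_const K).mono' ?_ (h.ae_parSum.mono fun t ht => ?_)
  · exact (Complex.measurable_ofReal.comp (measurable_wt d τ)).aestronglyMeasurable.smul
      (h.strMeas_parSum.apply hu)
  · rw [norm_smul, norm_real, Real.norm_of_nonneg (wt_nonneg _ _ _), mul_assoc]
    refine mul_le_mul_of_nonneg_left ?_ (wt_nonneg _ _ _)
    exact (ContinuousLinearMap.le_opNorm _ _).trans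
      (mul_le_mul ht.2 (hK t) (norm_nonneg _) (norm_nonneg _))

/-- The weights cancel: the square of the norm is at most `(wt ‖F‖) · (wt⁻¹ ‖S⁻¹‖)`, a product of
two integrable functions, so the norm is bounded by their sum. -/
theorem MinPair.integrable_mul_inv {u : ℝ → H ι} (hu : AEStronglyMeasurable u circ)
    (hK : ∀ t, ‖u t‖ ≤ 1) : Integrable (fun t => F t (sumInv F G t (u t))) circ := by
  refine (h.left.integrable.add h.minimal.integrable).mono'
    (h.left.strMeas.apply (h.strMeas_inv.apply hu)) ?_
  filter_upwards [h.left.positive, h.right.positive, h.minimal.invertible,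
    ae_incr_ne_zero d h.step] with t h1 h2 h3 h4
  have hw := wt_pos_of_incr h4
  have h5 := norm_mul_inverse_apply_sq_le h1 h2 h3 (u t)
  have h6 : ‖F t‖ * (‖sumInv F G t‖ * ‖u t‖ ^ 2) ≤ ‖F t‖ * ‖sumInv F G t‖ := by
    refine mul_le_mul_of_nonneg_left ?_ (norm_nonneg _)
    exact mul_le_of_le_one_right (norm_nonneg _) (pow_le_one₀ (norm_nonneg _) (hK t))
  have ha : 0 ≤ wt d τ t * ‖F t‖ := by positivity
  have hb : 0 ≤ (wt d τ t)⁻¹ * ‖sumInv F G t‖ := by positivity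
  have h7 : ‖F t‖ * ‖sumInv F G t‖ = (wt d τ t * ‖F t‖) * ((wt d τ t)⁻¹ * ‖sumInv F G t‖) := by
    field_simp
  refine (sq_le_sq₀ (norm_nonneg _) (add_nonneg ha hb)).1 ((h5.trans h6).trans ?_)
  rw [h7]
  nlinarith

include hb in
theorem MinPair.finNorm_target : FinNorm (dsum F G) (target d τ F G b) := by
  refine finNorm_of_qf_le ?_ (h.left.integrable.mul_const ((∑' j, ‖b j‖) ^ 2)) ?_
  · exact (measurable_incr d τ).aestronglyMeasurable.smul
      (h.strMeas_inv.apply (h.left.strMeas.apply (continuous_symB hb).aestronglyMeasurable))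
  · filter_upwards [h.left.positive, h.right.positive, h.minimal.invertible] with t h1 h2 h3
    rw [target, qf_smul_right, norm_incr_sq, mul_assoc]
    refine mul_le_mul_of_nonneg_left ?_ (wt_nonneg _ _ _)
    rw [dsum, sumInv, qf_inverse (h1.add h2) h3]
    refine (qf_inverse_apply_le h1 h2 h3 _).trans ((qf_le_norm _ _).trans ?_)
    exact mul_le_mul_of_nonneg_left (pow_le_pow_left₀ (norm_nonneg _) (norm_symB_le hb t) 2)
      (norm_nonneg _)

theorem MinPair.comb_dualFamily (x : ℕ × ι →₀ ℂ) :
    comb (dualFamily d τ F G) x = emb (dsum F G) (lft d τ F G (symFin x)) := by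
  rw [symFin_eq, lft_sum, emb_sum h.isWeight h.finNorm_dual]
  rfl

theorem MinPair.finNorm_lft_symFin (x : ℕ × ι →₀ ℂ) :
    FinNorm (dsum F G) (lft d τ F G (symFin x)) := by
  rw [symFin_eq, lft_sum]
  exact FinNorm.sum h.isWeight h.finNorm_dual _ _

/-- The mean square error is a squared distance to the target, up to a constant. -/
theorem MinPair.lintegral_error {u : ℝ → H ι} (hu : AEStronglyMeasurable u circ)
    (hb : Summable fun j => ‖b j‖) :
    ∫⁻ l, (ENNReal.ofReal (qf (F l) (incr d τ l • symB b l - u l))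
      + ENNReal.ofReal (qf (G l) (u l))) ∂circ =
    wSq (dsum F G) (u - target d τ F G b) + ENNReal.ofReal (interpError d τ b F G) := by
  have hpos : ∀ᵐ t ∂circ, 0 ≤ wt d τ t * qf (parSum (F t) (G t)) (symB b t) :=
    h.ae_parSum.mono fun t ht => mul_nonneg (wt_nonneg _ _ _) (qf_nonneg ht.1 _)
  have hint : Integrable (fun t => wt d τ t * qf (parSum (F t) (G t)) (symB b t)) circ := by
    refine (h.left.integrable.mul_const ((∑' j, ‖b j‖) ^ 2)).mono' ?_ ?_
    · exact ((measurable_wt d τ).aemeasurable.mul (aemeasurable_qf h.strMeas_parSum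
        (continuous_symB hb).aestronglyMeasurable)).aestronglyMeasurable
    · filter_upwards [h.ae_parSum, hpos] with t h1 h2
      rw [Real.norm_of_nonneg h2, mul_assoc]
      refine mul_le_mul_of_nonneg_left ((qf_le_norm _ _).trans ?_) (wt_nonneg _ _ _)
      exact mul_le_mul h1.2 (pow_le_pow_left₀ (norm_nonneg _) (norm_symB_le hb t) 2)
        (by positivity) (norm_nonneg _)
  have hm : AEMeasurable (fun t => ENNReal.ofReal (qf (dsum F G t) ((u - target d τ F G b) t)))
      circ := (aemeasurable_qf h.isWeight.strMeas
    (hu.sub (h.finNorm_target hb).1)).ennreal_ofReal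
  rw [interpError, ofReal_integral_eq_lintegral_ofReal hint hpos, wSq, ← lintegral_add_left' hm]
  refine lintegral_congr_ae ?_
  filter_upwards [h.left.positive, h.right.positive, h.minimal.invertible, h.ae_parSum]
    with t h1 h2 h3 h4
  rw [← ENNReal.ofReal_add (qf_nonneg h1 _) (qf_nonneg h2 _), qf_sub_add_qf h1 h2 h3,
    ENNReal.ofReal_add (qf_nonneg (h1.add h2) _) (qf_nonneg h4.1 _), qf_smul_right, norm_incr_sq,
    map_smul, map_smul]
  rfl

end MinimalPair

end OptimalEstimate

/-! ## The operators `P_τ`, `R`, `Q_τ` of a minimal pair -/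

section BlockMatrices

variable {ι : Type*}

theorem exp_neg_eq_chr (m n : ℕ) (t : ℝ) :
    exp (-(I * t * ((m : ℂ) - n))) = chr (-m) t * chr n t := by
  rw [chr_mul, chr]; push_cast; ring_nf

theorem exp_eq_chr (m n : ℕ) (t : ℝ) :
    exp (I * t * ((m : ℂ) - n)) = chr m t * zc t ^ n := by
  rw [zc_pow, chr_mul, chr]; push_cast; ring_nf

theorem exp_neg_succ_eq_zc (m n : ℕ) (t : ℝ) :
    exp (-(I * t * ((m : ℂ) + 1 + n))) = zc t ^ n * zc t ^ (m + 1) := by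
  rw [← pow_add, zc_pow, chr]; push_cast; ring_nf

theorem conj_incr_mul (d τ : ℕ) (t : ℝ) :
    (incr d τ t)⁻¹ * ((starRingEnd ℂ) (incr d τ t))⁻¹ = (((wt d τ t)⁻¹ : ℝ) : ℂ) := by
  rw [ofReal_inv, ← mul_inv, mul_conj, normSq_eq_norm_sq, norm_incr_sq]

theorem mem_L20_add_iff {d τ : ℕ} {f g : ℝ → H ι →L[ℂ] H ι} {u : ℝ → H ι} :
    u ∈ L20 d τ (f + g) ↔ u ∈ obsClosure d τ (dsum (trn f) (trn g)) := by
  rw [mem_L20_iff]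
  simp only [Pi.add_apply, transp_add]
  rfl

theorem normSq_add (f g : ℝ → H ι →L[ℂ] H ι) (u : ℝ → H ι) : normSq (f + g) u = wSq (dsum (trn f) (trn g)) u := by
  rw [normSq_eq_wSq]
  simp only [Pi.add_apply, transp_add]
  rfl

variable [Countable ι] {d τ : ℕ} {b : ℕ → H ι} {f g : ℝ → H ι →L[ℂ] H ι}
  (h : MinPair d τ (trn f) (trn g)) (hb : Summable fun j => ‖b j‖)
include h

/-- One of the two factors `S⁻¹` cancels the weight of `L₂(S)`, and the scalars `w⁻¹` and `w̄⁻¹`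
combine to `wt⁻¹`. -/
theorem MinPair.matP_eq : matP d τ f g = gram (dualFamily d τ (trn f) (trn g)) := by
  funext p q
  rw [gram, dualFamily, dualFamily, inner_emb h.isWeight (h.finNorm_dual p) (h.finNorm_dual q),
    matP]
  refine integral_congr_ae ((h.dual_inner (u := lft d τ (trn f) (trn g) (dualMono q))
    (dualMono p)).mono fun t ht => Eq.trans ?_ ht.symm)
  beta_reduce
  rw [entry_eq_transp, ← sumInv_transpose, exp_neg_eq_chr, ← conj_incr_mul, lft, dualMono, dualMono,
    map_smul, inner_smul_left, inner_smul_right, inner_smul_right, conj_chr]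
  -- The shift `j + 1` of the dual monomials cancels in the difference of indices.
  have h1 : chr (-(p.1 : ℤ)) t * chr (q.1 : ℤ) t =
      chr (-((p.1 : ℤ) + 1)) t * chr ((q.1 : ℤ) + 1) t := by
    rw [chr_mul, chr_mul]; congr 1; ring
  rw [h1]
  ring

include hb in
-- In the coefficient of the target the factor `w` cancels, leaving a coefficient of `S⁻¹ F B`;
-- expanding `B` gives the row of `R`. The index `l + 1 + j` joins the dual shift to the frequency
-- of `b_j`.
theorem MinPair.app_matR (p : ℕ × ι) : app (matR f g) (stack b) p =
    inner ℂ (dualFamily d τ (trn f) (trn g) p)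
      (emb (dsum (trn f) (trn g)) (target d τ (trn f) (trn g) b)) := by
  have hV := h.positive_inv
  set V := sumInv (trn f) (trn g) with hVdef
  have hm : AEStronglyMeasurable (fun t => (starRingEnd ℂ) (zc t ^ (p.1 + 1)) • delta (ι := ι) p.2)
      circ := by
    have : Continuous fun t => (starRingEnd ℂ) (zc t ^ (p.1 + 1)) • delta (ι := ι) p.2 :=
      (Complex.continuous_conj.comp (continuous_zc.pow _)).smul continuous_const
    exact this.aestronglyMeasurable
  have hY := h.integrable_mul_inv hm fun t => by
    rw [norm_smul, RCLike.norm_conj, norm_pow, norm_zc, one_pow, norm_delta, one_mul]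
  have hinner : ∀ᵐ t ∂circ, ∀ x, inner ℂ (transp (f t) (V t ((starRingEnd ℂ) (zc t ^ (p.1 + 1)) •
      delta (ι := ι) p.2))) x = zc t ^ (p.1 + 1) * inner ℂ (delta p.2) (V t (transp (f t) x)) := by
    filter_upwards [hV, h.left.positive] with t h1 h2 x
    rw [map_smul, map_smul, inner_smul_left, starRingEnd_self_apply,
      h2.inner_left_eq_inner_right, h1.inner_left_eq_inner_right]
  have hsum := (hasSum_integral_symB hb hY).tsum_eq
  rw [h.inner_dualFamily (h.finNorm_target hb), app]
  refine Eq.trans (tsum_congr fun q => ?_) (hsum.trans ?_)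
  · congr 1
    refine integral_congr_ae (hinner.mono fun t ht => ?_)
    beta_reduce
    rw [ht, entry_eq_transp, transp_mul, ← sumInv_transpose, exp_neg_succ_eq_zc, mul_assoc]
    rfl
  · refine integral_congr_ae ?_
    filter_upwards [hinner, ae_incr_ne_zero d h.step] with t ht h1
    rw [ht, target, inv_smul_smul₀ h1, inner_delta]

include hb in
-- The product `f (f + g)⁻¹ g` transposes to the parallel sum of `fᵀ` and `gᵀ`. The expansion of `B`
-- is used twice, for each row and then for the outer sum.
theorem MinPair.tsum_matQ :
    (∑' p, app (matQ d τ f g) (stack b) p * star (stack b p)).re =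
      interpError d τ b (trn f) (trn g) := by
  set T := fun t => parSum (trn f t) (trn g t) with hT
  have hpos : ∀ᵐ t ∂circ, (T t).IsPositive := h.ae_parSum.mono fun _ ht => ht.1
  have hrow : ∀ p : ℕ × ι, app (matQ d τ f g) (stack b) p =
      ∫ t, chr p.1 t * ((wt d τ t : ℂ) * inner ℂ (delta p.2) (T t (symB b t))) ∂circ := by
    intro p
    have hm : AEStronglyMeasurable (fun t => zc t ^ p.1 • delta (ι := ι) p.2) circ := by
      have : Continuous fun t => zc t ^ p.1 • delta (ι := ι) p.2 :=
        (continuous_zc.pow _).smul continuous_const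
      exact this.aestronglyMeasurable
    have hY := h.integrable_parSum hm (K := 1) fun t => by
      rw [norm_smul, norm_pow, norm_zc, one_pow, norm_delta, one_mul]
    have hinner : ∀ᵐ t ∂circ, ∀ x, inner ℂ (((wt d τ t : ℝ) : ℂ) • T t (zc t ^ p.1 •
        delta (ι := ι) p.2)) x =
        chr p.1 t * ((wt d τ t : ℂ) * inner ℂ (delta p.2) (T t x)) := by
      filter_upwards [hpos] with t h1 x
      rw [map_smul, inner_smul_left, inner_smul_left, h1.inner_left_eq_inner_right, zc_pow,
        conj_chr, neg_neg, conj_ofReal]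
      ring
    rw [app]
    refine Eq.trans (tsum_congr fun q => ?_) ((hasSum_integral_symB hb hY).tsum_eq.trans ?_)
    · congr 1
      refine integral_congr_ae ?_
      filter_upwards [hinner, h.minimal.invertible] with t ht h1
      rw [ht, entry_eq_transp, transp_mul, transp_mul, ← sumInv_transpose, exp_eq_chr]
      simp only [hT]
      rw [← mul_inverse_mul_eq_parSum h1, mul_assoc (trn g t)]
      simp only [sumInv]
      ring
    · exact integral_congr_ae (hinner.mono fun t ht => ht _)
  have hZ := h.integrable_parSum (continuous_symB hb).aestronglyMeasurable (norm_symB_le hb)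
  have hsum := (hasSum_integral_symB hb hZ).map (starRingEnd ℂ) Complex.continuous_conj
  have hterm : ∀ p, app (matQ d τ f g) (stack b) p * star (stack b p) =
      (starRingEnd ℂ ∘ fun q : ℕ × ι => (∫ t, zc t ^ q.1 *
        inner ℂ (((wt d τ t : ℝ) : ℂ) • T t (symB b t)) (delta q.2) ∂circ) * stack b q) p := by
    intro p
    rw [Function.comp_apply, map_mul, hrow, ← integral_conj]
    congr 1
    refine integral_congr_ae (Eventually.of_forall fun t => ?_)
    beta_reduce
    rw [map_mul, inner_conj_symm, inner_smul_right, zc_pow, conj_chr, neg_neg]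
  simp only [hterm]
  rw [hsum.tsum_eq, conj_re, interpError]
  have hi := integrable_inner_symB hb hZ
  have h2 := integral_re hi
  refine Eq.trans h2.symm (integral_congr_ae (hpos.mono fun t ht => ?_))
  beta_reduce
  rw [inner_smul_left, conj_ofReal, ht.inner_left_eq_inner_right]
  exact re_ofReal_mul _ _

include hb in
-- The objective of the optimization problem is therefore single-valued on minimal pairs and equals
-- the optimal error.
theorem MinPair.hasValue_iff (v : ℝ) :
    HasValue d τ b f g v ↔ v = minError d τ b (trn f) (trn g) := by
  have hr : app (matR f g) (stack b) = fun p => inner ℂ (dualFamily d τ (trn f) (trn g) p)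
      (emb (dsum (trn f) (trn g)) (target d τ (trn f) (trn g) b)) := funext (h.app_matR hb)
  rw [HasValue, hr, h.matP_eq, h.tsum_matQ hb]
  simp only [hasInvForm_iff]
  constructor
  · rintro ⟨u, rfl, rfl⟩; rfl
  · rintro rfl; exact ⟨_, rfl, rfl⟩

include hb in
theorem MinPair.isSymbolC_iff (C : ℝ → H ι) : IsSymbolC d τ b f g C ↔
    AEStronglyMeasurable C circ ∧ FinNorm (dsum (trn f) (trn g)) (lft d τ (trn f) (trn g) C) ∧
      emb (dsum (trn f) (trn g)) (lft d τ (trn f) (trn g) C) = dualProj d τ b (trn f) (trn g) := by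
  have hr : app (matR f g) (stack b) = fun p => inner ℂ (dualFamily d τ (trn f) (trn g) p)
      (emb (dsum (trn f) (trn g)) (target d τ (trn f) (trn g) b)) := funext (h.app_matR hb)
  have hw : ∀ x : ℕ × ι →₀ ℂ, ∫⁻ l, ENNReal.ofReal
      ((wt d τ l)⁻¹ * quad (sumInv f g l) (C l - symFin x l)) ∂circ =
      wSq (dsum (trn f) (trn g))
        (lft d τ (trn f) (trn g) C - lft d τ (trn f) (trn g) (symFin x)) := by
    intro x
    rw [← lft_sub, h.wSq_lft]
    simp only [quad_eq_qf, ← sumInv_transpose]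
    rfl
  rw [IsSymbolC, hr, h.matP_eq]
  simp only [hw, convergesToInv_iff, h.comb_dualFamily]
  constructor
  · rintro ⟨hC, x, hx, hlim⟩
    have hfin : FinNorm (dsum (trn f) (trn g)) (lft d τ (trn f) (trn g) C) := by
      obtain ⟨n, hn⟩ := (hlim.eventually (gt_mem_nhds ENNReal.zero_lt_top)).exists
      have h1 : FinNorm (dsum (trn f) (trn g))
          (lft d τ (trn f) (trn g) C - lft d τ (trn f) (trn g) (symFin (x n))) :=
        ⟨(h.lft_aestronglyMeasurable hC).sub (h.finNorm_lft_symFin _).1, hn.ne⟩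
      simpa using h1.add h.isWeight (h.finNorm_lft_symFin (x n))
    exact ⟨hC, hfin, tendsto_nhds_unique
      ((tendsto_emb_iff h.isWeight (fun n => h.finNorm_lft_symFin (x n)) hfin).2 hlim) hx⟩
  · rintro ⟨hC, hfin, heq⟩
    obtain ⟨x, hx⟩ := exists_convergesToInv (dualFamily d τ (trn f) (trn g))
      (emb (dsum (trn f) (trn g)) (target d τ (trn f) (trn g) b))
    rw [convergesToInv_iff] at hx
    simp only [h.comb_dualFamily] at hx
    refine ⟨hC, x, hx, ?_⟩
    rw [← tendsto_emb_iff h.isWeight (fun n => h.finNorm_lft_symFin (x n)) hfin, heq]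
    exact hx

/-- Solve for `C`: with `C = w̄ S^{1/2} y`, `S^{1/2}` applied to the lifted function returns `y`, by
injectivity of `S^{1/2}`. Thus the limit defining `C` is attained by an actual function. -/
theorem MinPair.exists_lft_eq (y : Lp (H ι) 2 circ) : ∃ C, AEStronglyMeasurable C circ ∧
    FinNorm (dsum (trn f) (trn g)) (lft d τ (trn f) (trn g) C) ∧
      emb (dsum (trn f) (trn g)) (lft d τ (trn f) (trn g) C) = y := by
  set S := dsum (trn f) (trn g) with hS
  have hm : AEStronglyMeasurable (fun t => opSqrt (S t) (y t)) circ :=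
    (h.isWeight.strMeas.opSqrt h.isWeight.positive).apply (Lp.aestronglyMeasurable y)
  set C : ℝ → H ι := fun t => (starRingEnd ℂ) (incr d τ t) • opSqrt (S t) (y t) with hC
  have hCm : AEStronglyMeasurable C circ := by
    have h1 : AEStronglyMeasurable (fun l => (starRingEnd ℂ) (incr d τ l)) circ :=
      (Complex.continuous_conj.measurable.comp (measurable_incr d τ)).aestronglyMeasurable
    exact h1.smul hm
  have hrt : rt S (lft d τ (trn f) (trn g) C) =ᵐ[circ] y := by
    filter_upwards [h.isWeight.positive, h.minimal.invertible, ae_incr_ne_zero d h.step]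
      with t h1 h2 h3
    have h4 : lft d τ (trn f) (trn g) C t = Ring.inverse (S t) (opSqrt (S t) (y t)) := by
      rw [lft, hC]
      simp only [map_smul]
      rw [inv_smul_smul₀ (by simpa using h3)]
      rfl
    have hinj : ∀ x, opSqrt (S t) x = 0 → x = 0 := fun x hx => by
      rw [← inverse_apply_self h2 x]
      change Ring.inverse (S t) (S t x) = 0
      rw [← opSqrt_opSqrt_apply h1, hx, map_zero, map_zero]
    rw [rt, h4, ← sub_eq_zero]
    apply hinj
    rw [map_sub, opSqrt_opSqrt_apply h1, sub_eq_zero]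
    exact self_apply_inverse h2 _
  have hL : MemLp (rt S (lft d τ (trn f) (trn g) C)) 2 circ := (memLp_congr_ae hrt).2 (Lp.memLp y)
  have hfin : FinNorm S (lft d τ (trn f) (trn g) C) := by
    refine ⟨h.lft_aestronglyMeasurable hCm, ?_⟩
    rw [← norm_toLp_rt_sq h.isWeight.positive hL]
    exact ENNReal.ofReal_ne_top
  refine ⟨C, hCm, hfin, ?_⟩
  rw [emb_eq h.isWeight hfin]
  exact Lp.ext ((MemLp.coeFn_toLp _).trans hrt)

include hb in
theorem MinPair.exists_isSymbolC : ∃ C, IsSymbolC d τ b f g C := by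
  obtain ⟨C, hC⟩ := h.exists_lft_eq (dualProj d τ b (trn f) (trn g))
  exact ⟨C, (h.isSymbolC_iff hb C).2 hC⟩

theorem MinPair.finNorm_of_mem {u : ℝ → H ι} (hu : u ∈ obsClosure d τ (dsum (trn f) (trn g))) :
    FinNorm (dsum (trn f) (trn g)) u := ⟨hu.1, obsClosure_wSq_ne_top h.sum_density hu⟩

include hb in
/-- The spectral characteristic of the optimal estimate, and the error of the others. -/
theorem MinPair.spectralA_mem {C : ℝ → H ι} (hC : IsSymbolC d τ b f g C) :
    spectralA d τ b f g C ∈ L20 d τ (f + g) := by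
  obtain ⟨hCm, hfin, heq⟩ := (h.isSymbolC_iff hb C).1 hC
  rw [spectralA_eq, mem_L20_add_iff,
    h.mem_obsClosure_iff ((h.finNorm_target hb).sub h.isWeight hfin)]
  intro p
  rw [emb_sub h.isWeight (h.finNorm_target hb) hfin, heq]
  exact inner_sub_gproj _ _ p

include hb in
-- Pythagoras: `u - target` is the difference of `u - h⁰`, which lies in the observed span, and the
-- lift of `C`, which is orthogonal to it.
theorem MinPair.mse_eq_add {C : ℝ → H ι} (hC : IsSymbolC d τ b f g C) {u : ℝ → H ι}
    (hu : u ∈ L20 d τ (f + g)) : mse d τ b u f g =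
      ENNReal.ofReal (minError d τ b (trn f) (trn g)) +
        normSq (f + g) (u - spectralA d τ b f g C) := by
  obtain ⟨hCm, hfin, heq⟩ := (h.isSymbolC_iff hb C).1 hC
  have hs := mem_L20_add_iff.1 (h.spectralA_mem hb hC)
  have hu' := mem_L20_add_iff.1 hu
  have hW := h.isWeight
  have hsf := h.finNorm_of_mem hs
  have huf := h.finNorm_of_mem hu'
  have hd := huf.sub hW hsf
  set S := dsum (trn f) (trn g) with hS
  have h1 : u - target d τ (trn f) (trn g) b =
      (u - spectralA d τ b f g C) - lft d τ (trn f) (trn g) C := by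
    rw [spectralA_eq]; abel
  have horth : inner ℂ (emb S (lft d τ (trn f) (trn g) C))
      (emb S (u - spectralA d τ b f g C)) = 0 := by
    rw [heq]
    refine inner_eq_zero_of_mem_closedSpan (fun p => ?_) (gproj_mem _ _)
    rw [emb_sub hW huf hsf, inner_sub_right, (h.mem_obsClosure_iff huf).1 hu' p,
      (h.mem_obsClosure_iff hsf).1 hs p, sub_zero]
  have h2 : ‖emb S (u - target d τ (trn f) (trn g) b)‖ ^ 2 =
      ‖emb S (u - spectralA d τ b f g C)‖ ^ 2 + ‖dualProj d τ b (trn f) (trn g)‖ ^ 2 := by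
    rw [h1, emb_sub hW hd hfin, ← heq, @norm_sub_sq ℂ, ← inner_conj_symm, horth]
    simp
  have hc : 0 ≤ interpError d τ b (trn f) (trn g) :=
    integral_nonneg_of_ae (h.ae_parSum.mono fun t ht =>
      mul_nonneg (wt_nonneg _ _ _) (qf_nonneg ht.1 _))
  rw [mse_eq, h.lintegral_error huf.1 hb,
    ← norm_emb_sq hW (huf.sub hW (h.finNorm_target hb)), h2, normSq_add, ← norm_emb_sq hW hd,
    minError, ENNReal.ofReal_add (sq_nonneg _) (sq_nonneg _), ENNReal.ofReal_add (sq_nonneg _) hc]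
  ring

include hb in
theorem MinPair.mse_spectralA {C : ℝ → H ι} (hC : IsSymbolC d τ b f g C) :
    mse d τ b (spectralA d τ b f g C) f g =
      ENNReal.ofReal (minError d τ b (trn f) (trn g)) := by
  rw [h.mse_eq_add hb hC (h.spectralA_mem hb hC), sub_self]
  simp [normSq, quad]

include hb in
theorem MinPair.isOptimal {C : ℝ → H ι} (hC : IsSymbolC d τ b f g C) :
    IsOptimal d τ b f g (spectralA d τ b f g C) := by
  refine ⟨h.spectralA_mem hb hC, fun u hu => ?_⟩
  rw [h.mse_spectralA hb hC, h.mse_eq_add hb hC hu]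
  exact le_self_add

include hb in
theorem MinPair.optMse_eq : optMse d τ b f g = ENNReal.ofReal (minError d τ b (trn f) (trn g)) := by
  obtain ⟨C, hC⟩ := h.exists_isSymbolC hb
  refine le_antisymm ?_ (le_iInf₂ fun u hu => ?_)
  · exact (iInf₂_le _ (h.spectralA_mem hb hC)).trans (h.mse_spectralA hb hC).le
  · rw [h.mse_eq_add hb hC hu]
    exact le_self_add

end BlockMatrices

/-! ## Convex combinations of densities -/

section Mixtures

set_option linter.unusedSectionVars false

variable {ι : Type*}

/-- The convex combination `(1 - t) f₀ + t f`. -/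
def mix (t : ℝ) (f₀ f : ℝ → H ι →L[ℂ] H ι) (l : ℝ) : H ι →L[ℂ] H ι :=
  ((1 - t : ℝ) : ℂ) • f₀ l + (t : ℂ) • f l

theorem quad_mix (t : ℝ) (f₀ f : ℝ → H ι →L[ℂ] H ι) (l : ℝ) (x : H ι) :
    quad (mix t f₀ f l) x = (1 - t) * quad (f₀ l) x + t * quad (f l) x := by
  simp only [quad_eq_qf, mix, transp_add, transp_smul, qf_add_left, qf_real_smul_left]

theorem mix_add_mix (t : ℝ) (f₀ f g₀ g : ℝ → H ι →L[ℂ] H ι) :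
    mix t f₀ f + mix t g₀ g = mix t (f₀ + g₀) (f + g) := by
  funext l
  simp only [mix, Pi.add_apply, smul_add]
  abel

theorem quad_nonneg {A : H ι →L[ℂ] H ι} (hA : A.IsPositive) (x : H ι) : 0 ≤ quad A x := by
  rw [quad_eq_qf]
  exact qf_nonneg (isPositive_transp hA) x

theorem ofReal_quad_mix {t : ℝ} (ht0 : 0 ≤ t) (ht1 : t ≤ 1) {f₀ f : ℝ → H ι →L[ℂ] H ι} {l : ℝ}
    (h₀ : (f₀ l).IsPositive) (h : (f l).IsPositive) (x : H ι) :
    ENNReal.ofReal (quad (mix t f₀ f l) x) = ENNReal.ofReal (1 - t) * ENNReal.ofReal (quad (f₀ l) x)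
      + ENNReal.ofReal t * ENNReal.ofReal (quad (f l) x) := by
  have h1 : 0 ≤ 1 - t := by linarith
  rw [quad_mix, ENNReal.ofReal_add (mul_nonneg h1 (quad_nonneg h₀ x))
    (mul_nonneg ht0 (quad_nonneg h x)), ENNReal.ofReal_mul h1, ENNReal.ofReal_mul ht0]

theorem IsSpectralDensity.aemeasurable_quad {d τ : ℕ} {f : ℝ → H ι →L[ℂ] H ι}
    (hf : IsSpectralDensity d τ f) {u : ℝ → H ι} (hu : AEStronglyMeasurable u circ) :
    AEMeasurable (fun l => ENNReal.ofReal (quad (f l) (u l))) circ := by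
  simp only [quad_eq_qf]
  exact (aemeasurable_qf hf.transpose.strMeas hu).ennreal_ofReal

/-- A larger density has a stronger norm, hence a smaller closure of the same polynomials. -/
theorem L20_subset_of_quad_le {d τ : ℕ} {S S' : ℝ → H ι →L[ℂ] H ι} {r : ℝ} (hr : 0 < r)
    (hle : ∀ᵐ l ∂circ, ∀ x, r * quad (S l) x ≤ quad (S' l) x) : L20 d τ S' ⊆ L20 d τ S := by
  intro h hh
  rw [mem_L20_iff] at hh ⊢
  refine obsClosure_mono (K := ENNReal.ofReal r⁻¹) ENNReal.ofReal_ne_top (fun u => ?_) hh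
  rw [wSq, wSq, ← lintegral_const_mul' _ _ ENNReal.ofReal_ne_top]
  refine lintegral_mono_ae (hle.mono fun l h1 => ?_)
  rw [← ENNReal.ofReal_mul (inv_nonneg.2 hr.le), ← quad_eq_qf, ← quad_eq_qf]
  refine ENNReal.ofReal_le_ofReal ?_
  rw [inv_mul_eq_div, le_div_iff₀ hr, mul_comm]
  exact h1 _

theorem normSq_sub_comm (S : ℝ → H ι →L[ℂ] H ι) (g h : ℝ → H ι) :
    normSq S (g - h) = normSq S (h - g) := by
  rw [normSq_eq_wSq, normSq_eq_wSq, wSq_sub_comm]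

theorem normSq_zero (S : ℝ → H ι →L[ℂ] H ι) : normSq S (0 : ℝ → H ι) = 0 := by
  simp [normSq, quad]

theorem L20_congr {d τ : ℕ} {S : ℝ → H ι →L[ℂ] H ι} {g h : ℝ → H ι} (hg : g ∈ L20 d τ S)
    (hgh : g =ᵐ[circ] h) : h ∈ L20 d τ S := by
  rw [mem_L20_iff] at hg ⊢
  exact obsClosure_congr hg hgh

theorem mse_congr (d τ : ℕ) (b : ℕ → H ι) (f g : ℝ → H ι →L[ℂ] H ι) {u v : ℝ → H ι}
    (huv : u =ᵐ[circ] v) : mse d τ b u f g = mse d τ b v f g :=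
  lintegral_congr_ae (huv.mono fun l hl => by simp only [hl])

variable [Countable ι] {d τ : ℕ}

theorem IsSpectralDensity.mix {t : ℝ} (ht0 : 0 ≤ t) (ht1 : t ≤ 1) {f₀ f : ℝ → H ι →L[ℂ] H ι}
    (h₀ : IsSpectralDensity d τ f₀) (h : IsSpectralDensity d τ f) :
    IsSpectralDensity d τ (mix t f₀ f) :=
  (h₀.smul (sub_nonneg.2 ht1)).add (h.smul ht0)

theorem IsSpectralDensity.add' {f g : ℝ → H ι →L[ℂ] H ι} (hf : IsSpectralDensity d τ f)
    (hg : IsSpectralDensity d τ g) : IsSpectralDensity d τ (f + g) := hf.add hg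

theorem normSq_mix {t : ℝ} (ht0 : 0 ≤ t) (ht1 : t ≤ 1) {f₀ f : ℝ → H ι →L[ℂ] H ι}
    (h₀ : IsSpectralDensity d τ f₀) (h : IsSpectralDensity d τ f) {u : ℝ → H ι}
    (hu : AEStronglyMeasurable u circ) : normSq (mix t f₀ f) u =
      ENNReal.ofReal (1 - t) * normSq f₀ u + ENNReal.ofReal t * normSq f u := by
  have hm₀ := h₀.aemeasurable_quad hu
  have hm := h.aemeasurable_quad hu
  rw [normSq, normSq, normSq, ← lintegral_const_mul'' _ hm₀, ← lintegral_const_mul'' _ hm,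
    ← lintegral_add_left' (hm₀.const_mul _)]
  refine lintegral_congr_ae ?_
  filter_upwards [h₀.positive, h.positive] with l h1 h2 using ofReal_quad_mix ht0 ht1 h1 h2 _

theorem mse_mix {b : ℕ → H ι} (hb : Summable fun j => ‖b j‖) {t : ℝ} (ht0 : 0 ≤ t) (ht1 : t ≤ 1)
    {f₀ f g₀ g : ℝ → H ι →L[ℂ] H ι} (hf₀ : IsSpectralDensity d τ f₀)
    (hf : IsSpectralDensity d τ f) (hg₀ : IsSpectralDensity d τ g₀) (hg : IsSpectralDensity d τ g)
    {u : ℝ → H ι} (hu : AEStronglyMeasurable u circ) :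
    mse d τ b u (mix t f₀ f) (mix t g₀ g) =
      ENNReal.ofReal (1 - t) * mse d τ b u f₀ g₀ + ENNReal.ofReal t * mse d τ b u f g := by
  have hv : AEStronglyMeasurable (fun l => incr d τ l • symB b l - u l) circ :=
    ((measurable_incr d τ).aestronglyMeasurable.smul
      (continuous_symB hb).aestronglyMeasurable).sub hu
  have hm₀ := (hf₀.aemeasurable_quad hv).fun_add (hg₀.aemeasurable_quad hu)
  have hm := (hf.aemeasurable_quad hv).fun_add (hg.aemeasurable_quad hu)
  rw [mse, mse, mse, ← lintegral_const_mul'' _ hm₀, ← lintegral_const_mul'' _ hm,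
    ← lintegral_add_left' (hm₀.const_mul _)]
  refine lintegral_congr_ae ?_
  filter_upwards [hf₀.positive, hf.positive, hg₀.positive, hg.positive] with l h1 h2 h3 h4
  rw [ofReal_quad_mix ht0 ht1 h1 h2, ofReal_quad_mix ht0 ht1 h3 h4]
  ring

/-- The mixed sum dominates `(1 - t)(f₀ + g₀)`, so its inverse has norm at most `(1 - t)⁻¹ ‖(f₀ +
g₀)⁻¹‖`. The second pair need not be minimal. -/
theorem Minimality.mix {t : ℝ} (ht0 : 0 ≤ t) (ht1 : t < 1) {f₀ f g₀ g : ℝ → H ι →L[ℂ] H ι}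
    (hf₀ : IsSpectralDensity d τ f₀)
    (hf : IsSpectralDensity d τ f) (hg₀ : IsSpectralDensity d τ g₀) (hg : IsSpectralDensity d τ g)
    (hmin : Minimality d τ f₀ g₀) :
    Minimality d τ (MinimaxFilter.mix t f₀ f) (MinimaxFilter.mix t g₀ g) := by
  have h1t : 0 < 1 - t := by linarith
  have hS := (hf₀.mix ht0 ht1.le hf).add (hg₀.mix ht0 ht1.le hg)
  have key : ∀ᵐ l ∂circ, IsUnit (MinimaxFilter.mix t f₀ f l + MinimaxFilter.mix t g₀ g l) ∧
      ‖sumInv (MinimaxFilter.mix t f₀ f) (MinimaxFilter.mix t g₀ g) l‖ ≤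
        (1 - t)⁻¹ * ‖sumInv f₀ g₀ l‖ := by
    filter_upwards [hf₀.positive, hf.positive, hg₀.positive, hg.positive, hmin.invertible,
      hS.positive] with l h1 h2 h3 h4 h5 h6
    have hle : ∀ x, ‖x‖ ^ 2 ≤ ((1 - t)⁻¹ * ‖sumInv f₀ g₀ l‖) *
        qf (MinimaxFilter.mix t f₀ f l + MinimaxFilter.mix t g₀ g l) x := fun x => by
      have h7 := norm_sq_le_inverse (h1.add h3) h5 x
      have h8 : (1 - t) * qf (f₀ l + g₀ l) x ≤
          qf (MinimaxFilter.mix t f₀ f l + MinimaxFilter.mix t g₀ g l) x := by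
        simp only [MinimaxFilter.mix, qf_add_left, qf_real_smul_left]
        have h9 := mul_nonneg ht0 (qf_nonneg h2 x)
        have h10 := mul_nonneg ht0 (qf_nonneg h4 x)
        linarith
      calc ‖x‖ ^ 2 ≤ ‖sumInv f₀ g₀ l‖ * qf (f₀ l + g₀ l) x := h7
        _ = ((1 - t)⁻¹ * ‖sumInv f₀ g₀ l‖) * ((1 - t) * qf (f₀ l + g₀ l) x) := by
          field_simp
        _ ≤ _ := mul_le_mul_of_nonneg_left h8 (by positivity)
    have hu := isUnit_of_bound h6 hle
    exact ⟨hu, norm_inverse_le_of_bound (by positivity) hu hle⟩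
  refine ⟨key.mono fun l hl => hl.1, ?_⟩
  have hinv := hS.strMeas.inverse hS.positive (key.mono fun l hl => hl.1)
  refine (hmin.integrable.const_mul (1 - t)⁻¹).mono' ?_ (key.mono fun l hl => ?_)
  · exact ((measurable_wt d τ).inv.aemeasurable.mul hinv.norm).aestronglyMeasurable
  · rw [norm_mul, norm_norm, norm_inv, Real.norm_of_nonneg (wt_nonneg _ _ _),
      mul_left_comm]
    exact mul_le_mul_of_nonneg_left hl.2 (inv_nonneg.2 (wt_nonneg _ _ _))

end Mixtures

/-! ## The saddle point -/

section SaddlePoint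

set_option linter.unusedSectionVars false

variable {ι : Type*} [Countable ι]

theorem MinPair.of_minimality {d τ : ℕ} (hτ : 0 < τ) {f g : ℝ → H ι →L[ℂ] H ι}
    (hf : IsSpectralDensity d τ f) (hg : IsSpectralDensity d τ g) (h : Minimality d τ f g) :
    MinPair d τ (trn f) (trn g) := ⟨hτ, hf.transpose, hg.transpose, h.transpose⟩

theorem toReal_mix_identity {t m : ℝ} (ht0 : 0 < t) (ht1 : t < 1) (hm : 0 ≤ m) {A B a b : ℝ≥0∞}
    (hA : A ≠ ⊤) (hB : B ≠ ⊤)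
    (h : ENNReal.ofReal (1 - t) * A + ENNReal.ofReal t * B =
      ENNReal.ofReal m + (ENNReal.ofReal (1 - t) * a + ENNReal.ofReal t * b)) :
    a ≠ ⊤ ∧ b ≠ ⊤ ∧
      (1 - t) * A.toReal + t * B.toReal = m + ((1 - t) * a.toReal + t * b.toReal) := by
  have h1 : 0 < 1 - t := by linarith
  have hL : ENNReal.ofReal (1 - t) * A + ENNReal.ofReal t * B ≠ ⊤ :=
    ENNReal.add_ne_top.2 ⟨ENNReal.mul_ne_top ENNReal.ofReal_ne_top hA,
      ENNReal.mul_ne_top ENNReal.ofReal_ne_top hB⟩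
  have hR := hL
  rw [h, ENNReal.add_ne_top, ENNReal.add_ne_top] at hR
  obtain ⟨-, hRa, hRb⟩ := hR
  have ha : a ≠ ⊤ := fun h2 => hRa (by
    rw [h2, ENNReal.mul_top (by simpa using h1)])
  have hb : b ≠ ⊤ := fun h2 => hRb (by
    rw [h2, ENNReal.mul_top (by simpa using ht0)])
  refine ⟨ha, hb, ?_⟩
  have h3 := congrArg ENNReal.toReal h
  rw [ENNReal.toReal_add (ENNReal.add_ne_top.1 hL).1 (ENNReal.add_ne_top.1 hL).2,
    ENNReal.toReal_add ENNReal.ofReal_ne_top (ENNReal.add_ne_top.2 ⟨hRa, hRb⟩),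
    ENNReal.toReal_add hRa hRb, ENNReal.toReal_mul, ENNReal.toReal_mul, ENNReal.toReal_mul,
    ENNReal.toReal_mul, ENNReal.toReal_ofReal h1.le, ENNReal.toReal_ofReal ht0.le,
    ENNReal.toReal_ofReal hm] at h3
  exact h3

/-- `A, B` are the errors at the two pairs of the optimum for weight `t`, `A', B'` those for `s`;
`a, b` are their squared distances in the two norms. Weights `1 - s` and `1 - t` eliminate `A' - A`,
and the resulting coefficient of `b` is at least `t - s`. -/
theorem le_sub_of_mix_identities {t s A A' B B' a b M N : ℝ} (hs0 : 0 < s) (hst : s < t)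
    (ht1 : t < 1) (ha : 0 ≤ a) (hb : 0 ≤ b)
    (h1 : (1 - t) * A' + t * B' = M + ((1 - t) * a + t * b)) (h2 : (1 - t) * A + t * B = M)
    (h3 : (1 - s) * A + s * B = N + ((1 - s) * a + s * b)) (h4 : (1 - s) * A' + s * B' = N) :
    b ≤ B' - B := by
  have h5 : (t - s) * (B' - B) =
      2 * ((1 - t) * (1 - s) * a) + (t * (1 - s) + s * (1 - t)) * b := by
    linear_combination (1 - s) * h1 - (1 - s) * h2 + (1 - t) * h3 - (1 - t) * h4
  have h6 : 0 ≤ (1 - t) * (1 - s) * a := by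
    have : 0 ≤ 1 - t := by linarith
    have : 0 ≤ 1 - s := by linarith
    positivity
  have h7 : (t - s) * b ≤ (t * (1 - s) + s * (1 - t)) * b := by
    refine mul_le_mul_of_nonneg_right ?_ hb
    nlinarith [mul_pos hs0 (show 0 < 1 - t by linarith)]
  exact le_of_mul_le_mul_left (by linarith) (show 0 < t - s by linarith)

theorem minError_nonneg {d τ : ℕ} (b : ℕ → H ι) {F G : ℝ → H ι →L[ℂ] H ι}
    (h : MinPair d τ F G) : 0 ≤ minError d τ b F G :=
  add_nonneg (sq_nonneg _) (integral_nonneg_of_ae (h.ae_parSum.mono fun _ ht =>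
    mul_nonneg (wt_nonneg _ _ _) (qf_nonneg ht.1 _)))

variable {d τ : ℕ} (hτ : 0 < τ) {b : ℕ → H ι} (hb : Summable fun j => ‖b j‖)
  {f₀ g₀ f g : ℝ → H ι →L[ℂ] H ι} (hf₀ : IsSpectralDensity d τ f₀)
  (hg₀ : IsSpectralDensity d τ g₀) (hf : IsSpectralDensity d τ f) (hg : IsSpectralDensity d τ g)
  (hmin : Minimality d τ f₀ g₀)
include hτ hb hf₀ hg₀ hf hg hmin

/-- The Pythagorean identity of the mixed pair, with both sides expanded linearly in the densities.
-/
theorem exists_optimal_mix {t : ℝ} (ht0 : 0 < t) (ht1 : t < 1) :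
    ∃ u ∈ L20 d τ (mix t f₀ f + mix t g₀ g), ∀ v ∈ L20 d τ (mix t f₀ f + mix t g₀ g),
      ENNReal.ofReal (1 - t) * mse d τ b v f₀ g₀ + ENNReal.ofReal t * mse d τ b v f g =
      ENNReal.ofReal (minError d τ b (trn (mix t f₀ f)) (trn (mix t g₀ g))) +
        (ENNReal.ofReal (1 - t) * normSq (f₀ + g₀) (v - u) +
          ENNReal.ofReal t * normSq (f + g) (v - u)) := by
  have h := MinPair.of_minimality hτ (hf₀.mix ht0.le ht1.le hf) (hg₀.mix ht0.le ht1.le hg)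
    (hmin.mix ht0.le ht1 hf₀ hf hg₀ hg)
  obtain ⟨C, hC⟩ := h.exists_isSymbolC hb
  refine ⟨_, h.spectralA_mem hb hC, fun v hv => ?_⟩
  rw [← mse_mix hb ht0.le ht1.le hf₀ hf hg₀ hg hv.1, h.mse_eq_add hb hC hv, mix_add_mix,
    normSq_mix ht0.le ht1.le (hf₀.add' hg₀) (hf.add' hg)
      (hv.1.sub (h.spectralA_mem hb hC).1)]

omit hτ hb hmin in
theorem ae_quad_add_nonneg : ∀ᵐ l ∂circ, ∀ x, 0 ≤ quad ((f₀ + g₀) l) x ∧ 0 ≤ quad ((f + g) l) x := by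
  filter_upwards [(hf₀.add' hg₀).positive, (hf.add' hg).positive] with l h1 h2 x
  exact ⟨quad_nonneg h1 x, quad_nonneg h2 x⟩

/-- The optimal estimate of the least favourable pair is a saddle point. -/
theorem saddle_point (hmax : ∀ t : ℝ, 0 < t → t < 1 →
      minError d τ b (trn (mix t f₀ f)) (trn (mix t g₀ g)) ≤ minError d τ b (trn f₀) (trn g₀))
    {C : ℝ → H ι} (hC : IsSymbolC d τ b f₀ g₀ C) :
    spectralA d τ b f₀ g₀ C ∈ L20 d τ (f + g) ∧
      mse d τ b (spectralA d τ b f₀ g₀ C) f g ≤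
        ENNReal.ofReal (minError d τ b (trn f₀) (trn g₀)) := by
  have h₀ := MinPair.of_minimality hτ hf₀ hg₀ hmin
  set v₀ := minError d τ b (trn f₀) (trn g₀) with hv₀
  set h0 := spectralA d τ b f₀ g₀ C with hh0
  have hv₀0 : 0 ≤ v₀ := minError_nonneg b h₀
  have hh0m := h₀.spectralA_mem hb hC
  have hq := ae_quad_add_nonneg hf₀ hg₀ hf hg
  -- The mixed density dominates a positive multiple of each of the two, so its admissible functions
  -- are admissible for both.
  have hsub : ∀ {t : ℝ}, 0 < t → t < 1 → L20 d τ (mix t f₀ f + mix t g₀ g) ⊆ L20 d τ (f₀ + g₀) ∧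
      L20 d τ (mix t f₀ f + mix t g₀ g) ⊆ L20 d τ (f + g) := fun {t} ht0 ht1 => by
    rw [mix_add_mix]
    refine ⟨L20_subset_of_quad_le (sub_pos.2 ht1) (hq.mono fun l hl x => ?_),
      L20_subset_of_quad_le ht0 (hq.mono fun l hl x => ?_)⟩
    · rw [quad_mix]; linarith [mul_nonneg ht0.le (hl x).2]
    · rw [quad_mix]; linarith [mul_nonneg (sub_pos.2 ht1).le (hl x).1]
  -- Any two proper mixtures have comparable norms, hence the same admissible functions; `(1 - s) s`
  -- is a convenient common constant.
  have hsub' : ∀ {t s : ℝ}, 0 < t → t < 1 → 0 < s → s < 1 →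
      L20 d τ (mix s f₀ f + mix s g₀ g) ⊆ L20 d τ (mix t f₀ f + mix t g₀ g) :=
      fun {t s} ht0 ht1 hs0 hs1 => by
    have ht : 0 < 1 - t := by linarith
    have hs : 0 < 1 - s := by linarith
    rw [mix_add_mix, mix_add_mix]
    refine L20_subset_of_quad_le (r := (1 - s) * s) (by positivity) (hq.mono fun l hl x => ?_)
    rw [quad_mix, quad_mix]
    obtain ⟨h1, h2⟩ := hl x
    have h3 : (1 - s) * s * (1 - t) ≤ 1 - s := by nlinarith [mul_pos ht hs, mul_pos hs0 hs]
    have h4 : (1 - s) * s * t ≤ s := by nlinarith [mul_pos hs0 hs, mul_pos hs0 ht0]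
    nlinarith [mul_le_mul_of_nonneg_right h3 h1, mul_le_mul_of_nonneg_right h4 h2]
  -- Geometric decay makes the squared distances to `h0` summable, so no subsequence is needed for
  -- convergence almost everywhere; the shift keeps `t ≤ 1/2`.
  set t : ℕ → ℝ := fun n => (1 / 2) ^ (n + 1) with htdef
  have ht0 : ∀ n, 0 < t n := fun n => by positivity
  have ht2 : ∀ n, t n ≤ 1 / 2 := fun n => by
    rw [htdef]
    simp only [pow_succ]
    have : ((1 : ℝ) / 2) ^ n ≤ 1 := pow_le_one₀ (by norm_num) (by norm_num)
    linarith
  have ht1 : ∀ n, t n < 1 := fun n => (ht2 n).trans_lt (by norm_num)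
  have htlt : ∀ {m n}, m < n → t n < t m := fun {m n} hmn =>
    pow_lt_pow_right_of_lt_one₀ (by norm_num) (by norm_num) (by omega)
  choose u hu hid using fun n => exists_optimal_mix hτ hb hf₀ hg₀ hf hg hmin (ht0 n) (ht1 n)
  have hu0 : ∀ n, u n ∈ L20 d τ (f₀ + g₀) := fun n => (hsub (ht0 n) (ht1 n)).1 (hu n)
  have hu1 : ∀ n, u n ∈ L20 d τ (f + g) := fun n => (hsub (ht0 n) (ht1 n)).2 (hu n)
  have hA : ∀ n, mse d τ b (u n) f₀ g₀ = ENNReal.ofReal v₀ + normSq (f₀ + g₀) (u n - h0) :=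
    fun n => h₀.mse_eq_add hb hC (hu0 n)
  have hself : ∀ n, ENNReal.ofReal (1 - t n) * mse d τ b (u n) f₀ g₀ +
      ENNReal.ofReal (t n) * mse d τ b (u n) f g ≤ ENNReal.ofReal v₀ := fun n => by
    rw [hid n _ (hu n), sub_self, normSq_zero, normSq_zero]
    simpa using ENNReal.ofReal_le_ofReal (hmax _ (ht0 n) (ht1 n))
  have hAfin : ∀ n, mse d τ b (u n) f₀ g₀ ≠ ⊤ := fun n htop => by
    have h1 := hself n
    rw [htop, ENNReal.mul_top (by simpa using ht1 n), top_add] at h1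
    exact ENNReal.ofReal_ne_top (top_le_iff.1 h1)
  have hBfin : ∀ n, mse d τ b (u n) f g ≠ ⊤ := fun n htop => by
    have h1 := hself n
    rw [htop, ENNReal.mul_top (by simpa using ht0 n), add_top] at h1
    exact ENNReal.ofReal_ne_top (top_le_iff.1 h1)
  have hafin : ∀ n, normSq (f₀ + g₀) (u n - h0) ≠ ⊤ := fun n htop => by
    have h1 := hAfin n
    rw [hA, htop, add_top] at h1
    exact h1 rfl
  have hAr : ∀ n, (mse d τ b (u n) f₀ g₀).toReal = v₀ + (normSq (f₀ + g₀) (u n - h0)).toReal :=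
    fun n => by
      rw [hA, ENNReal.toReal_add ENNReal.ofReal_ne_top (hafin n), ENNReal.toReal_ofReal hv₀0]
  have hselfr : ∀ n, (1 - t n) * (mse d τ b (u n) f₀ g₀).toReal +
      t n * (mse d τ b (u n) f g).toReal =
      minError d τ b (trn (mix (t n) f₀ f)) (trn (mix (t n) g₀ g)) := fun n => by
    have hm := minError_nonneg b (MinPair.of_minimality hτ (hf₀.mix (ht0 n).le (ht1 n).le hf)
      (hg₀.mix (ht0 n).le (ht1 n).le hg) (hmin.mix (ht0 n).le (ht1 n) hf₀ hf hg₀ hg))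
    have h1 := (toReal_mix_identity (ht0 n) (ht1 n) hm (hAfin n) (hBfin n)
      (hid n _ (hu n))).2.2
    rw [h1, sub_self, normSq_zero, normSq_zero]
    simp
  -- The mixed error is at most `v₀` while its share from `(f₀, g₀)` is at least `(1 - t) v₀`, so
  -- the error at `(f, g)` is at most `v₀`.
  have hBle : ∀ n, (mse d τ b (u n) f g).toReal ≤ v₀ := fun n => by
    have h1 := hselfr n
    have h2 := hmax _ (ht0 n) (ht1 n)
    rw [hAr] at h1
    have h3 : 0 ≤ (1 - t n) * (normSq (f₀ + g₀) (u n - h0)).toReal :=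
      mul_nonneg (by linarith [ht1 n]) ENNReal.toReal_nonneg
    refine le_of_mul_le_mul_left ?_ (ht0 n)
    nlinarith
  -- The same inequality, now dropping the error at `(f, g)`: the excess at `(f₀, g₀)` satisfies `(1
  -- - t) a ≤ t v₀`, and `t ≤ 1/2` gives `a ≤ 2 t v₀`.
  have hale : ∀ n, normSq (f₀ + g₀) (u n - h0) ≤ ENNReal.ofReal (v₀ * (1 / 2) ^ n) := fun n => by
    rw [← ENNReal.ofReal_toReal (hafin n)]
    refine ENNReal.ofReal_le_ofReal ?_
    have h1 := hselfr n
    have h2 := hmax _ (ht0 n) (ht1 n)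
    rw [hAr] at h1
    have h3 : 0 ≤ t n * (mse d τ b (u n) f g).toReal :=
      mul_nonneg (ht0 n).le ENNReal.toReal_nonneg
    have h4 : t n = (1 / 2) ^ n * (1 / 2) := pow_succ _ _
    have h5 : 0 ≤ (1 / 2 - t n) * (normSq (f₀ + g₀) (u n - h0)).toReal :=
      mul_nonneg (by linarith [ht2 n]) ENNReal.toReal_nonneg
    have h6 : (1 - t n) * (normSq (f₀ + g₀) (u n - h0)).toReal ≤ t n * v₀ := by linarith
    rw [h4] at h6 h5
    nlinarith
  -- The optimality identity of each mixture is evaluated at the optimum of the other one.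
  have hinc : ∀ {m n}, m < n → normSq (f + g) (u n - u m) ≠ ⊤ ∧
      (normSq (f + g) (u n - u m)).toReal ≤
        (mse d τ b (u n) f g).toReal - (mse d τ b (u m) f g).toReal := fun {m n} hmn => by
    have hm := fun n => minError_nonneg b (MinPair.of_minimality hτ
      (hf₀.mix (ht0 n).le (ht1 n).le hf) (hg₀.mix (ht0 n).le (ht1 n).le hg)
      (hmin.mix (ht0 n).le (ht1 n) hf₀ hf hg₀ hg))
    obtain ⟨ha, hb', h1⟩ := toReal_mix_identity (ht0 m) (ht1 m) (hm m) (hAfin n) (hBfin n)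
      (hid m _ (hsub' (ht0 m) (ht1 m) (ht0 n) (ht1 n) (hu n)))
    obtain ⟨-, -, h3⟩ := toReal_mix_identity (ht0 n) (ht1 n) (hm n) (hAfin m) (hBfin m)
      (hid n _ (hsub' (ht0 n) (ht1 n) (ht0 m) (ht1 m) (hu m)))
    rw [normSq_sub_comm, normSq_sub_comm (f + g)] at h3
    exact ⟨hb', le_sub_of_mix_identities (ht0 n) (htlt hmn) (ht1 m) ENNReal.toReal_nonneg
      ENNReal.toReal_nonneg h1 (hselfr m) h3 (hselfr n)⟩
  -- The sum of the squared distances is integrable, hence finite almost everywhere; invertibility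
  -- of `f₀ + g₀` turns this into convergence of vectors.
  have hlim : ∀ᵐ l ∂circ, Tendsto (fun n => u n l) atTop (𝓝 (h0 l)) := by
    have h1 : ∫⁻ l, ∑' n, ENNReal.ofReal (quad ((f₀ + g₀) l) ((u n - h0) l)) ∂circ ≠ ⊤ := by
      rw [lintegral_tsum fun n => (hf₀.add' hg₀).aemeasurable_quad ((hu n).1.sub hh0m.1)]
      refine ne_top_of_le_ne_top ?_ (ENNReal.tsum_le_tsum hale)
      have h2 : Summable fun n => v₀ * (1 / 2 : ℝ) ^ n :=
        (summable_geometric_of_lt_one (by norm_num) (by norm_num)).mul_left _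
      rw [← ENNReal.ofReal_tsum_of_nonneg (fun n => by positivity) h2]
      exact ENNReal.ofReal_ne_top
    have h2 := ae_lt_top' (AEMeasurable.tsum fun n =>
      (hf₀.add' hg₀).aemeasurable_quad ((hu n).1.sub hh0m.1)) h1
    filter_upwards [h2, (hf₀.add' hg₀).positive, hmin.invertible] with l h3 h4 h5
    have h6 := ENNReal.tendsto_atTop_zero_of_tsum_ne_top h3.ne
    have h7 : Tendsto (fun n => quad ((f₀ + g₀) l) ((u n - h0) l)) atTop (𝓝 0) := by
      have h8 := (ENNReal.tendsto_toReal ENNReal.zero_ne_top).comp h6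
      refine h8.congr fun n => ENNReal.toReal_ofReal (quad_nonneg h4 _)
    have h8 : ∀ n, ‖u n l - h0 l‖ ≤ √(‖Ring.inverse (transp ((f₀ + g₀) l))‖ *
        quad ((f₀ + g₀) l) ((u n - h0) l)) := fun n => by
      refine Real.le_sqrt_of_sq_le ?_
      rw [quad_eq_qf]
      exact norm_sq_le_inverse (isPositive_transp h4) (isUnit_transp h5) _
    rw [tendsto_iff_norm_sub_tendsto_zero]
    refine squeeze_zero (fun n => norm_nonneg _) h8 ?_
    have h9 := (Real.continuous_sqrt.tendsto _).comp
      (h7.const_mul ‖Ring.inverse (transp ((f₀ + g₀) l))‖)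
    rwa [mul_zero, Real.sqrt_zero] at h9
  have hcont : ∀ A : H ι →L[ℂ] H ι, Continuous fun x => ENNReal.ofReal (quad A x) := fun A => by
    unfold quad
    have h1 : Continuous fun x : H ι => star x := continuous_star
    exact ENNReal.continuous_ofReal.comp
      (Complex.continuous_re.comp (h1.inner (A.continuous.comp h1)))
  constructor
  -- The errors at `(f, g)` increase and are bounded, and their increments bound squared distances
  -- in `L₂(f + g)`, so the sequence is Cauchy there. Fatou's lemma with the pointwise limit
  -- identifies `h0` as the limit, without invertibility of `f + g`.
  · have hmono : Monotone fun n => (mse d τ b (u n) f g).toReal :=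
      monotone_nat_of_le_succ fun n => by
        have := (hinc (Nat.lt_succ_self n)).2
        have h2 : 0 ≤ (normSq (f + g) (u n.succ - u n)).toReal := ENNReal.toReal_nonneg
        simp only [Nat.succ_eq_add_one] at this h2
        linarith
    have hconv := tendsto_atTop_ciSup hmono ⟨v₀, by rintro _ ⟨n, rfl⟩; exact hBle n⟩
    rw [mem_L20_iff]
    have hS := (hf.add' hg)
    refine obsClosure_of_limit hS.transpose.strMeas hS.transpose.positive hh0m.1 fun ε hε => ?_
    obtain ⟨δ, hδ, hδε⟩ : ∃ δ : ℝ, 0 < δ ∧ ENNReal.ofReal δ ≤ ε := by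
      rcases eq_or_ne ε ⊤ with rfl | htop
      · exact ⟨1, one_pos, le_top⟩
      · exact ⟨ε.toReal, ENNReal.toReal_pos hε htop, by rw [ENNReal.ofReal_toReal htop]⟩
    obtain ⟨N, hN⟩ := Metric.cauchySeq_iff'.1 hconv.cauchySeq δ hδ
    refine ⟨u N, mem_L20_iff.1 (hu1 N), le_trans ?_ hδε⟩
    rw [← normSq_eq_wSq]
    have hF : normSq (f + g) (h0 - u N) ≤
        liminf (fun n => normSq (f + g) (u n - u N)) atTop := by
      refine le_trans ?_ (lintegral_liminf_le' fun n =>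
        hS.aemeasurable_quad ((hu1 n).1.sub (hu1 N).1))
      refine lintegral_mono_ae (hlim.mono fun l hl => ?_)
      have h1 := ((hcont ((f + g) l)).tendsto (h0 l - u N l)).comp
        (hl.sub (tendsto_const_nhds (x := u N l)))
      exact h1.liminf_eq.ge
    refine hF.trans (liminf_le_of_frequently_le' (Eventually.frequently ?_))
    filter_upwards [eventually_gt_atTop N] with n hn
    obtain ⟨h1, h2⟩ := hinc hn
    rw [← ENNReal.ofReal_toReal h1]
    refine ENNReal.ofReal_le_ofReal (h2.trans ?_)
    have h3 := hN n hn.le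
    rw [Real.dist_eq] at h3
    exact (le_abs_self _).trans h3.le
  · have hv : ∀ w : ℝ → H ι, AEStronglyMeasurable w circ →
        AEStronglyMeasurable (fun l => incr d τ l • symB b l - w l) circ := fun w hw =>
      ((measurable_incr d τ).aestronglyMeasurable.smul
        (continuous_symB hb).aestronglyMeasurable).sub hw
    have hF : mse d τ b h0 f g ≤ liminf (fun n => mse d τ b (u n) f g) atTop := by
      refine le_trans ?_ (lintegral_liminf_le' fun n =>
        (hf.aemeasurable_quad (hv _ (hu1 n).1)).fun_add (hg.aemeasurable_quad (hu1 n).1))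
      refine lintegral_mono_ae (hlim.mono fun l hl => ?_)
      have h1 := ((hcont (f l)).tendsto (incr d τ l • symB b l - h0 l)).comp
        ((tendsto_const_nhds (x := incr d τ l • symB b l)).sub hl)
      have h2 := ((hcont (g l)).tendsto (h0 l)).comp hl
      exact (h1.add h2).liminf_eq.ge
    refine hF.trans (liminf_le_of_frequently_le' (Frequently.of_forall fun n => ?_))
    rw [← ENNReal.ofReal_toReal (hBfin n)]
    exact ENNReal.ofReal_le_ofReal (hBle n)

end SaddlePoint

/-! ### From the saddle point to the minimax-robust characteristic -/

section Robust

theorem mem_HD_iff {ι : Type*} {d τ : ℕ} {D : DensityPairs ι} {u : ℝ → H ι} :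
    u ∈ HD d τ D ↔ ∀ p ∈ D, u ∈ L20 d τ (p.1 + p.2) := Set.mem_iInter₂

theorem mse_le_iSup {ι : Type*} (d τ : ℕ) (b : ℕ → H ι) (u : ℝ → H ι) {D : DensityPairs ι}
    {f g : ℝ → H ι →L[ℂ] H ι} (h : (f, g) ∈ D) :
    mse d τ b u f g ≤ ⨆ p ∈ D, mse d τ b u p.1 p.2 :=
  le_iSup₂_of_le (f, g) h le_rfl

variable {ι : Type*} [Countable ι]

/-- Convexity keeps every mixture with `(f₀, g₀)` inside `D`, so maximality supplies the hypothesis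
of the saddle point theorem. Testing the optimal error of any pair at `h⁰` gives least
favourability. -/
theorem robustSolution_of_solvesProblem {d τ : ℕ} (hτ : 0 < τ) {b : ℕ → H ι}
    (hb : Summable fun j => ‖b j‖) {D : DensityPairs ι}
    (hD : ∀ p ∈ D, IsSpectralDensity d τ p.1 ∧ IsSpectralDensity d τ p.2)
    {f₀ g₀ : ℝ → H ι →L[ℂ] H ι} (h₀ : (f₀, g₀) ∈ D)
    (hconv : ∀ p ∈ D, ∀ t : ℝ, 0 < t → t < 1 → (mix t f₀ p.1, mix t g₀ p.2) ∈ D)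
    (hmin : Minimality d τ f₀ g₀) (hsol : SolvesProblem d τ b D f₀ g₀) :
    RobustSolution d τ b D f₀ g₀ := by
  obtain ⟨hf₀, hg₀⟩ := hD _ h₀
  have hP := MinPair.of_minimality hτ hf₀ hg₀ hmin
  obtain ⟨v₀, hv₀, hmaxv⟩ := hsol
  rw [hP.hasValue_iff hb] at hv₀
  subst hv₀
  have hmax : ∀ p ∈ D, ∀ t : ℝ, 0 < t → t < 1 →
      minError d τ b (trn (mix t f₀ p.1)) (trn (mix t g₀ p.2)) ≤
        minError d τ b (trn f₀) (trn g₀) := fun p hp t ht0 ht1 => by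
    have hm := hmin.mix ht0.le ht1 hf₀ (hD p hp).1 hg₀ (hD p hp).2
    refine hmaxv _ (hconv p hp t ht0 ht1) hm _ ?_
    exact ((MinPair.of_minimality hτ (hf₀.mix ht0.le ht1.le (hD p hp).1)
      (hg₀.mix ht0.le ht1.le (hD p hp).2) hm).hasValue_iff hb _).2 rfl
  have hsad : ∀ C, IsSymbolC d τ b f₀ g₀ C → ∀ p ∈ D,
      spectralA d τ b f₀ g₀ C ∈ L20 d τ (p.1 + p.2) ∧
      mse d τ b (spectralA d τ b f₀ g₀ C) p.1 p.2 ≤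
        ENNReal.ofReal (minError d τ b (trn f₀) (trn g₀)) := fun C hC p hp =>
    saddle_point hτ hb hf₀ hg₀ (hD p hp).1 (hD p hp).2 hmin (hmax p hp) hC
  refine ⟨⟨h₀, fun p hp => ?_⟩, hP.exists_isSymbolC hb, fun C hC => hP.isOptimal hb hC,
    fun C hC h => ?_⟩
  · obtain ⟨C, hC⟩ := hP.exists_isSymbolC hb
    rw [hP.optMse_eq hb]
    exact (iInf₂_le _ (hsad C hC p hp).1).trans (hsad C hC p hp).2
  · have hHD : spectralA d τ b f₀ g₀ C ∈ HD d τ D :=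
      mem_HD_iff.2 fun p hp => (hsad C hC p hp).1
    have hsup : ⨆ p ∈ D, mse d τ b (spectralA d τ b f₀ g₀ C) p.1 p.2 ≤
        ENNReal.ofReal (minError d τ b (trn f₀) (trn g₀)) :=
      iSup₂_le fun p hp => (hsad C hC p hp).2
    -- The supremum dominates the error at `(f₀, g₀)`, which is `v₀` plus a squared distance;
    -- equality forces that distance to vanish, and `f₀ + g₀` is invertible.
    have hge : ∀ u ∈ HD d τ D, ENNReal.ofReal (minError d τ b (trn f₀) (trn g₀)) +
        normSq (f₀ + g₀) (u - spectralA d τ b f₀ g₀ C) ≤ ⨆ p ∈ D, mse d τ b u p.1 p.2 :=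
      fun u hu => by
        have hu₀ : u ∈ L20 d τ (f₀ + g₀) := mem_HD_iff.1 hu (f₀, g₀) h₀
        rw [← hP.mse_eq_add hb hC hu₀]
        exact mse_le_iSup d τ b u h₀
    constructor
    · rintro ⟨hh, hle⟩
      have h1 := (hge h hh).trans ((hle _ hHD).trans hsup)
      have h2 : normSq (f₀ + g₀) (h - spectralA d τ b f₀ g₀ C) = 0 := by
        have h3 : ENNReal.ofReal (minError d τ b (trn f₀) (trn g₀)) +
            normSq (f₀ + g₀) (h - spectralA d τ b f₀ g₀ C) ≤
            ENNReal.ofReal (minError d τ b (trn f₀) (trn g₀)) + 0 := by rwa [add_zero]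
        exact le_zero_iff.1 ((ENNReal.add_le_add_iff_left ENNReal.ofReal_ne_top).1 h3)
      have hm : AEStronglyMeasurable h circ := (mem_HD_iff.1 hh (f₀, g₀) h₀).1
      have hm' := (mem_HD_iff.1 hHD (f₀, g₀) h₀).1
      rw [normSq, lintegral_eq_zero_iff' ((hf₀.add' hg₀).aemeasurable_quad (hm.sub hm'))] at h2
      filter_upwards [h2, (hf₀.add' hg₀).positive, hmin.invertible] with l h3 h4 h5
      have h6 : quad ((f₀ + g₀) l) ((h - spectralA d τ b f₀ g₀ C) l) ≤ 0 :=
        ENNReal.ofReal_eq_zero.1 h3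
      rw [quad_eq_qf] at h6
      have h7 := norm_sq_le_inverse (isPositive_transp h4) (isUnit_transp h5)
        ((h - spectralA d τ b f₀ g₀ C) l)
      have h8 : ‖(h - spectralA d τ b f₀ g₀ C) l‖ ^ 2 ≤ 0 :=
        h7.trans (mul_nonpos_of_nonneg_of_nonpos (norm_nonneg _) h6)
      have h9 : ‖(h - spectralA d τ b f₀ g₀ C) l‖ = 0 := by
        nlinarith [norm_nonneg ((h - spectralA d τ b f₀ g₀ C) l)]
      exact sub_eq_zero.1 (norm_eq_zero.1 h9)
    · intro heq
      have hheq : ∀ f g, mse d τ b h f g = mse d τ b (spectralA d τ b f₀ g₀ C) f g :=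
        fun f g => mse_congr d τ b f g heq
      refine ⟨mem_HD_iff.2 fun p hp => L20_congr (hsad C hC p hp).1 heq.symm,
        fun u hu => ?_⟩
      simp only [hheq]
      exact hsup.trans (le_self_add.trans (hge u hu))

end Robust

/-! ## Convexity of the classes -/

section Convexity

set_option linter.unusedSectionVars false

variable {ι : Type*}

/-- Functionals of positive operators that respect convex combinations and measurability. -/
structure IsTraceLike (φ : (H ι →L[ℂ] H ι) → ℝ≥0∞) : Prop where
  convex_comb : ∀ {t : ℝ}, 0 ≤ t → t ≤ 1 → ∀ {f₀ f : ℝ → H ι →L[ℂ] H ι} {l : ℝ},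
    (f₀ l).IsPositive → (f l).IsPositive →
      φ (mix t f₀ f l) = ENNReal.ofReal (1 - t) * φ (f₀ l) + ENNReal.ofReal t * φ (f l)
  aemeasurable : ∀ {f : ℝ → H ι →L[ℂ] H ι}, StrMeas circ f → AEMeasurable (fun l => φ (f l)) circ

theorem entry_mix (t : ℝ) (f₀ f : ℝ → H ι →L[ℂ] H ι) (l : ℝ) (i j : ι) :
    entry (mix t f₀ f l) i j = (1 - t : ℝ) * entry (f₀ l) i j + t * entry (f l) i j := by
  simp only [entry_eq_inner, mix, add_apply, smul_apply, inner_add_right, inner_smul_right]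

theorem entry_re_nonneg {A : H ι →L[ℂ] H ι} (hA : A.IsPositive) (k : ι) : 0 ≤ (entry A k k).re := by
  rw [entry_eq_inner]
  exact hA.re_inner_nonneg_right _

theorem mul_mix_mul (B : H ι →L[ℂ] H ι) (t : ℝ) (f₀ f : ℝ → H ι →L[ℂ] H ι) (l : ℝ) :
    B * mix t f₀ f l * B = mix t (fun l => B * f₀ l * B) (fun l => B * f l * B) l := by
  simp only [mix, mul_add, add_mul, mul_smul_comm, smul_mul_assoc]

theorem isPositive_sandwich {A B : H ι →L[ℂ] H ι} (hA : A.IsPositive) (hB : B.IsPositive) :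
    (B * A * B).IsPositive := by
  have h := hA.conj_adjoint B
  rw [hB.isSelfAdjoint.adjoint_eq] at h
  exact h

theorem isTraceLike_opTrace [Countable ι] : IsTraceLike (opTrace (ι := ι)) where
  convex_comb {t} ht0 ht1 f₀ f l h₀ h := by
    have h1 : 0 ≤ 1 - t := by linarith
    simp only [opTrace]
    rw [← ENNReal.tsum_mul_left, ← ENNReal.tsum_mul_left, ← ENNReal.tsum_add]
    refine tsum_congr fun k => ?_
    rw [entry_mix, add_re, re_ofReal_mul, re_ofReal_mul,
      ENNReal.ofReal_add (mul_nonneg h1 (entry_re_nonneg h₀ k))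
        (mul_nonneg ht0 (entry_re_nonneg h k)), ENNReal.ofReal_mul h1, ENNReal.ofReal_mul ht0]
  aemeasurable {f} hf := by
    simp only [opTrace]
    refine AEMeasurable.tsum fun k => AEMeasurable.ennreal_ofReal ?_
    simp only [entry_eq_inner]
    exact Complex.measurable_re.comp_aemeasurable
      (aestronglyMeasurable_const.inner (hf (delta k))).aemeasurable

/-- Sandwiching with the positive operator `opSqrt B` preserves positivity and mixtures, which
reduces the pairing to the trace. -/
theorem isTraceLike_pairing [Countable ι] (B : H ι →L[ℂ] H ι) : IsTraceLike (pairing B) where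
  convex_comb {t} ht0 ht1 f₀ f l h₀ h := by
    simp only [pairing]
    rw [mul_mix_mul]
    exact isTraceLike_opTrace.convex_comb ht0 ht1 (isPositive_sandwich h₀ (isPositive_opSqrt B))
      (isPositive_sandwich h (isPositive_opSqrt B))
  aemeasurable {f} hf := isTraceLike_opTrace.aemeasurable
    (((StrMeas.const (opSqrt B)).mul hf).mul (StrMeas.const (opSqrt B)))

theorem ofReal_mix_self {t : ℝ} (ht0 : 0 ≤ t) (ht1 : t ≤ 1) (x : ℝ≥0∞) :
    ENNReal.ofReal (1 - t) * x + ENNReal.ofReal t * x = x := by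
  rw [← add_mul, ← ENNReal.ofReal_add (by linarith) ht0, sub_add_cancel, ENNReal.ofReal_one,
    one_mul]

theorem HasIntegralEq.mix_entry {t : ℝ} {f₀ f : ℝ → H ι →L[ℂ] H ι} {i j : ι} {z : ℂ}
    (h₀ : HasIntegralEq (fun l => entry (f₀ l) i j) z)
    (h : HasIntegralEq (fun l => entry (f l) i j) z) :
    HasIntegralEq (fun l => entry (mix t f₀ f l) i j) z := by
  simp only [entry_mix]
  refine ⟨(h₀.1.const_mul _).add (h.1.const_mul _), ?_⟩
  rw [integral_add (h₀.1.const_mul _) (h.1.const_mul _), integral_const_mul, integral_const_mul,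
    h₀.2, h.2]
  push_cast
  ring

variable [Countable ι] {d τ : ℕ} {φ : (H ι →L[ℂ] H ι) → ℝ≥0∞} {t : ℝ}
  {f₀ f : ℝ → H ι →L[ℂ] H ι}

theorem IsTraceLike.lintegral_mix (hφ : IsTraceLike φ) (ht0 : 0 ≤ t) (ht1 : t ≤ 1)
    (h₀ : IsSpectralDensity d τ f₀) (h : IsSpectralDensity d τ f) {p : ℝ≥0∞}
    (hp₀ : ∫⁻ l, φ (f₀ l) ∂circ = p) (hp : ∫⁻ l, φ (f l) ∂circ = p) :
    ∫⁻ l, φ (mix t f₀ f l) ∂circ = p := by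
  have hm₀ := hφ.aemeasurable h₀.strMeas
  have hm := hφ.aemeasurable h.strMeas
  have h1 : ∫⁻ l, φ (mix t f₀ f l) ∂circ =
      ∫⁻ l, (ENNReal.ofReal (1 - t) * φ (f₀ l) + ENNReal.ofReal t * φ (f l)) ∂circ := by
    refine lintegral_congr_ae ?_
    filter_upwards [h₀.positive, h.positive] with l h2 h3 using hφ.convex_comb ht0 ht1 h2 h3
  rw [h1, lintegral_add_left' (hm₀.const_mul _), lintegral_const_mul'' _ hm₀,
    lintegral_const_mul'' _ hm, hp₀, hp, ofReal_mix_self ht0 ht1]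

/-- The unknown contaminations may be mixed with the same weights, since the known part is common to
both densities. -/
theorem IsTraceLike.contaminated_mix (hφ : IsTraceLike φ) (ht0 : 0 ≤ t) (ht1 : t ≤ 1)
    (h₀ : IsSpectralDensity d τ f₀) (h : IsSpectralDensity d τ f) {a e : ℝ≥0∞}
    {g₁ W₀ W : ℝ → H ι →L[ℂ] H ι} (hW₀ : IsSpectralDensity d τ W₀) (hW : IsSpectralDensity d τ W)
    (he₀ : ∀ᵐ l ∂circ, φ (f₀ l) = a * φ (g₁ l) + e * φ (W₀ l))
    (he : ∀ᵐ l ∂circ, φ (f l) = a * φ (g₁ l) + e * φ (W l)) :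
    ∀ᵐ l ∂circ, φ (mix t f₀ f l) = a * φ (g₁ l) + e * φ (mix t W₀ W l) := by
  filter_upwards [h₀.positive, h.positive, hW₀.positive, hW.positive, he₀, he]
    with l h1 h2 h3 h4 h5 h6
  rw [hφ.convex_comb ht0 ht1 h1 h2, hφ.convex_comb ht0 ht1 h3 h4, h5, h6]
  nth_rewrite 3 [← ofReal_mix_self ht0 ht1 (a * φ (g₁ l))]
  ring

theorem mix_mem_classD0 {c : ClassData ι} {k : ClassNo} (ht0 : 0 ≤ t) (ht1 : t ≤ 1)
    (h₀ : f₀ ∈ classD0 d τ c k) (h : f ∈ classD0 d τ c k) : mix t f₀ f ∈ classD0 d τ c k := by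
  cases k with
  | one => exact ⟨h₀.1.mix ht0 ht1 h.1, fun i j => (h₀.2 i j).mix_entry (h.2 i j)⟩
  | two => exact ⟨h₀.1.mix ht0 ht1 h.1,
      isTraceLike_opTrace.lintegral_mix ht0 ht1 h₀.1 h.1 h₀.2 h.2⟩
  | three => exact ⟨h₀.1.mix ht0 ht1 h.1, fun i => (h₀.2 i).mix_entry (h.2 i)⟩
  | four => exact ⟨h₀.1.mix ht0 ht1 h.1,
      (isTraceLike_pairing c.B₁).lintegral_mix ht0 ht1 h₀.1 h.1 h₀.2 h.2⟩

theorem mix_mem_classDε {c : ClassData ι} {k : ClassNo} (ht0 : 0 ≤ t) (ht1 : t ≤ 1)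
    (h₀ : f₀ ∈ classDε d τ c k) (h : f ∈ classDε d τ c k) : mix t f₀ f ∈ classDε d τ c k := by
  cases k with
  | one =>
    obtain ⟨hs₀, ⟨W₀, hW₀, he₀⟩, hi₀⟩ := h₀
    obtain ⟨hs, ⟨W, hW, he⟩, hi⟩ := h
    exact ⟨hs₀.mix ht0 ht1 hs, ⟨_, hW₀.mix ht0 ht1 hW,
      isTraceLike_opTrace.contaminated_mix ht0 ht1 hs₀ hs hW₀ hW he₀ he⟩,
      isTraceLike_opTrace.lintegral_mix ht0 ht1 hs₀ hs hi₀ hi⟩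
  | two =>
    obtain ⟨hs₀, ⟨W₀, hW₀, he₀⟩, hi₀⟩ := h₀
    obtain ⟨hs, ⟨W, hW, he⟩, hi⟩ := h
    refine ⟨hs₀.mix ht0 ht1 hs, ⟨_, hW₀.mix ht0 ht1 hW, ?_⟩, fun i => (hi₀ i).mix_entry (hi i)⟩
    filter_upwards [he₀, he] with l h1 h2 i
    rw [entry_mix, entry_mix, h1, h2]
    push_cast
    ring
  | three =>
    obtain ⟨hs₀, ⟨W₀, hW₀, he₀⟩, hi₀⟩ := h₀
    obtain ⟨hs, ⟨W, hW, he⟩, hi⟩ := h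
    exact ⟨hs₀.mix ht0 ht1 hs, ⟨_, hW₀.mix ht0 ht1 hW,
      (isTraceLike_pairing c.B₂).contaminated_mix ht0 ht1 hs₀ hs hW₀ hW he₀ he⟩,
      (isTraceLike_pairing c.B₂).lintegral_mix ht0 ht1 hs₀ hs hi₀ hi⟩
  | four =>
    obtain ⟨hs₀, ⟨W₀, hW₀, he₀⟩, hi₀⟩ := h₀
    obtain ⟨hs, ⟨W, hW, he⟩, hi⟩ := h
    refine ⟨hs₀.mix ht0 ht1 hs, ⟨_, hW₀.mix ht0 ht1 hW, ?_⟩,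
      fun i j => (hi₀ i j).mix_entry (hi i j)⟩
    filter_upwards [he₀, he] with l h1 h2
    simp only [mix, h1, h2]
    push_cast
    module

theorem isSpectralDensity_of_mem_classD0 {c : ClassData ι} {k : ClassNo}
    (h : f ∈ classD0 d τ c k) : IsSpectralDensity d τ f := by
  cases k <;> exact h.1

theorem isSpectralDensity_of_mem_classDε {c : ClassData ι} {k : ClassNo}
    (h : f ∈ classDε d τ c k) : IsSpectralDensity d τ f := by
  cases k <;> exact h.1

end Convexity

/-! ## Families with equal Gram matrices -/

section Isometry

variable {κ 𝓔 𝓕 : Type*} [NormedAddCommGroup 𝓔] [InnerProductSpace ℂ 𝓔]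
  [NormedAddCommGroup 𝓕] [InnerProductSpace ℂ 𝓕]

theorem norm_comb_eq_of_gram_eq {v : κ → 𝓔} {w : κ → 𝓕} (h : gram v = gram w) (x : κ →₀ ℂ) :
    ‖comb v x‖ = ‖comb w x‖ := by
  rw [← sq_eq_sq₀ (norm_nonneg _) (norm_nonneg _), ← energy_gram, ← energy_gram, h]

theorem comb_single (v : κ → 𝓔) (p : κ) : comb v (Finsupp.single p 1) = v p := by
  simp [comb]

theorem mem_closedSpan_self (v : κ → 𝓔) (p : κ) : v p ∈ closedSpan v :=
  Submodule.le_topologicalClosure _ (Submodule.subset_span ⟨p, rfl⟩)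

theorem comb_mem_closedSpan (v : κ → 𝓔) (x : κ →₀ ℂ) : comb v x ∈ closedSpan v :=
  Submodule.le_topologicalClosure _ (comb_mem_span v x)

/-- Families with the same Gram matrix have isometric closed spans. -/
theorem exists_isometry_of_gram_eq [CompleteSpace 𝓔] [CompleteSpace 𝓕] {v : κ → 𝓔} {w : κ → 𝓕}
    (h : gram v = gram w) : ∃ U : 𝓕 →L[ℂ] 𝓔, (∀ p, U (w p) = v p) ∧
      (∀ y ∈ closedSpan w, ‖U y‖ = ‖y‖) ∧ ∀ y ∈ closedSpan w, U y ∈ closedSpan v := by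
  let e : (κ →₀ ℂ) →ₗ[ℂ] closedSpan w :=
    (Finsupp.linearCombination ℂ w).codRestrict (closedSpan w) (comb_mem_closedSpan w)
  have he : ∀ x, ((e x : closedSpan w) : 𝓕) = comb w x := fun x => rfl
  have hdense : DenseRange e := fun y => by
    rw [closure_subtype]
    refine closure_mono ?_ y.2
    intro z hz
    obtain ⟨x, rfl⟩ := Finsupp.mem_span_range_iff_exists_finsupp.1 hz
    exact ⟨e x, ⟨x, rfl⟩, rfl⟩
  have hn : ∀ x, ‖Finsupp.linearCombination ℂ v x‖ ≤ 1 * ‖e x‖ := fun x => by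
    rw [one_mul]
    exact (norm_comb_eq_of_gram_eq h x).le
  let U₀ : closedSpan w →L[ℂ] 𝓔 := (Finsupp.linearCombination ℂ v).extendOfNorm e
  have hU₀ : ∀ x, U₀ (e x) = comb v x := fun x =>
    LinearMap.extendOfNorm_eq hdense ⟨1, hn⟩ x
  have hproj : ∀ y : closedSpan w, (closedSpan w).orthogonalProjectionOnto (y : 𝓕) = y := fun y =>
    Submodule.orthogonalProjectionOnto_mem_subspace_eq_self y
  -- Precomposition with the projection extends the operator to the whole space without changing it
  -- on the closed span.
  refine ⟨U₀.comp (closedSpan w).orthogonalProjectionOnto, fun p => ?_, fun y hy => ?_, fun y hy => ?_⟩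
  · have h1 := hU₀ (Finsupp.single p 1)
    rw [comb_single] at h1
    have h2 : w p = ((e (Finsupp.single p 1) : closedSpan w) : 𝓕) := by rw [he, comb_single]
    rw [ContinuousLinearMap.comp_apply, h2, hproj, h1]
  · rw [ContinuousLinearMap.comp_apply, hproj ⟨y, hy⟩]
    have key : ∀ z : closedSpan w, ‖U₀ z‖ = ‖z‖ := fun z =>
      hdense.induction_on z (isClosed_eq (by fun_prop) (by fun_prop)) fun x => by
        rw [hU₀]
        exact norm_comb_eq_of_gram_eq h x
    exact key ⟨y, hy⟩
  · rw [ContinuousLinearMap.comp_apply, hproj ⟨y, hy⟩]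
    have hcl : IsClosed ((closedSpan v : Submodule ℂ 𝓔) : Set 𝓔) :=
      Submodule.isClosed_topologicalClosure _
    exact hdense.induction_on (p := fun z => U₀ z ∈ closedSpan v) ⟨y, hy⟩
      (hcl.preimage U₀.continuous) fun x => by
        rw [hU₀]
        exact comb_mem_closedSpan v x

end Isometry

/-! ## The observed functions in the weighted spaces -/

section ObservedFunctions

set_option linter.unusedSectionVars false

variable {ι : Type*} [Countable ι] {d τ : ℕ} {A : ℝ → H ι →L[ℂ] H ι}

/-- The image of the observed functions in `L₂(A)`. -/
def obsFamily (d τ : ℕ) (A : ℝ → H ι →L[ℂ] H ι) (p : ℕ × ι) : Lp (H ι) 2 circ :=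
  emb A (observed d τ p)

theorem observed_eq (d τ : ℕ) (p : ℕ × ι) (l : ℝ) :
    observed d τ p l = incr d τ l • (zc l ^ p.1 • delta p.2) := by
  rw [observed, smul_smul, zc_pow, chr, mul_comm]
  push_cast
  ring_nf

theorem IsSpectralDensity.finNorm_incr (hA : IsSpectralDensity d τ A) {u : ℝ → H ι}
    (hu : AEStronglyMeasurable u circ) {K : ℝ} (hK : ∀ t, ‖u t‖ ≤ K) :
    FinNorm A fun l => incr d τ l • u l :=
  ⟨(measurable_incr d τ).aestronglyMeasurable.smul hu, wSq_incr_vpoly_ne_top hA hK⟩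

theorem IsSpectralDensity.norm_emb_incr_le (hA : IsSpectralDensity d τ A) {u : ℝ → H ι}
    (hu : AEStronglyMeasurable u circ) {K : ℝ} (hK : ∀ t, ‖u t‖ ≤ K) :
    ‖emb A fun l => incr d τ l • u l‖ ≤ √(∫ t, wt d τ t * ‖A t‖ ∂circ) * K := by
  have hK0 : 0 ≤ K := (norm_nonneg _).trans (hK 0)
  have hi0 : 0 ≤ ∫ t, wt d τ t * ‖A t‖ ∂circ :=
    integral_nonneg fun t => mul_nonneg (wt_nonneg _ _ _) (norm_nonneg _)
  rw [← sq_le_sq₀ (norm_nonneg _) (by positivity), mul_pow, Real.sq_sqrt hi0,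
    ← ENNReal.ofReal_le_ofReal_iff (by positivity), norm_emb_sq hA.isWeight (hA.finNorm_incr hu hK),
    ← integral_mul_const, ofReal_integral_eq_lintegral_ofReal (hA.integrable.mul_const _)
      (Eventually.of_forall fun t =>
        mul_nonneg (mul_nonneg (wt_nonneg _ _ _) (norm_nonneg _)) (sq_nonneg _))]
  refine lintegral_mono fun t => ENNReal.ofReal_le_ofReal ?_
  rw [qf_smul_right, norm_incr_sq, mul_assoc]
  refine mul_le_mul_of_nonneg_left ((qf_le_norm _ _).trans ?_) (wt_nonneg _ _ _)
  exact mul_le_mul_of_nonneg_left (pow_le_pow_left₀ (norm_nonneg _) (hK t) 2) (norm_nonneg _)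

theorem aestronglyMeasurable_zc_pow_smul (j : ℕ) (x : H ι) :
    AEStronglyMeasurable (fun t => zc t ^ j • x) circ :=
  Continuous.aestronglyMeasurable (Continuous.smul (continuous_zc.pow j) continuous_const)

theorem norm_zc_pow_smul_le (j : ℕ) (x : H ι) (t : ℝ) : ‖zc t ^ j • x‖ ≤ ‖x‖ := by
  rw [norm_smul, norm_pow, norm_zc, one_pow, one_mul]

theorem IsSpectralDensity.finNorm_observed (hA : IsSpectralDensity d τ A) (p : ℕ × ι) :
    FinNorm A (observed d τ p) := by
  have h : observed d τ p = fun l => incr d τ l • (zc l ^ p.1 • delta p.2) :=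
    funext fun l => observed_eq d τ p l
  rw [h]
  exact hA.finNorm_incr (aestronglyMeasurable_zc_pow_smul _ _) (norm_zc_pow_smul_le _ _)

theorem IsSpectralDensity.gram_obsFamily (hA : IsSpectralDensity d τ A) (p q : ℕ × ι) :
    gram (obsFamily d τ A) p q = ∫ t, exp (I * t * ((p.1 : ℂ) - q.1)) * wt d τ t *
      inner ℂ (delta p.2) (A t (delta q.2)) ∂circ := by
  rw [gram, obsFamily, obsFamily, inner_emb hA.isWeight (hA.finNorm_observed p)
    (hA.finNorm_observed q)]
  refine integral_congr_ae (Eventually.of_forall fun t => ?_)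
  beta_reduce
  have h1 : (starRingEnd ℂ) (incr d τ t) * incr d τ t = (wt d τ t : ℂ) := by
    rw [conj_mul', ← ofReal_pow, norm_incr_sq]
  rw [observed_eq, observed_eq, map_smul, map_smul, inner_smul_left, inner_smul_left,
    inner_smul_right, inner_smul_right, exp_eq_chr, ← h1, zc_pow p.1, conj_chr, neg_neg]
  ring

theorem IsSpectralDensity.comb_obsFamily (hA : IsSpectralDensity d τ A) (x : ℕ × ι →₀ ℂ) :
    comb (obsFamily d τ A) x = emb A (∑ p ∈ x.support, x p • observed d τ p) := by
  rw [emb_sum hA.isWeight hA.finNorm_observed]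
  rfl

/-- The functions `e^{-iλj} w(λ) x` in `L₂(A)`, as a linear function of `x`. -/
def shiftEmb (hA : IsSpectralDensity d τ A) (j : ℕ) : H ι →L[ℂ] Lp (H ι) 2 circ :=
  LinearMap.mkContinuous
    { toFun := fun x => emb A fun l => incr d τ l • (zc l ^ j • x)
      map_add' := fun x y => by
        rw [← emb_add hA.isWeight
          (hA.finNorm_incr (aestronglyMeasurable_zc_pow_smul _ _) (norm_zc_pow_smul_le _ _))
          (hA.finNorm_incr (aestronglyMeasurable_zc_pow_smul _ _) (norm_zc_pow_smul_le _ _))]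
        congr 1
        funext l
        simp only [Pi.add_apply, smul_add]
      map_smul' := fun c x => by
        rw [RingHom.id_apply, ← emb_smul hA.isWeight c
          (hA.finNorm_incr (aestronglyMeasurable_zc_pow_smul _ _) (norm_zc_pow_smul_le _ _))]
        congr 1
        funext l
        simp only [Pi.smul_apply]
        rw [smul_comm c, smul_comm c] }
    (√(∫ t, wt d τ t * ‖A t‖ ∂circ)) fun x =>
      hA.norm_emb_incr_le (aestronglyMeasurable_zc_pow_smul _ _) (norm_zc_pow_smul_le _ _)

theorem shiftEmb_apply (hA : IsSpectralDensity d τ A) (j : ℕ) (x : H ι) :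
    shiftEmb hA j x = emb A fun l => incr d τ l • (zc l ^ j • x) := rfl

theorem norm_shiftEmb_le (hA : IsSpectralDensity d τ A) (j : ℕ) (x : H ι) :
    ‖shiftEmb hA j x‖ ≤ √(∫ t, wt d τ t * ‖A t‖ ∂circ) * ‖x‖ :=
  hA.norm_emb_incr_le (aestronglyMeasurable_zc_pow_smul _ _) (norm_zc_pow_smul_le _ _)

/-- Together with the sum over `j`, this realizes the iterated series of the functional inside
`L₂(A)`, by continuity of `shiftEmb`. -/
theorem hasSum_shiftEmb (hA : IsSpectralDensity d τ A) (j : ℕ) (x : H ι) :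
    HasSum (fun k => x k • obsFamily d τ A (j, k)) (shiftEmb hA j x) := by
  have h := (hasSum_delta x).mapL (shiftEmb hA j)
  convert h using 2 with k
  rw [map_smul, shiftEmb_apply, obsFamily]
  congr 2
  funext l
  exact observed_eq d τ (j, k) l

theorem sum_shiftEmb (hA : IsSpectralDensity d τ A) (b : ℕ → H ι) (n : ℕ) :
    ∑ j ∈ Finset.range n, shiftEmb hA j (b j) =
      emb A fun l => incr d τ l • ∑ j ∈ Finset.range n, zc l ^ j • b j := by
  have h := emb_sum hA.isWeight (u := fun j l => incr d τ l • (zc l ^ j • b j))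
    (fun j => hA.finNorm_incr (aestronglyMeasurable_zc_pow_smul _ _) (norm_zc_pow_smul_le _ _))
    (Finset.range n) (fun _ => 1)
  simp only [one_smul] at h
  rw [Finset.sum_congr rfl fun j _ => shiftEmb_apply hA j (b j), ← h]
  congr 1
  funext l
  rw [Finset.sum_apply, Finset.smul_sum]

theorem hasSum_emb_symB (hA : IsSpectralDensity d τ A) {b : ℕ → H ι}
    (hb : Summable fun j => ‖b j‖) :
    HasSum (fun j => shiftEmb hA j (b j)) (emb A fun l => incr d τ l • symB b l) := by
  have hs : Summable fun j => shiftEmb hA j (b j) :=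
    Summable.of_norm_bounded (hb.mul_left _) fun j => norm_shiftEmb_le hA j (b j)
  refine (hs.hasSum_iff_tendsto_nat).2 ?_
  have hm : ∀ n : ℕ, AEStronglyMeasurable (fun l => ∑ j ∈ Finset.range n, zc l ^ j • b j) circ :=
    fun n => Finset.aestronglyMeasurable_fun_sum _ fun j _ => aestronglyMeasurable_zc_pow_smul j _
  have hle : ∀ (n : ℕ) (t : ℝ), ‖symB b t - ∑ j ∈ Finset.range n, zc t ^ j • b j‖ ≤
      ∑' j, ‖b (j + n)‖ := fun n t => by
    have h1 : Summable fun j => zc t ^ j • b j := (hasSum_symB hb t).summable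
    rw [← (hasSum_symB hb t).tsum_eq, ← h1.sum_add_tsum_nat_add n, add_sub_cancel_left]
    have h2 := (summable_nat_add_iff n).2 hb
    refine (norm_tsum_le_tsum_norm ?_).trans (le_of_eq ?_)
    · simpa only [norm_smul, norm_pow, norm_zc, one_pow, one_mul] using h2
    · simp only [norm_smul, norm_pow, norm_zc, one_pow, one_mul]
  have hfin : ∀ n : ℕ, FinNorm A fun l => incr d τ l • ∑ j ∈ Finset.range n, zc l ^ j • b j :=
    fun n => hA.finNorm_incr (hm n) (K := ∑ j ∈ Finset.range n, ‖b j‖) fun t =>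
      norm_sum_le_of_le _ fun j _ => norm_zc_pow_smul_le _ _ _
  have hfinB : FinNorm A fun l => incr d τ l • symB b l :=
    hA.finNorm_incr (continuous_symB hb).aestronglyMeasurable (norm_symB_le hb)
  simp only [sum_shiftEmb]
  rw [tendsto_iff_norm_sub_tendsto_zero]
  have hbound : ∀ n : ℕ, ‖(emb A fun l => incr d τ l • ∑ j ∈ Finset.range n, zc l ^ j • b j) -
      emb A fun l => incr d τ l • symB b l‖ ≤
      √(∫ t, wt d τ t * ‖A t‖ ∂circ) * ∑' j, ‖b (j + n)‖ := fun n => by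
    rw [norm_sub_rev, ← emb_sub hA.isWeight hfinB (hfin n)]
    have h3 : ((fun l => incr d τ l • symB b l) - fun l => incr d τ l • ∑ j ∈ Finset.range n,
        zc l ^ j • b j) = fun l => incr d τ l • (symB b l - ∑ j ∈ Finset.range n, zc l ^ j • b j) :=
      funext fun l => (smul_sub _ _ _).symm
    rw [h3]
    exact hA.norm_emb_incr_le ((continuous_symB hb).aestronglyMeasurable.sub (hm n)) (hle n)
  refine squeeze_zero (fun n => norm_nonneg _) hbound ?_
  have h4 := (tendsto_sum_nat_add fun j => ‖b j‖).const_mul (√(∫ t, wt d τ t * ‖A t‖ ∂circ))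
  rwa [mul_zero] at h4

theorem emb_symB_mem_closedSpan (hA : IsSpectralDensity d τ A) {b : ℕ → H ι}
    (hb : Summable fun j => ‖b j‖) :
    emb A (fun l => incr d τ l • symB b l) ∈ closedSpan (obsFamily d τ A) := by
  have hcl : IsClosed ((closedSpan (obsFamily d τ A) : Submodule ℂ _) : Set (Lp (H ι) 2 circ)) :=
    Submodule.isClosed_topologicalClosure _
  refine hcl.mem_of_tendsto (hasSum_emb_symB hA hb) (Eventually.of_forall fun s => ?_)
  refine Submodule.sum_mem _ fun j _ => ?_
  refine hcl.mem_of_tendsto (hasSum_shiftEmb hA j (b j)) (Eventually.of_forall fun s => ?_)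
  exact Submodule.sum_mem _ fun k _ => Submodule.smul_mem _ _ (mem_closedSpan_self _ _)

end ObservedFunctions

/-! ## Random sequences -/

section Realizations

set_option linter.unusedSectionVars false

variable {ι Ω : Type*} [Countable ι] [MeasurableSpace Ω] {μ : Measure Ω} {d τ : ℕ}
  {f g : ℝ → H ι →L[ℂ] H ι} {ξ η : ℤ → ι → Lp ℂ 2 μ} {b : ℕ → H ι}

/-- The past of a sequence as one family. -/
def pastFamily (ξ : ℤ → ι → Lp ℂ 2 μ) (p : ℕ × ι) : Lp ℂ 2 μ := ξ (-(p.1 : ℤ)) p.2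

/-- The covariances are taken at times `-j`, which reverses the sign of the frequency; the exchanged
indices of the entry amount to a transposition of `f`. -/
theorem gram_pastFamily (hf : IsSpectralDensity d τ f)
    (h : ∀ l j k n, inner ℂ (ξ j n) (ξ l k) =
      ∫ t, exp (I * t * (l - j)) * wt d τ t * entry (f t) k n ∂circ) :
    gram (pastFamily ξ) = gram (obsFamily d τ (trn f)) := by
  funext p q
  rw [hf.transpose.gram_obsFamily, gram, pastFamily, pastFamily, h]
  refine integral_congr_ae (Eventually.of_forall fun t => ?_)
  beta_reduce
  rw [entry_eq_transp]
  congr 3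
  push_cast
  ring_nf

/-- Both series are images under `U` of convergent series in `L₂(fᵀ)`, so the `tsum`s are genuine
limits and not default values. -/
theorem functional_eq (hf : IsSpectralDensity d τ f) (hb : Summable fun j => ‖b j‖)
    {U : Lp (H ι) 2 circ →L[ℂ] Lp ℂ 2 μ}
    (hU : ∀ p, U (obsFamily d τ (trn f) p) = pastFamily ξ p) :
    functional b ξ = U (emb (trn f) fun l => incr d τ l • symB b l) := by
  rw [← ((hasSum_emb_symB hf.transpose hb).mapL U).tsum_eq, functional]
  refine tsum_congr fun j => ?_
  rw [← ((hasSum_shiftEmb hf.transpose j (b j)).mapL U).tsum_eq]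
  refine tsum_congr fun k => ?_
  rw [map_smul, hU]
  rfl

theorem mse_eq_norm_emb (hf : IsSpectralDensity d τ f) (hg : IsSpectralDensity d τ g)
    (hb : Summable fun j => ‖b j‖) {u : ℝ → H ι} (hF : FinNorm (trn f) u)
    (hG : FinNorm (trn g) u) : mse d τ b u f g =
      ENNReal.ofReal (‖emb (trn f) (fun l => incr d τ l • symB b l) - emb (trn f) u‖ ^ 2
        + ‖emb (trn g) u‖ ^ 2) := by
  have hfinB : FinNorm (trn f) fun l => incr d τ l • symB b l :=
    hf.transpose.finNorm_incr (continuous_symB hb).aestronglyMeasurable (norm_symB_le hb)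
  have hd := hfinB.sub hf.transpose.isWeight hF
  rw [ENNReal.ofReal_add (sq_nonneg _) (sq_nonneg _), ← emb_sub hf.transpose.isWeight hfinB hF,
    norm_emb_sq hf.transpose.isWeight hd, norm_emb_sq hg.transpose.isWeight hG, mse_eq]
  exact lintegral_add_left' (aemeasurable_qf hf.transpose.strMeas hd.1).ennreal_ofReal _

theorem finNorm_sum_observed (hf : IsSpectralDensity d τ f) (x : ℕ × ι →₀ ℂ) :
    FinNorm (trn f) (∑ p ∈ x.support, x p • observed d τ p) :=
  FinNorm.sum hf.transpose.isWeight hf.transpose.finNorm_observed _ _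

theorem past_eq (ξ η : ℤ → ι → Lp ℂ 2 μ) :
    (past ξ η : Set (Lp ℂ 2 μ)) = closure
      ((Submodule.span ℂ (Set.range fun p => pastFamily ξ p + pastFamily η p) :
        Submodule ℂ (Lp ℂ 2 μ)) : Set (Lp ℂ 2 μ)) := rfl

theorem comb_add (v w : ℕ × ι → Lp ℂ 2 μ) (x : ℕ × ι →₀ ℂ) :
    comb (fun p => v p + w p) x = comb v x + comb w x := by
  simp only [comb_eq_sum, smul_add, Finset.sum_add_distrib]

/-- The signal part is moved by the isometry; the noise part is orthogonal to the whole closed span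
of the signal, so squared norms add. -/
theorem mse_sum_observed (hf : IsSpectralDensity d τ f) (hg : IsSpectralDensity d τ g)
    (hb : Summable fun j => ‖b j‖) (h : IsRealization d τ f g μ ξ η) (x : ℕ × ι →₀ ℂ) :
    mse d τ b (∑ p ∈ x.support, x p • observed d τ p) f g = ENNReal.ofReal
      (‖functional b ξ - comb (fun p => pastFamily ξ p + pastFamily η p) x‖ ^ 2) := by
  obtain ⟨U, hU, hiso, hmem⟩ := exists_isometry_of_gram_eq (gram_pastFamily hf h.cov_ξ)
  have hy := emb_symB_mem_closedSpan hf.transpose hb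
  have hUx : U (comb (obsFamily d τ (trn f)) x) = comb (pastFamily ξ) x := by
    simp only [comb_eq_sum, map_sum, map_smul, hU]
  have hx := comb_mem_closedSpan (obsFamily d τ (trn f)) x
  have h1 : ‖functional b ξ - comb (pastFamily ξ) x‖ =
      ‖emb (trn f) (fun l => incr d τ l • symB b l) - comb (obsFamily d τ (trn f)) x‖ := by
    rw [functional_eq hf hb hU, ← hUx, ← map_sub]
    exact hiso _ (Submodule.sub_mem _ hy hx)
  have h2 : ‖comb (pastFamily η) x‖ = ‖comb (obsFamily d τ (trn g)) x‖ :=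
    norm_comb_eq_of_gram_eq (gram_pastFamily hg h.cov_η) x
  have h3 : inner ℂ (functional b ξ - comb (pastFamily ξ) x) (comb (pastFamily η) x) = 0 := by
    refine inner_eq_zero_of_mem_closedSpan (v := pastFamily ξ) (fun p => ?_) ?_
    · rw [comb_eq_sum, inner_sum]
      refine Finset.sum_eq_zero fun q _ => ?_
      rw [inner_smul_right, pastFamily, pastFamily, h.uncorrelated, mul_zero]
    · rw [functional_eq hf hb hU, ← hUx, ← map_sub]
      exact hmem _ (Submodule.sub_mem _ hy hx)
  rw [mse_eq_norm_emb hf hg hb (finNorm_sum_observed hf x) (finNorm_sum_observed hg x),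
    ← hf.transpose.comb_obsFamily, ← hg.transpose.comb_obsFamily, ← h1, ← h2, comb_add,
    ← sub_sub, @norm_sub_sq ℂ _ _ _ _ (functional b ξ - _), h3]
  simp

theorem sum_observed_mem_L20 (S : ℝ → H ι →L[ℂ] H ι) (x : ℕ × ι →₀ ℂ) :
    ∑ p ∈ x.support, x p • observed d τ p ∈ L20 d τ S := by
  have hm : AEStronglyMeasurable (∑ p ∈ x.support, x p • observed (ι := ι) d τ p) circ := by
    refine Finset.aestronglyMeasurable_sum _ fun p _ => AEStronglyMeasurable.const_smul ?_ _
    have h : observed d τ p = fun l => incr d τ l • (zc l ^ p.1 • delta p.2) :=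
      funext fun l => observed_eq d τ p l
    rw [h]
    exact (measurable_incr d τ).aestronglyMeasurable.smul (aestronglyMeasurable_zc_pow_smul _ _)
  refine ⟨hm, fun _ => ∑ p ∈ x.support, x p • observed d τ p, fun _ => ?_, ?_⟩
  · exact Submodule.sum_mem _ fun p _ =>
      Submodule.smul_mem _ _ (Submodule.subset_span ⟨p, rfl⟩)
  · simp only [sub_self, normSq_zero]
    exact tendsto_const_nhds

/-- Each of the two norms is dominated by the norm of `L₂(f + g)`, so approximants in that norm
converge for signal and noise separately. -/
theorem exists_tendsto_mse (hf : IsSpectralDensity d τ f) (hg : IsSpectralDensity d τ g)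
    (hb : Summable fun j => ‖b j‖) {u : ℝ → H ι} (hu : u ∈ L20 d τ (f + g)) :
    ∃ x : ℕ → ℕ × ι →₀ ℂ, Tendsto
      (fun n => mse d τ b (∑ p ∈ (x n).support, x n p • observed d τ p) f g) atTop
      (𝓝 (mse d τ b u f g)) := by
  obtain ⟨hum, q, hq, hlim⟩ := hu
  choose x hx using fun n => Finsupp.mem_span_range_iff_exists_finsupp.1 (hq n)
  have hx' : ∀ n, q n = ∑ p ∈ (x n).support, x n p • observed d τ p := fun n => (hx n).symm
  have hleF : ∀ v, wSq (trn f) v ≤ normSq (f + g) v := fun v => by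
    rw [normSq]
    refine lintegral_mono_ae ?_
    filter_upwards [hg.positive] with l h2
    refine ENNReal.ofReal_le_ofReal ?_
    rw [quad_eq_qf, Pi.add_apply, transp_add, qf_add_left]
    linarith [qf_nonneg (isPositive_transp h2) (v l)]
  have hleG : ∀ v, wSq (trn g) v ≤ normSq (f + g) v := fun v => by
    rw [normSq]
    refine lintegral_mono_ae ?_
    filter_upwards [hf.positive] with l h2
    refine ENNReal.ofReal_le_ofReal ?_
    rw [quad_eq_qf, Pi.add_apply, transp_add, qf_add_left]
    linarith [qf_nonneg (isPositive_transp h2) (v l)]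
  have hqF : ∀ n, FinNorm (trn f) (q n) := fun n => by
    rw [hx']; exact finNorm_sum_observed hf _
  have hqG : ∀ n, FinNorm (trn g) (q n) := fun n => by
    rw [hx']; exact finNorm_sum_observed hg _
  have hfin : ∀ {A : ℝ → H ι →L[ℂ] H ι}, IsSpectralDensity d τ A → (∀ n, FinNorm A (q n)) →
      (∀ v, wSq A v ≤ normSq (f + g) v) → FinNorm A u ∧
        Tendsto (fun n => emb A (q n)) atTop (𝓝 (emb A u)) := fun {A} hA hqA hle => by
    have h0 : Tendsto (fun n => wSq A (u - q n)) atTop (𝓝 0) :=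
      tendsto_of_tendsto_of_tendsto_of_le_of_le tendsto_const_nhds hlim (fun n => zero_le)
        fun n => hle _
    have h1 : FinNorm A u := by
      obtain ⟨n, hn⟩ := (h0.eventually (gt_mem_nhds ENNReal.zero_lt_top)).exists
      have h2 : FinNorm A (u - q n) := ⟨hum.sub (hqA n).1, hn.ne⟩
      simpa using h2.add hA.isWeight (hqA n)
    exact ⟨h1, (tendsto_emb_iff hA.isWeight hqA h1).2 h0⟩
  obtain ⟨huF, hlF⟩ := hfin hf.transpose hqF hleF
  obtain ⟨huG, hlG⟩ := hfin hg.transpose hqG hleG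
  refine ⟨x, ?_⟩
  simp only [← hx']
  rw [mse_eq_norm_emb hf hg hb huF huG]
  simp only [mse_eq_norm_emb hf hg hb (hqF _) (hqG _)]
  exact (ENNReal.continuous_ofReal.tendsto _).comp
    (((tendsto_const_nhds.sub hlF).norm.pow 2).add (hlG.norm.pow 2))

/-- The mean square error of the optimal estimate is the squared distance to the observations. -/
theorem optMse_eq_infDist (hf : IsSpectralDensity d τ f) (hg : IsSpectralDensity d τ g)
    (hb : Summable fun j => ‖b j‖) (h : IsRealization d τ f g μ ξ η) :
    optMse d τ b f g = ENNReal.ofReal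
      (Metric.infDist (functional b ξ) (past ξ η : Set (Lp ℂ 2 μ)) ^ 2) := by
  rw [past_eq, Metric.infDist_closure]
  set N : Submodule ℂ (Lp ℂ 2 μ) :=
    Submodule.span ℂ (Set.range fun p => pastFamily ξ p + pastFamily η p) with hN
  have hne : (N : Set (Lp ℂ 2 μ)).Nonempty := ⟨0, N.zero_mem⟩
  refine le_antisymm ?_ (le_iInf₂ fun u hu => ?_)
  -- The distance need not be attained on the algebraic span, hence the slack `1/(n+1)`.
  · have hstep : ∀ n : ℕ, optMse d τ b f g ≤ ENNReal.ofReal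
        ((Metric.infDist (functional b ξ) (N : Set (Lp ℂ 2 μ)) + 1 / ((n : ℝ) + 1)) ^ 2) :=
        fun n => by
      obtain ⟨y, hy, hlt⟩ := (Metric.infDist_lt_iff hne).1
        (lt_add_of_pos_right (Metric.infDist (functional b ξ) (N : Set (Lp ℂ 2 μ)))
          (Nat.one_div_pos_of_nat (α := ℝ) (n := n)))
      obtain ⟨x, rfl⟩ := Finsupp.mem_span_range_iff_exists_finsupp.1 hy
      refine (iInf₂_le _ (sum_observed_mem_L20 (f + g) x)).trans ?_
      rw [mse_sum_observed hf hg hb h]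
      refine ENNReal.ofReal_le_ofReal (pow_le_pow_left₀ (norm_nonneg _) ?_ 2)
      rw [dist_eq_norm] at hlt
      exact hlt.le
    refine ge_of_tendsto' (x := atTop) ?_ hstep
    have h1 := ((tendsto_const_nhds (x := Metric.infDist (functional b ξ)
      (N : Set (Lp ℂ 2 μ)))).add (tendsto_one_div_add_atTop_nhds_zero_nat (𝕜 := ℝ))).pow 2
    rw [add_zero] at h1
    exact (ENNReal.continuous_ofReal.tendsto _).comp h1
  -- Each approximating polynomial is an element of the span with the same error, so its error is at
  -- least the squared distance.
  · obtain ⟨x, hx⟩ := exists_tendsto_mse hf hg hb hu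
    refine ge_of_tendsto' hx fun n => ?_
    rw [mse_sum_observed hf hg hb h]
    refine ENNReal.ofReal_le_ofReal (pow_le_pow_left₀ Metric.infDist_nonneg ?_ 2)
    rw [← dist_eq_norm]
    exact Metric.infDist_le_dist_of_mem (comb_mem_span _ _)

end Realizations

end MinimaxFilter

end

/-! ### The theorem for the four pairs of classes -/

theorem theorem5 {ι : Type*} [Countable ι] (d τ : ℕ) (hτ : 0 < τ)
    (a : ℕ → H ι) (ha : Summable fun j : ℕ => ((j : ℝ) + 1) * ‖Dτ d τ a j‖)
    (c : ClassData ι) (hc : c.Valid d τ) (k : ClassNo) :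
    (∀ f0 ∈ classD0 d τ c k, ∀ g0 ∈ classDε d τ c k,
      LagrangeEquations d τ c (Dτ d τ a) k f0 g0 → Minimality d τ f0 g0 →
      SolvesProblem d τ (Dτ d τ a) (classPair d τ c k) f0 g0 →
      RobustSolution d τ (Dτ d τ a) (classPair d τ c k) f0 g0) ∧
    (∀ f0 ∈ classD0 d τ c k, ∀ g0 ∈ classDε d τ c k, Minimality d τ f0 g0 →
      SolvesProblem d τ (Dτ d τ a) (classPair d τ c k) f0 g0 →
      RobustSolution d τ (Dτ d τ a) (classPair d τ c k) f0 g0) ∧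
    (∀ f ∈ classD0 d τ c k, ∀ g ∈ classDε d τ c k,
      ∀ (Ω : Type) (_ : MeasurableSpace Ω) (μ : Measure Ω) (_ : IsProbabilityMeasure μ)
        (ξ η : ℤ → ι → Lp ℂ 2 μ), IsRealization d τ f g μ ξ η →
      optMse d τ (Dτ d τ a) f g = ENNReal.ofReal
        (Metric.infDist (functional (Dτ d τ a) ξ) (past ξ η : Set (Lp ℂ 2 μ)) ^ 2)) := by
  have hb : Summable fun j => ‖Dτ d τ a j‖ :=
    ha.of_nonneg_of_le (fun j => norm_nonneg _) fun j =>
      le_mul_of_one_le_left (norm_nonneg _) (by linarith [(Nat.cast_nonneg j : (0 : ℝ) ≤ j)])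
  have hmain : ∀ f0 ∈ classD0 d τ c k, ∀ g0 ∈ classDε d τ c k, Minimality d τ f0 g0 →
      SolvesProblem d τ (Dτ d τ a) (classPair d τ c k) f0 g0 →
      RobustSolution d τ (Dτ d τ a) (classPair d τ c k) f0 g0 := fun f0 hf0 g0 hg0 =>
    robustSolution_of_solvesProblem hτ hb
      (fun p hp => ⟨isSpectralDensity_of_mem_classD0 hp.1, isSpectralDensity_of_mem_classDε hp.2⟩)
      ⟨hf0, hg0⟩ fun p hp t ht0 ht1 =>
        ⟨mix_mem_classD0 ht0.le ht1.le hf0 hp.1, mix_mem_classDε ht0.le ht1.le hg0 hp.2⟩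
  refine ⟨fun f0 hf0 g0 hg0 _ => hmain f0 hf0 g0 hg0, hmain,
    fun f hf g hg Ω _ μ _ ξ η hr => ?_⟩
  exact optMse_eq_infDist (isSpectralDensity_of_mem_classD0 hf)
    (isSpectralDensity_of_mem_classDε hg) hb hr
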